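/- **Setting.** Let $\hat f(\xi)=\int_{\mathbb R^3}e^{-ix\cdot\xi}f(x)\,dx$, extended to tempered distributions. Fix nonnegative Schwartz functions $\varphi,\psi$ on $\mathbb R^3$, supported in $\{|\xi|\le \frac43\}$ and $\{\frac34\le|\xi|\le\frac83\}$ respectively, with $\sum_{j\in\mathbb Z}\psi(2^{-j}\xi)=1$ for $\xi\ne0$ and $\varphi(\xi)+\sum_{j\ge0}\psi(2^{-j}\xi)=1$ for all $\xi$. Put $\widehat{\Delta_jf}=\psi(2^{-j}\cdot)\hat f$ and $\widehat{S_jf}=\varphi(2^{-j}\cdot)\hat f$. For $s\in\mathbb R$ and $1\le r,\lambda<\infty$, the space $F\dot B^{s}_{1,r}$ consists of the (vector-valued, complex) tempered distributions $f$ on $\mathbb R^3$ modulo polynomials, represented with $\hat f\in L^1_{loc}(\mathbb R^3)$, such that $$\|f\|_{F\dot B^{s}_{1,r}}=\Big(\sum_{j\in\mathbb Z}2^{jsr}\|\widehat{\Delta_jf}\|_{L^1}^r\Big)^{1/r}<\infty ,$$ and, for $0<T\le\infty$, $\tilde L^{\lambda}(0,T;F\dot B^{s}_{1,r})$ consists of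 the tempered distributions $f$ on $(0,T)\times\mathbb R^3$ with $S_jf\to0$ in $\mathcal S'((0,T)\times\mathbb R^3)$ as $j\to-\infty$ and $$\|f\|_{\tilde L^{\lambda}_T(F\dot B^{s}_{1,r})}=\Big(\sum_{j\in\mathbb Z}2^{jsr}\|\widehat{\Delta_jf}\|_{L^\lambda(0,T;L^1)}^r\Big)^{1/r}<\infty .$$ Consider the micropolar fluid system in $\mathbb R^3$ (with $\kappa=\mu=1$, $\chi=\nu=\frac12$) $$\begin{cases}\partial_tu-\Delta u+u\cdot\nabla u+\nabla\pi-\nabla\times\omega=0,\\ \partial_t\omega-\Delta\omega+u\cdot\nabla\omega+2\omega-\nabla\operatorname{div}\omega-\nabla\times u=0,\\ \operatorname{div}u=0,\qquad (u,\omega)|_{t=0}=(u_0,\omega_0).\end{cases}$$ Write $U=(u,\omega)$ and $U_0=(u_0,\omega_0)$. Let $\widehat{G(t)f}(\xi)=e^{-t\mathcal A(\xi)}\hat f(\xi)$, where $$\mathcal A(\xi)=\begin{bmatrix}|\xi|^2I&\mathcal B(\xi)\\ \mathcal B(\xi)&(|\xi|^2+2)I+\xi\xi^{T}\end{bmatrix},\qquad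 \mathcal B(\xi)=i\begin{bmatrix}0&\xi_3&-\xi_2\\-\xi_3&0&\xi_1\\ \xi_2&-\xi_1&0\end{bmatrix},$$ let $\mathbf P$ be the Leray projection, with symbol $\delta_{ij}-\xi_i\xi_j/|\xi|^2$, and let $\tilde{\mathbf P}\nabla\cdot(U\tilde\otimes U)=\big(\mathbf P\nabla\cdot(u\otimes u),\ \nabla\cdot(u\otimes\omega)\big)$, where $\big(\nabla\cdot(u\otimes v)\big)_k=\sum_i\partial_i(u_iv_k)$. A *mild solution* on $[0,T)$ is a solution $U$ of $$U(t)=G(t)U_0-\int_0^tG(t-\tau)\,\tilde{\mathbf P}\nabla\cdot(U\tilde\otimes U)(\tau)\,d\tau,\qquad t\in[0,T).$$ **Theorem.** Let $r\in[1,2]$ and $\alpha\in(0,1)$, and for $0<T\le\infty$ set $$Y_T=C\big([0,T);F\dot B^{-1}_{1,r}\big)\cap\tilde L^{\frac2{1+\alpha}}\big(0,T;F\dot B^{\alpha}_{1,r}\big)\cap\tilde L^{\frac2{1-\alpha}}\big(0,T;F\dot B^{-\alpha}_{1,r}\big).$$ 1. For every $(u_0,\omega_0)\in F\dot B^{-1}_{1,r}$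 with $\operatorname{div}u_0=0$ there is $T\in(0,\infty)$ such that the system has a unique mild solution $(u,\omega)\in Y_T$ on $[0,T)$ with initial data $(u_0,\omega_0)$. 2. There is $\epsilon>0$ such that for every $(u_0,\omega_0)\in F\dot B^{-1}_{1,r}$ with $\operatorname{div}u_0=0$ and $\|(u_0,\omega_0)\|_{F\dot B^{-1}_{1,r}}<\epsilon$ the system has a unique global mild solution $(u,\omega)\in Y_\infty$ with initial data $(u_0,\omega_0)$. -/

import Mathlib

open MeasureTheory Filter Topology Set
open scoped SchwartzMap FourierTransform LineDeriv ENNReal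

noncomputable section

namespace Micropolar

/-- Physical space (and frequency space) `ℝ³`. -/
abbrev R3 : Type := EuclideanSpace ℝ (Fin 3)

/-- The index set of the six components of `U = (u, ω)`: `Sum.inl i` is the component `u_i` and
`Sum.inr i` is the component `ω_i`. -/
abbrev Idx : Type := Fin 3 ⊕ Fin 3

/-- The space `ℂ⁶` in which `U = (u, ω)` takes its values. -/
abbrev C6 : Type := EuclideanSpace ℂ Idx

/-- The space `ℂ^{3 × 6}` in which `u ⊗ U = (u ⊗ u, u ⊗ ω)` takes its values. -/
abbrev C3x6 : Type := EuclideanSpace ℂ (Fin 3 × Idx)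

/-! ### Distributions given by functions, and the Fourier transform -/

section Distributions

variable {F : Type*} [NormedAddCommGroup F] [NormedSpace ℂ F]

/-- The tempered distribution `f` is given by the locally integrable function `a`. (Test functions
of compact support are dense in the Schwartz space, so they determine `f`.) -/
def HasFn (f : 𝓢'(R3, F)) (a : R3 → F) : Prop :=
  LocallyIntegrable a volume ∧
    ∀ φ : 𝓢(R3, ℂ), HasCompactSupport φ → f φ = ∫ x, φ x • a x

/-- The Fourier transform of the tempered distribution `f`, in the normalization
`f̂(ξ) = ∫ exp(-i x·ξ) f(x) dx`, is given by the locally integrable function `g`. Mathlib's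
transform `𝓕` uses `exp(-2π i x·η)`, hence `(𝓕 f)(η) = f̂(2π η)`. -/
def HasFourierFn (f : 𝓢'(R3, F)) (g : R3 → F) : Prop :=
  HasFn (𝓕 f) (fun η => g ((2 * Real.pi) • η))

open Classical in
/-- The function `f̂`, when `f̂ ∈ L¹_loc(ℝ³)` (it is unique almost everywhere), and `0` when `f̂` is
not a locally integrable function. -/
def hat (f : 𝓢'(R3, F)) : R3 → F :=
  if h : ∃ g, HasFourierFn f g then h.choose else 0

end Distributions

/-! ### Littlewood-Paley decomposition and function spaces -/

/-- A Littlewood-Paley pair `(φ, ψ)`: the cut-off functions of a dyadic partition of unity. -/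
structure LittlewoodPaley where
  φ : 𝓢(R3, ℝ)
  ψ : 𝓢(R3, ℝ)
  φ_nonneg : ∀ ξ, 0 ≤ φ ξ
  ψ_nonneg : ∀ ξ, 0 ≤ ψ ξ
  φ_support : ∀ ξ, φ ξ ≠ 0 → ‖ξ‖ ≤ 4 / 3
  ψ_support : ∀ ξ, ψ ξ ≠ 0 → 3 / 4 ≤ ‖ξ‖ ∧ ‖ξ‖ ≤ 8 / 3
  sum_ψ : ∀ ξ, ξ ≠ 0 → HasSum (fun j : ℤ => ψ ((2 : ℝ) ^ (-j) • ξ)) 1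
  φ_add_sum_ψ : ∀ ξ, HasSum (fun j : ℕ => ψ ((2 : ℝ) ^ (-(j : ℤ)) • ξ)) (1 - φ ξ)

/-- The norm `‖(Δ_j f)^‖_{L¹}`, where `(Δ_j f)^(ξ) = ψ(2^{-j} ξ) f̂(ξ)`. -/
def blockNorm (D : LittlewoodPaley) (j : ℤ) (f : 𝓢'(R3, C6)) : ℝ≥0∞ :=
  ∫⁻ ξ, ‖D.ψ ((2 : ℝ) ^ (-j) • ξ) • hat f ξ‖ₑ

/-- The function `S_j f (x) = (2π)⁻³ ∫ exp(i x·ξ) φ(2^{-j} ξ) f̂(ξ) dξ`. -/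
def lowFreq (D : LittlewoodPaley) (j : ℤ) (f : 𝓢'(R3, C6)) (x : R3) : C6 :=
  ((2 * Real.pi : ℝ) ^ (-3 : ℤ)) •
    ∫ ξ, Complex.exp (Complex.I * (inner ℝ x ξ : ℝ)) • D.φ ((2 : ℝ) ^ (-j) • ξ) • hat f ξ

/-- The weighted sequence norm `(∑_j 2^{j s r} (c_j)^r)^{1/r}`, for `1 ≤ r < ∞`. -/
def dyadicNorm (s r : ℝ) (c : ℤ → ℝ≥0∞) : ℝ≥0∞ :=
  (∑' j : ℤ, (ENNReal.ofReal ((2 : ℝ) ^ ((j : ℝ) * s)) * c j) ^ r) ^ (1 / r)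

/-- The norm of the homogeneous Fourier-Besov space `FḂ^s_{1,r}(ℝ³)`. -/
def fbNorm (D : LittlewoodPaley) (s r : ℝ) (f : 𝓢'(R3, C6)) : ℝ≥0∞ :=
  dyadicNorm s r (fun j => blockNorm D j f)

/-- Membership in the homogeneous Fourier-Besov space `FḂ^s_{1,r}(ℝ³)`. A class of tempered
distributions modulo polynomials, with Fourier transform in `L¹_loc`, is represented by its unique
element whose Fourier transform is a locally integrable function on `ℝ³`. -/
def MemFB (D : LittlewoodPaley) (s r : ℝ) (f : 𝓢'(R3, C6)) : Prop :=
  (∃ g, HasFourierFn f g) ∧ fbNorm D s r f < ∞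

/-- The time interval `[0, T)`, for `0 < T ≤ ∞`. -/
def timeIco (T : EReal) : Set ℝ := {t | 0 ≤ t ∧ (t : EReal) < T}

/-- The time interval `(0, T)`, for `0 < T ≤ ∞`. -/
def timeIoo (T : EReal) : Set ℝ := {t | 0 < t ∧ (t : EReal) < T}

/-- `U ∈ C([0, T); FḂ^s_{1,r}(ℝ³))`. -/
def MemCFB (D : LittlewoodPaley) (s r : ℝ) (T : EReal) (U : ℝ → 𝓢'(R3, C6)) : Prop :=
  (∀ t ∈ timeIco T, MemFB D s r (U t)) ∧
    ∀ t₀ ∈ timeIco T,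
      Tendsto (fun t => fbNorm D s r (U t - U t₀)) (𝓝[timeIco T] t₀) (𝓝 0)

/-- The Chemin-Lerner norm `‖U‖_{L̃^q_T(FḂ^s_{1,r})}`, for `1 ≤ q < ∞`. -/
def clNorm (D : LittlewoodPaley) (s r q : ℝ) (T : EReal) (U : ℝ → 𝓢'(R3, C6)) : ℝ≥0∞ :=
  dyadicNorm s r (fun j => (∫⁻ t in timeIoo T, blockNorm D j (U t) ^ q) ^ (1 / q))

/-- The time-dependent distribution `U` belongs to the Chemin-Lerner space
`L̃^q(0, T; FḂ^s_{1,r}(ℝ³))`: its norm is finite, and `S_j U → 0` in the sense of tempered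
distributions on `(0, T) × ℝ³` as `j → -∞`. -/
def MemCL (D : LittlewoodPaley) (s r q : ℝ) (T : EReal) (U : ℝ → 𝓢'(R3, C6)) : Prop :=
  (∀ᵐ t ∂(volume.restrict (timeIoo T)), ∃ g, HasFourierFn (U t) g) ∧
  clNorm D s r q T U < ∞ ∧
  ∀ Φ : 𝓢(ℝ × R3, ℂ), tsupport Φ ⊆ timeIoo T ×ˢ univ →
    (∀ j : ℤ, IntegrableOn (fun z : ℝ × R3 => Φ z • lowFreq D j (U z.1) z.2)
      (timeIoo T ×ˢ univ)) ∧
    Tendsto (fun j : ℤ => ∫ z in timeIoo T ×ˢ univ, Φ z • lowFreq D j (U z.1) z.2)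
      atBot (𝓝 0)

/-- The solution class `C([0,T); FḂ^{-1}_{1,r}) ∩ L̃^{2/(1+α)}(0,T; FḂ^α_{1,r}) ∩
L̃^{2/(1-α)}(0,T; FḂ^{-α}_{1,r})`. -/
def SolutionClass (D : LittlewoodPaley) (r α : ℝ) (T : EReal) (U : ℝ → 𝓢'(R3, C6)) : Prop :=
  MemCFB D (-1) r T U ∧
  MemCL D α r (2 / (1 + α)) T U ∧
  MemCL D (-α) r (2 / (1 - α)) T U

/-! ### The micropolar system in mild form -/

/-- `div u₀ = 0` in the sense of distributions, for `U₀ = (u₀, ω₀)`. -/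
def IsDivFree (U₀ : 𝓢'(R3, C6)) : Prop :=
  ∀ φ : 𝓢(R3, ℂ), ∑ i : Fin 3, U₀ (∂_{EuclideanSpace.single i (1 : ℝ)} φ) (Sum.inl i) = 0

/-- The matrix `ℬ(ξ)`, the symbol of `-∇×`. -/
def symB (ξ : R3) : Matrix (Fin 3) (Fin 3) ℂ :=
  Complex.I • !![0, (ξ 2 : ℂ), -(ξ 1 : ℂ);
                 -(ξ 2 : ℂ), 0, (ξ 0 : ℂ);
                 (ξ 1 : ℂ), -(ξ 0 : ℂ), 0]

/-- The matrix `𝒞(ξ) = ξ ξᵀ`, the symbol of `-∇ div`. -/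
def symC (ξ : R3) : Matrix (Fin 3) (Fin 3) ℂ :=
  Matrix.of fun i k => (ξ i : ℂ) * (ξ k : ℂ)

/-- The symbol `𝒜(ξ)` of the linearized system (with `κ = μ = 1`, `χ = ν = 1/2`). -/
def symA (ξ : R3) : Matrix Idx Idx ℂ :=
  Matrix.fromBlocks
    (((‖ξ‖ ^ 2 : ℝ) : ℂ) • 1) (symB ξ)
    (symB ξ) (((‖ξ‖ ^ 2 + 2 : ℝ) : ℂ) • 1 + symC ξ)

/-- The symbol `exp(-t 𝒜(ξ))` of the linear solution operator `G(t)`. -/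
def symG (t : ℝ) (ξ : R3) : Matrix Idx Idx ℂ :=
  NormedSpace.exp (((-t : ℝ) : ℂ) • symA ξ)

/-- The symbol of `diag(𝐏, I)`, with `𝐏` the Leray projection, of symbol
`δ_{ik} - ξ_i ξ_k / |ξ|²`. -/
def symP (ξ : R3) : Matrix Idx Idx ℂ :=
  Matrix.fromBlocks
    (Matrix.of fun i k =>
      (if i = k then (1 : ℂ) else 0) - (ξ i : ℂ) * (ξ k : ℂ) / ((‖ξ‖ ^ 2 : ℝ) : ℂ)) 0
    0 1

/-- The divergence on the Fourier side: `(∇·N)^_k(ξ) = ∑_i i ξ_i N̂_{ik}(ξ)`. -/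
def divHat (ξ : R3) (n : C3x6) : Idx → ℂ :=
  fun k => ∑ i : Fin 3, Complex.I * (ξ i : ℂ) * n (i, k)

/-- The distribution `U = (u, ω)` is given by a function, whose tensor product
`u ⊗ U = (u_i U_k)_{i,k}` is locally integrable and gives the distribution `N`, and `N̂` is a
locally integrable function. -/
def IsTensor (U : 𝓢'(R3, C6)) (N : 𝓢'(R3, C3x6)) : Prop :=
  (∃ a : R3 → C6, HasFn U a ∧
    HasFn N (fun x => WithLp.toLp 2 fun p : Fin 3 × Idx => a x (Sum.inl p.1) * a x p.2)) ∧
  ∃ g, HasFourierFn N g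

/-- The Fourier transform of `G(t) 𝐏̃ ∇·N` at `ξ`. -/
def duhamelHat (t : ℝ) (N : 𝓢'(R3, C3x6)) (ξ : R3) : C6 :=
  WithLp.toLp 2 ((symG t ξ * symP ξ).mulVec (divHat ξ (hat N ξ)))

/-- The Fourier transform of `G(t) U₀` at `ξ`. -/
def linearHat (t : ℝ) (U₀ : 𝓢'(R3, C6)) (ξ : R3) : C6 :=
  WithLp.toLp 2 ((symG t ξ).mulVec (hat U₀ ξ).ofLp)

/-- `U` is a mild solution on `[0, T)` with initial data `U₀`:
`U(t) = G(t) U₀ - ∫_0^t G(t-τ) 𝐏̃ ∇·(U ⊗̃ U)(τ) dτ` for all `t ∈ [0, T)`. The product `U ⊗̃ U`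
is the pointwise product of functions, for almost every `τ`, and the identity between distributions
is written on the Fourier side: both sides are tested with the functions `φ`, and the time
integral is the integral of the tested integrand. -/
def IsMildSolution (T : EReal) (U₀ : 𝓢'(R3, C6)) (U : ℝ → 𝓢'(R3, C6)) : Prop :=
  (∀ t ∈ timeIco T, ∃ g, HasFourierFn (U t) g) ∧
  ∃ N : ℝ → 𝓢'(R3, C3x6),
    (∀ᵐ τ ∂(volume.restrict (timeIoo T)), IsTensor (U τ) (N τ)) ∧
    ∀ t ∈ timeIco T, ∀ φ : 𝓢(R3, ℂ), HasCompactSupport φ →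
      IntervalIntegrable (fun τ => ∫ ξ, φ ξ • duhamelHat (t - τ) (N τ) ξ) volume 0 t ∧
      ∫ ξ, φ ξ • hat (U t) ξ =
        (∫ ξ, φ ξ • linearHat t U₀ ξ) -
          ∫ τ in (0 : ℝ)..t, ∫ ξ, φ ξ • duhamelHat (t - τ) (N τ) ξ

end Micropolar

end

/-!
Everything happens on the Fourier side. If `v₀` is the Fourier transform of the data and `n(τ, ·)`
that of `u ⊗ U` at time `τ`, a mild solution has the Fourier transform
`velHat v₀ n t = e^{-t𝒜} v₀ - ∫_0^t e^{-(t-τ)𝒜} (diag(𝐏, I) iξ · n(τ)) dτ`, and being a mild solution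
means that `n` is the convolution square `tensorHat` of `velHat v₀ n`. The unknown of the fixed
point problem is this quadratic term `n`, in the Banach space `L¹((0, T) × ℝ³)`, and not `U` itself.

*Linear estimates.* The Hermitian matrix `𝒜(ξ)` is bounded below by `|ξ|²/2`, although the coupling
`ℬ(ξ)` is of first order, because of the damping `2ω`. So
`|e^{-t𝒜(ξ)} x| ≤ e^{-t|ξ|²/2} |x|` (`norm_flowHat_le`), as for the heat flow. As the kernel
`|ξ| e^{-t|ξ|²/2}` has norm at most `1` in `L²_t`, uniformly in `ξ`, the Duhamel term maps
`L¹((0, T) × ℝ³)` to `L²(0, T; L¹)` (`lintegral_sq_duhamelInt_le`), and in the same way to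
`L̃^q(0, T; FḂ^{-1+2/q}_{1,1})` for all `q ≥ 1` (`dyadicNorm_duhamelInt_le`) and to
`C([0, T); FḂ^{-1}_{1,1})` (`tendsto_tsum_blockMass_duhamelInt_sub`).

*Quadratic estimate.* By Young's inequality the convolution square maps `L²(0, T; L¹)` to
`L¹((0, T) × ℝ³)`, and it is Lipschitz on bounded sets. Hence the map of the fixed point problem is
a contraction of a small ball as soon as the free evolution is small in `L²(0, T; L¹)`
(`exists_isFixedPoint`).

*The role of `r ≤ 2` and of the Chemin-Lerner spaces.* The sum over dyadic blocks which gives the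
`L¹` norm is controlled in `L²_t` by the norms of `L̃^{2/(1+α)}(FḂ^α_{1,2})` and
`L̃^{2/(1-α)}(FḂ^{-α}_{1,2})` (`exists_interpolation`): the product of the blocks `j` and `k` is
estimated by Hölder's inequality with the smoother norm on the higher frequency, which gains the
factor `2^{-α|j-k|}`. So the free evolution of data in `FḂ^{-1}_{1,r}` has a finite norm in
`L²(0, ∞; L¹)`, bounded by the norm of the data (`exists_lintegral_sq_flowHat_le`). This norm is
small for small data, and over short time intervals for all data.

*Uniqueness.* The same embedding shows that every solution in the solution class is in
`L²(0, T; L¹)`, so that its quadratic term is a fixed point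
(`exists_isFixedPoint_of_isMildSolution`); the joint measurability that this requires comes from the
continuity in time. Two fixed points coincide because the map is a contraction for their difference
on a short interval after the last time up to which they agree
(`IsFixedPoint.lintegral_sub_eq_zero`).
-/

noncomputable section

namespace Micropolar

/-! ### Tempered distributions given by functions -/

section Cutoff

variable {E : Type*} [NormedAddCommGroup E] [InnerProductSpace ℝ E] [FiniteDimensional ℝ E]

/-- Compactly supported functions are dense in the Schwartz space: the cut-offs `χ(x / k) f(x)`
converge to `f`, since `χ(x / k) - 1` vanishes for `‖x‖ < k` and has bounded derivatives. -/
theorem exists_compactSupport_tendsto (f : 𝓢(E, ℂ)) :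
    ∃ g : ℕ → 𝓢(E, ℂ), (∀ k, HasCompactSupport (g k)) ∧ Tendsto g atTop (𝓝 f) := by
  let χ : ContDiffBump (0 : E) := ⟨1, 2, one_pos, one_lt_two⟩
  let c : E → ℂ := fun x => (χ x : ℂ)
  have hc_supp : HasCompactSupport c := χ.hasCompactSupport.comp_left (g := Complex.ofReal) rfl
  have hc_smooth : ContDiff ℝ (⊤ : ℕ∞) c := Complex.ofRealCLM.contDiff.comp χ.contDiff
  let a : ℕ → ℝ := fun k => ((k : ℝ) + 1)⁻¹
  have ha : ∀ k, 0 < a k := fun k => by positivity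
  have ha1 : ∀ k, a k ≤ 1 := fun k => inv_le_one_of_one_le₀ (by linarith [k.cast_nonneg (α := ℝ)])
  let cut : ℕ → E → ℂ := fun k x => c (a k • x)
  have hcut_supp : ∀ k, HasCompactSupport (cut k) := fun k =>
    hc_supp.comp_homeomorph (Homeomorph.smulOfNeZero (a k) (ha k).ne')
  have hcut_smooth : ∀ k, ContDiff ℝ (⊤ : ℕ∞) (cut k) := fun k =>
    hc_smooth.comp (contDiff_const_smul (a k))
  have hcut_tg : ∀ k, (cut k).HasTemperateGrowth := fun k =>
    (hcut_supp k).hasTemperateGrowth (hcut_smooth k)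
  refine ⟨fun k => SchwartzMap.smulLeftCLM ℂ (cut k) f, fun k => ?_, ?_⟩
  · rw [show ((SchwartzMap.smulLeftCLM ℂ (cut k) f : 𝓢(E, ℂ)) : E → ℂ) = fun x => cut k x • f x from
      funext fun x => SchwartzMap.smulLeftCLM_apply_apply (hcut_tg k) f x]
    exact (hcut_supp k).smul_right
  rw [(schwartz_withSeminorms ℝ E ℂ).tendsto_nhds]
  rintro ⟨p, n⟩ ε hε
  -- bounds for the derivatives of `χ - 1`, uniform in the dilation
  let h : E → ℂ := fun x => c x - 1
  have h_smooth : ContDiff ℝ (⊤ : ℕ∞) h := hc_smooth.sub contDiff_const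
  have hbd : ∀ i : ℕ, ∃ C : ℝ, 0 ≤ C ∧ ∀ x, ‖iteratedFDeriv ℝ i h x‖ ≤ C := by
    intro i
    have hcont : Continuous (iteratedFDeriv ℝ i h) :=
      h_smooth.continuous_iteratedFDeriv (by exact_mod_cast le_top)
    obtain ⟨C, hC⟩ := (isCompact_closedBall (0 : E) 3).exists_bound_of_continuousOn hcont.continuousOn
    refine ⟨max C 1, by positivity, fun x => ?_⟩
    by_cases hx : x ∈ Metric.closedBall (0 : E) 3
    · exact (hC x hx).trans (le_max_left _ _)
    · have hloc : h =ᶠ[𝓝 x] fun _ => -1 := by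
        have : (Metric.closedBall (0 : E) 3)ᶜ ∈ 𝓝 x :=
          Metric.isClosed_closedBall.isOpen_compl.mem_nhds hx
        filter_upwards [this] with y hy
        have : χ y = 0 := by
          apply χ.zero_of_le_dist
          simp only [mem_compl_iff, Metric.mem_closedBall, not_le] at hy
          change (2 : ℝ) ≤ _
          linarith
        simp [h, c, this]
      rw [(hloc.iteratedFDeriv ℝ i).eq_of_nhds]
      rcases Nat.eq_zero_or_pos i with rfl | hi
      · simp
      · rw [iteratedFDeriv_const_of_ne (𝕜 := ℝ) hi.ne']
        simp
  choose C hC0 hC using hbd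
  let S : ℝ := ∑ i ∈ Finset.range (n + 1),
    (n.choose i : ℝ) * C i * SchwartzMap.seminorm ℝ (p + 1) (n - i) f
  have hS : 0 ≤ S := Finset.sum_nonneg fun i _ =>
    mul_nonneg (mul_nonneg (by positivity) (hC0 i)) (apply_nonneg _ _)
  have key : ∀ k, SchwartzMap.seminorm ℝ p n (SchwartzMap.smulLeftCLM ℂ (cut k) f - f) ≤ a k * S := by
    intro k
    refine SchwartzMap.seminorm_le_bound ℝ p n _ (mul_nonneg (ha k).le hS) fun x => ?_
    have heq : ((SchwartzMap.smulLeftCLM ℂ (cut k) f - f : 𝓢(E, ℂ)) : E → ℂ)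
        = fun y => h (a k • y) • f y := by
      ext y
      simp [SchwartzMap.smulLeftCLM_apply_apply (hcut_tg k), h, cut, sub_mul]
    rw [heq]
    by_cases hx : ‖x‖ < (k : ℝ) + 1
    · have hloc : (fun y => h (a k • y) • f y) =ᶠ[𝓝 x] fun _ => 0 := by
        have : Metric.ball (0 : E) (k + 1) ∈ 𝓝 x := Metric.isOpen_ball.mem_nhds (by simpa using hx)
        filter_upwards [this] with y hy
        have : χ (a k • y) = 1 := by
          apply χ.one_of_mem_closedBall
          rw [Metric.mem_closedBall, dist_zero_right, norm_smul, Real.norm_of_nonneg (ha k).le]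
          rw [mem_ball_zero_iff] at hy
          change _ ≤ (1 : ℝ)
          rw [inv_mul_le_iff₀ (by positivity)]
          linarith
        simp [h, c, this]
      rw [(hloc.iteratedFDeriv ℝ n).eq_of_nhds, iteratedFDeriv_fun_zero]
      simp only [Pi.zero_apply, norm_zero, mul_zero]
      exact mul_nonneg (ha k).le hS
    · have hx1 : 1 ≤ a k * ‖x‖ := by
        rw [not_lt] at hx
        rw [← div_eq_inv_mul, one_le_div (by positivity)]
        exact hx
      have hsm : ContDiff ℝ (⊤ : ℕ∞) fun y => h (a k • y) := h_smooth.comp (contDiff_const_smul (a k))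
      have hL := norm_iteratedFDeriv_smul_le (𝕜 := ℝ) hsm (f.smooth ⊤) x (n := n)
        (by exact_mod_cast le_top)
      calc ‖x‖ ^ p * ‖iteratedFDeriv ℝ n (fun y => h (a k • y) • f y) x‖
          ≤ ‖x‖ ^ p * ∑ i ∈ Finset.range (n + 1), (n.choose i : ℝ) *
              ‖iteratedFDeriv ℝ i (fun y => h (a k • y)) x‖ * ‖iteratedFDeriv ℝ (n - i) f x‖ := by
            gcongr
        _ = ∑ i ∈ Finset.range (n + 1), (n.choose i : ℝ) *
              ‖iteratedFDeriv ℝ i (fun y => h (a k • y)) x‖ *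
                (‖x‖ ^ p * ‖iteratedFDeriv ℝ (n - i) f x‖) := by
            rw [Finset.mul_sum]; exact Finset.sum_congr rfl fun i _ => by ring
        _ ≤ ∑ i ∈ Finset.range (n + 1), (n.choose i : ℝ) * C i *
              (a k * SchwartzMap.seminorm ℝ (p + 1) (n - i) f) := by
            refine Finset.sum_le_sum fun i _ => ?_
            have h1 : ‖iteratedFDeriv ℝ i (fun y => h (a k • y)) x‖ ≤ C i := by
              rw [iteratedFDeriv_comp_const_smul (𝕜 := ℝ) (a k)
                (h_smooth.of_le (by exact_mod_cast le_top)), norm_smul, norm_pow,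
                Real.norm_of_nonneg (ha k).le]
              calc _ ≤ 1 * C i := mul_le_mul (pow_le_one₀ (ha k).le (ha1 k)) (hC i _)
                    (norm_nonneg _) zero_le_one
                _ = C i := one_mul _
            have h2 : ‖x‖ ^ p * ‖iteratedFDeriv ℝ (n - i) f x‖ ≤
                a k * SchwartzMap.seminorm ℝ (p + 1) (n - i) f := by
              calc ‖x‖ ^ p * ‖iteratedFDeriv ℝ (n - i) f x‖
                  ≤ (a k * ‖x‖) * (‖x‖ ^ p * ‖iteratedFDeriv ℝ (n - i) f x‖) :=
                    le_mul_of_one_le_left (by positivity) hx1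
                _ = a k * (‖x‖ ^ (p + 1) * ‖iteratedFDeriv ℝ (n - i) f x‖) := by ring
                _ ≤ _ := by
                    gcongr
                    exact SchwartzMap.le_seminorm ℝ _ _ f x
            have := hC0 i
            gcongr
        _ = a k * S := by
            rw [Finset.mul_sum]; exact Finset.sum_congr rfl fun i _ => by ring
  have hlim : Tendsto (fun k => a k * S) atTop (𝓝 0) := by
    have := (tendsto_inv_atTop_zero.comp
      (tendsto_atTop_add_const_right atTop (1 : ℝ) tendsto_natCast_atTop_atTop)).mul_const S
    simpa [a, Function.comp_def] using this
  filter_upwards [hlim.eventually (gt_mem_nhds hε)] with k hk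
  exact (key k).trans_lt hk

/-- Test functions of compact support determine a tempered distribution. -/
theorem tempered_ext_compactSupport {F : Type*} [NormedAddCommGroup F] [NormedSpace ℂ F]
    {S T : 𝓢'(E, F)} (h : ∀ φ : 𝓢(E, ℂ), HasCompactSupport φ → S φ = T φ) : S = T := by
  ext φ
  obtain ⟨g, hg, hlim⟩ := exists_compactSupport_tendsto φ
  have h1 := ((map_continuous S).tendsto φ).comp hlim
  have h2 := ((map_continuous T).tendsto φ).comp hlim
  refine tendsto_nhds_unique h1 (h2.congr fun k => ?_)
  exact (h _ (hg k)).symm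

end Cutoff

section FourierFn

variable {F : Type*} [NormedAddCommGroup F] [NormedSpace ℂ F]

theorem two_pi_ne_zero : (2 * Real.pi : ℝ) ≠ 0 := by positivity

theorem quasiMeasurePreserving_const_smul {c : ℝ} (hc : c ≠ 0) :
    Measure.QuasiMeasurePreserving (fun x : R3 => c • x) volume volume :=
  ⟨measurable_const_smul c, by
    rw [Measure.map_addHaar_smul volume hc]; exact Measure.smul_absolutelyContinuous⟩

theorem ae_of_ae_comp_smul {p : R3 → Prop} {c : ℝ} (hc : c ≠ 0) (h : ∀ᵐ x : R3, p (c • x)) :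
    ∀ᵐ x, p x := by
  have := (quasiMeasurePreserving_const_smul (inv_ne_zero hc)).ae h
  filter_upwards [this] with x hx
  rwa [smul_inv_smul₀ hc] at hx

theorem locallyIntegrable_comp_smul {G : Type*} [NormedAddCommGroup G] {g : R3 → G} {c : ℝ}
    (hc : c ≠ 0) (hg : LocallyIntegrable g volume) :
    LocallyIntegrable (fun x => g (c • x)) volume := by
  have := (locallyIntegrable_map_homeomorph (Homeomorph.smulOfNeZero c hc) (f := g)
    (μ := (volume : Measure R3))).1
  refine this ?_
  have h2 : Measure.map (Homeomorph.smulOfNeZero (α := R3) c hc) volume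
      = ENNReal.ofReal |(c ^ Module.finrank ℝ R3)⁻¹| • (volume : Measure R3) :=
    Measure.map_addHaar_smul volume hc
  rw [h2]
  intro x
  obtain ⟨U, hU, hi⟩ := hg x
  exact ⟨U, hU, by
    rw [IntegrableOn, Measure.restrict_smul]
    exact Integrable.smul_measure hi ENNReal.ofReal_ne_top⟩

theorem HasFn.congr {f : 𝓢'(R3, F)} {a b : R3 → F} (ha : HasFn f a) (hab : a =ᵐ[volume] b) :
    HasFn f b :=
  ⟨ha.1.congr hab, fun φ hφ => (ha.2 φ hφ).trans <|
    integral_congr_ae <| hab.mono fun x hx => by simp only [hx]⟩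

theorem HasFn.sub {f g : 𝓢'(R3, F)} {a b : R3 → F} (ha : HasFn f a) (hb : HasFn g b) :
    HasFn (f - g) (fun x => a x - b x) := by
  refine ⟨ha.1.sub hb.1, fun φ hφ => ?_⟩
  have h : (f - g) φ = f φ - g φ := rfl
  rw [h, ha.2 φ hφ, hb.2 φ hφ, ← integral_sub
    (ha.1.integrable_smul_left_of_hasCompactSupport φ.continuous hφ)
    (hb.1.integrable_smul_left_of_hasCompactSupport φ.continuous hφ)]
  simp only [smul_sub]

theorem HasFn.eq {f g : 𝓢'(R3, F)} {a : R3 → F} (hf : HasFn f a) (hg : HasFn g a) : f = g :=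
  tempered_ext_compactSupport fun φ hφ => (hf.2 φ hφ).trans (hg.2 φ hφ).symm

theorem HasFourierFn.locallyIntegrable {f : 𝓢'(R3, F)} {a : R3 → F} (ha : HasFourierFn f a) :
    LocallyIntegrable a volume := by
  have := locallyIntegrable_comp_smul (inv_ne_zero two_pi_ne_zero) ha.1
  simpa only [smul_inv_smul₀ two_pi_ne_zero] using this

theorem hasFourierFn_hat {f : 𝓢'(R3, F)} (h : ∃ g, HasFourierFn f g) : HasFourierFn f (hat f) := by
  rw [hat, dif_pos h]; exact h.choose_spec

theorem HasFourierFn.congr {f : 𝓢'(R3, F)} {a b : R3 → F} (ha : HasFourierFn f a)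
    (hab : a =ᵐ[volume] b) : HasFourierFn f b :=
  HasFn.congr ha ((quasiMeasurePreserving_const_smul two_pi_ne_zero).ae hab)

theorem HasFourierFn.sub {f g : 𝓢'(R3, F)} {a b : R3 → F} (ha : HasFourierFn f a)
    (hb : HasFourierFn g b) : HasFourierFn (f - g) (fun x => a x - b x) := by
  have h : 𝓕 (f - g) = 𝓕 f - 𝓕 g := by
    ext φ
    rfl
  unfold HasFourierFn
  rw [h]
  exact HasFn.sub ha hb

theorem HasFourierFn.eq {f g : 𝓢'(R3, F)} {a : R3 → F} (hf : HasFourierFn f a)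
    (hg : HasFourierFn g a) : f = g := by
  have h : 𝓕 f = 𝓕 g := HasFn.eq hf hg
  rw [← FourierTransform.fourierInv_fourier_eq (F := 𝓢'(R3, F)) f, h,
    FourierTransform.fourierInv_fourier_eq]

theorem aestronglyMeasurable_hat (f : 𝓢'(R3, F)) : AEStronglyMeasurable (hat f) volume := by
  by_cases h : ∃ g, HasFourierFn f g
  · exact (hasFourierFn_hat h).locallyIntegrable.aestronglyMeasurable
  · rw [hat, dif_neg h]; exact aestronglyMeasurable_zero

variable [CompleteSpace F]

/-- A locally integrable function is determined by its integrals against Schwartz functions of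
compact support. -/
theorem ae_eq_of_forall_integral_smul_eq {a b : R3 → F} (ha : LocallyIntegrable a volume)
    (hb : LocallyIntegrable b volume)
    (h : ∀ φ : 𝓢(R3, ℂ), HasCompactSupport φ → ∫ x, φ x • a x = ∫ x, φ x • b x) :
    a =ᵐ[volume] b := by
  let _ : NormedSpace ℝ F := NormedSpace.restrictScalars ℝ ℂ F
  refine ae_eq_of_integral_contDiff_smul_eq ha hb fun g g_smooth g_cpt => ?_
  have h1 : HasCompactSupport (Complex.ofRealCLM ∘ g) := g_cpt.comp_left rfl
  have h2 : ContDiff ℝ (⊤ : ℕ∞) (Complex.ofRealCLM ∘ g) := by fun_prop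
  exact h (h1.toSchwartzMap h2) h1

theorem HasFn.ae_eq {f : 𝓢'(R3, F)} {a b : R3 → F} (ha : HasFn f a) (hb : HasFn f b) :
    a =ᵐ[volume] b :=
  ae_eq_of_forall_integral_smul_eq ha.1 hb.1 fun φ hφ => (ha.2 φ hφ).symm.trans (hb.2 φ hφ)

theorem HasFourierFn.ae_eq {f : 𝓢'(R3, F)} {a b : R3 → F} (ha : HasFourierFn f a)
    (hb : HasFourierFn f b) : a =ᵐ[volume] b :=
  ae_of_ae_comp_smul two_pi_ne_zero (HasFn.ae_eq ha hb)

theorem HasFourierFn.hat_ae_eq {f : 𝓢'(R3, F)} {g : R3 → F} (h : HasFourierFn f g) :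
    hat f =ᵐ[volume] g :=
  (hasFourierFn_hat ⟨g, h⟩).ae_eq h

/-- If `g / (1 + |ξ|²)` is integrable, then `g` is the Fourier transform of a tempered
distribution. -/
theorem exists_hasFourierFn {g : R3 → F}
    (hg : Integrable (fun ξ => ((1 + ‖ξ‖ ^ 2 : ℝ) : ℂ)⁻¹ • g ξ)) :
    ∃ f : 𝓢'(R3, F), HasFourierFn f g := by
  have hw : ∀ ξ : R3, ((1 + ‖ξ‖ ^ 2 : ℝ) : ℂ) ≠ 0 := fun ξ => by
    exact_mod_cast (by positivity : (0 : ℝ) < 1 + ‖ξ‖ ^ 2).ne'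
  let w : R3 → ℂ := fun η => ((1 + ‖(2 * Real.pi) • η‖ ^ 2 : ℝ) : ℂ)
  have hwt : w.HasTemperateGrowth := by
    have : w = fun η : R3 => (1 + ((2 * Real.pi) ^ 2 : ℝ) * ((‖η‖ ^ 2 : ℝ) : ℂ) : ℂ) := by
      ext η
      simp only [w, norm_smul, mul_pow, Real.norm_of_nonneg Real.two_pi_pos.le]
      push_cast; ring
    rw [this]
    have h2 : Function.HasTemperateGrowth (fun η : R3 => ((‖η‖ ^ 2 : ℝ) : ℂ)) :=
      Function.HasTemperateGrowth.comp (Function.Complex.hasTemperateGrowth_ofReal)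
        (Function.hasTemperateGrowth_norm_sq R3)
    exact (Function.HasTemperateGrowth.const _).add ((Function.HasTemperateGrowth.const _).mul h2)
  have hint := hg.comp_smul two_pi_ne_zero
  let L : Lp F 1 (volume : Measure R3) := hint.toL1
  let T : 𝓢'(R3, F) := TemperedDistribution.smulLeftCLM F w (L : 𝓢'(R3, F))
  refine ⟨𝓕⁻ T, ?_, fun φ _ => ?_⟩
  · have := hint.locallyIntegrable.continuous_smul (𝕜 := ℂ) (g := w) (by fun_prop)
    refine this.congr (ae_of_all _ fun η => ?_)
    simp only [w]
    rw [smul_inv_smul₀ (hw _)]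
  · rw [FourierTransform.fourier_fourierInv_eq, TemperedDistribution.smulLeftCLM_apply_apply,
      Lp.toTemperedDistribution_apply]
    refine integral_congr_ae ?_
    filter_upwards [hint.coeFn_toL1] with η hη
    change _ • L η = _
    rw [show L η = _ from hη, SchwartzMap.smulLeftCLM_apply_apply hwt]
    simp only [w, smul_eq_mul, mul_comm _ (φ η), mul_smul]
    rw [smul_inv_smul₀ (hw _)]

/-- A tempered distribution with integrable Fourier transform is given by the inverse Fourier
integral. -/
theorem HasFourierFn.hasFn_fourierInv {f : 𝓢'(R3, F)} {g : R3 → F} (h : HasFourierFn f g)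
    (hg : Integrable g) : HasFn f (𝓕⁻ (fun η => g ((2 * Real.pi) • η))) := by
  set k : R3 → F := fun η => g ((2 * Real.pi) • η)
  have hk : Integrable k := hg.comp_smul two_pi_ne_zero
  have hT : 𝓕 f = (hk.toL1 : 𝓢'(R3, F)) := by
    refine tempered_ext_compactSupport fun φ hφ => ?_
    rw [h.2 φ hφ, Lp.toTemperedDistribution_apply]
    refine integral_congr_ae ?_
    filter_upwards [hk.coeFn_toL1] with η hη
    rw [hη]
  have hflip : ∀ φ : 𝓢(R3, ℂ), ∫ x, 𝓕⁻ φ x • k x = ∫ x, φ x • 𝓕⁻ k x := by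
    intro φ
    have h1 := VectorFourier.integral_fourierIntegral_smul_eq_flip (L := innerₗ R3)
      Real.continuous_fourierChar continuous_inner φ.integrable (μ := volume) (ν := volume)
      (hk.comp_neg)
    rw [flip_innerₗ] at h1
    have h2 : ∫ x, 𝓕⁻ φ x • k x = ∫ x, 𝓕 (φ : R3 → ℂ) x • k (-x) := by
      rw [← integral_neg_eq_self]
      refine integral_congr_ae (ae_of_all _ fun x => ?_)
      simp only
      rw [SchwartzMap.fourierInv_coe, Real.fourierInv_eq_fourier_neg, neg_neg]
    rw [h2]
    refine Eq.trans h1 ?_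
    refine integral_congr_ae (ae_of_all _ fun x => ?_)
    simp only [Real.fourierInv_eq_fourier_comp_neg]
    rfl
  refine ⟨?_, fun φ _ => ?_⟩
  · rw [Real.fourierInv_eq_fourier_comp_neg]
    refine Continuous.locallyIntegrable ?_
    exact VectorFourier.fourierIntegral_continuous Real.continuous_fourierChar continuous_inner
      hk.comp_neg
  · rw [← hflip, ← FourierTransform.fourierInv_fourier_eq (F := 𝓢'(R3, F)) f,
      TemperedDistribution.fourierInv_apply,
      hT, Lp.toTemperedDistribution_apply]
    refine integral_congr_ae ?_
    filter_upwards [hk.coeFn_toL1] with η hη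
    rw [hη]

end FourierFn

/-! ### The quadratic term on the Fourier side -/

section Tensor

open scoped Convolution

theorem norm_tensor_le (a b : C6) :
    ‖(WithLp.toLp 2 fun p : Fin 3 × Idx => a (Sum.inl p.1) * b p.2 : C3x6)‖ ≤ ‖a‖ * ‖b‖ := by
  have h : ‖(WithLp.toLp 2 fun p : Fin 3 × Idx => a (Sum.inl p.1) * b p.2 : C3x6)‖ ^ 2
      ≤ (‖a‖ * ‖b‖) ^ 2 := by
    rw [mul_pow, EuclideanSpace.norm_sq_eq, EuclideanSpace.norm_sq_eq, EuclideanSpace.norm_sq_eq,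
      Fintype.sum_prod_type]
    simp only [norm_mul, mul_pow]
    rw [← Finset.sum_mul_sum]
    gcongr
    rw [Fintype.sum_sum_type (fun i => ‖a i‖ ^ 2)]
    exact le_add_of_nonneg_right (by positivity)
  exact (pow_le_pow_iff_left₀ (norm_nonneg _) (by positivity) two_ne_zero).1 h

/-- The bilinear map `(u, ω), U' ↦ u ⊗ U'`. -/
def tensorL : C6 →L[ℂ] C6 →L[ℂ] C3x6 :=
  LinearMap.mkContinuous₂
    (LinearMap.mk₂ ℂ (fun a b => (WithLp.toLp 2 fun p : Fin 3 × Idx => a (Sum.inl p.1) * b p.2))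
      (fun a a' b => by ext p; simp [add_mul])
      (fun c a b => by ext p; simp [mul_assoc])
      (fun a b b' => by ext p; simp [mul_add])
      (fun c a b => by ext p; simp [mul_left_comm]))
    1 (fun a b => by rw [one_mul]; exact norm_tensor_le a b)

theorem enorm_tensorL_le (a b : C6) : ‖tensorL a b‖ₑ ≤ ‖a‖ₑ * ‖b‖ₑ := by
  rw [← ofReal_norm, ← ofReal_norm, ← ofReal_norm, ← ENNReal.ofReal_mul (norm_nonneg _)]
  exact ENNReal.ofReal_le_ofReal (norm_tensor_le a b)

/-- The Fourier transform of `u ⊗ U'`, given the Fourier transforms `a` of `U = (u, ω)` and `b` of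
`U'`: the convolution product, normalized by `(2π)⁻³`. -/
def tensorHat (a b : R3 → C6) (ξ : R3) : C3x6 :=
  ((2 * Real.pi : ℝ) ^ 3)⁻¹ • ∫ η, tensorL (a η) (b (ξ - η))

theorem tensorHat_eq (a b : R3 → C6) (ξ : R3) :
    tensorHat a b ξ = ((2 * Real.pi : ℝ) ^ 3)⁻¹ • (a ⋆[tensorL] b) ξ := rfl

theorem tensorHat_congr {a a' : R3 → C6} (h : a =ᵐ[volume] a') :
    tensorHat a a = tensorHat a' a' := by
  ext1 ξ
  rw [tensorHat_eq, tensorHat_eq, convolution_congr tensorL h h]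

theorem two_pi_pow_inv_le_one : ((2 * Real.pi : ℝ) ^ 3)⁻¹ ≤ 1 :=
  inv_le_one_of_one_le₀ (one_le_pow₀ (by linarith [Real.pi_gt_three]))

theorem enorm_two_pi_pow_inv_smul_le (x : C3x6) : ‖((2 * Real.pi : ℝ) ^ 3)⁻¹ • x‖ₑ ≤ ‖x‖ₑ := by
  rw [enorm_smul]
  refine mul_le_of_le_one_left zero_le ?_
  rw [← ofReal_norm, Real.norm_of_nonneg (by positivity)]
  exact ENNReal.ofReal_le_one.2 two_pi_pow_inv_le_one

theorem lintegral_convolution_enorm {a b : R3 → ℝ≥0∞} (ha : AEMeasurable a) (hb : AEMeasurable b) :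
    ∫⁻ ξ, ∫⁻ η, a η * b (ξ - η) = (∫⁻ ξ, a ξ) * ∫⁻ ξ, b ξ := by
  rw [lintegral_lintegral_swap]
  · have : ∀ η, ∫⁻ ξ, a η * b (ξ - η) = a η * ∫⁻ ξ, b ξ := fun η => by
      have hm : AEMeasurable (fun ξ => b (ξ - η)) := hb.comp_quasiMeasurePreserving
        (measurePreserving_sub_right volume η).quasiMeasurePreserving
      rw [lintegral_const_mul'' _ hm, lintegral_sub_right_eq_self]
    simp_rw [this]
    rw [lintegral_mul_const'' _ ha]
  · exact (ha.comp_quasiMeasurePreserving Measure.quasiMeasurePreserving_snd).mul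
      (hb.comp_quasiMeasurePreserving (quasiMeasurePreserving_sub_of_right_invariant _ _))

theorem lintegral_tensorHat_le {a b : R3 → C6} (ha : AEStronglyMeasurable a)
    (hb : AEStronglyMeasurable b) :
    ∫⁻ ξ, ‖tensorHat a b ξ‖ₑ ≤ (∫⁻ ξ, ‖a ξ‖ₑ) * ∫⁻ ξ, ‖b ξ‖ₑ := by
  rw [← lintegral_convolution_enorm ha.enorm hb.enorm]
  refine lintegral_mono fun ξ => (enorm_two_pi_pow_inv_smul_le _).trans ?_
  exact (enorm_integral_le_lintegral_enorm _).trans (lintegral_mono fun η => enorm_tensorL_le _ _)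

theorem integrable_tensorHat {a b : R3 → C6} (ha : Integrable a) (hb : Integrable b) :
    Integrable (tensorHat a b) :=
  (ha.integrable_convolution tensorL hb).smul (((2 * Real.pi : ℝ) ^ 3)⁻¹)

/-- The quadratic map `a ↦ a ⊗ a` is Lipschitz on bounded sets of `L¹`. -/
theorem lintegral_tensorHat_sub_le {a b : R3 → C6} (ha : Integrable a) (hb : Integrable b) :
    ∫⁻ ξ, ‖tensorHat a a ξ - tensorHat b b ξ‖ₑ
      ≤ ((∫⁻ ξ, ‖a ξ‖ₑ) + ∫⁻ ξ, ‖b ξ‖ₑ) * ∫⁻ ξ, ‖a ξ - b ξ‖ₑ := by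
  have hd : Integrable (fun ξ => a ξ - b ξ) := ha.sub hb
  have hae : ∀ᵐ ξ, ‖tensorHat a a ξ - tensorHat b b ξ‖ₑ
      ≤ ‖tensorHat a (fun ξ => a ξ - b ξ) ξ‖ₑ + ‖tensorHat (fun ξ => a ξ - b ξ) b ξ‖ₑ := by
    filter_upwards [ha.ae_convolution_exists tensorL ha, hb.ae_convolution_exists tensorL hb,
      ha.ae_convolution_exists tensorL hd, hd.ae_convolution_exists tensorL hb]
      with ξ h1 h2 h3 h4
    have : tensorHat a a ξ - tensorHat b b ξ
        = tensorHat a (fun ξ => a ξ - b ξ) ξ + tensorHat (fun ξ => a ξ - b ξ) b ξ := by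
      simp only [tensorHat]
      rw [← smul_sub, ← smul_add, ← integral_sub h1 h2, ← integral_add h3 h4]
      congr 1
      refine integral_congr_ae (ae_of_all _ fun η => ?_)
      simp
    rw [this]
    exact enorm_add_le _ _
  calc _ ≤ ∫⁻ ξ, (‖tensorHat a (fun ξ => a ξ - b ξ) ξ‖ₑ + ‖tensorHat (fun ξ => a ξ - b ξ) b ξ‖ₑ) :=
        lintegral_mono_ae hae
    _ = _ := lintegral_add_left' (integrable_tensorHat ha hd).aestronglyMeasurable.enorm _
    _ ≤ _ := by
        rw [add_mul]
        refine add_le_add (lintegral_tensorHat_le ha.1 hd.1) ?_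
        rw [mul_comm]
        exact lintegral_tensorHat_le hd.1 hb.1

theorem stronglyMeasurable_tensorHat {v : ℝ → R3 → C6}
    (hv : StronglyMeasurable (Function.uncurry v)) :
    StronglyMeasurable (fun z : ℝ × R3 => tensorHat (v z.1) (v z.1) z.2) := by
  have h1 : StronglyMeasurable (fun p : (ℝ × R3) × R3 => v p.1.1 p.2) :=
    hv.comp_measurable (g := fun p : (ℝ × R3) × R3 => (p.1.1, p.2)) (by fun_prop)
  have h2 : StronglyMeasurable (fun p : (ℝ × R3) × R3 => v p.1.1 (p.1.2 - p.2)) :=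
    hv.comp_measurable (g := fun p : (ℝ × R3) × R3 => (p.1.1, p.1.2 - p.2)) (by fun_prop)
  have h3 : StronglyMeasurable (fun p : (ℝ × R3) × R3 =>
      tensorL (v p.1.1 p.2) (v p.1.1 (p.1.2 - p.2))) :=
    (tensorL.continuous₂.comp_stronglyMeasurable (h1.prodMk h2))
  exact h3.integral_prod_right'.const_smul (((2 * Real.pi : ℝ) ^ 3)⁻¹)

theorem fourierInv_tensorHat {a b : R3 → C6} (ha : Integrable a) (hb : Integrable b) (x : R3) :
    𝓕⁻ (fun η => tensorHat a b ((2 * Real.pi) • η)) x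
      = tensorL (𝓕⁻ (fun η => a ((2 * Real.pi) • η)) x) (𝓕⁻ (fun η => b ((2 * Real.pi) • η)) x) := by
  have h : (fun η => tensorHat a b ((2 * Real.pi) • η))
      = (fun η => a ((2 * Real.pi) • η)) ⋆[tensorL] (fun η => b ((2 * Real.pi) • η)) := by
    ext1 η
    rw [convolution_def, tensorHat]
    have := Measure.integral_comp_smul (volume : Measure R3)
      (fun t => tensorL (a t) (b ((2 * Real.pi) • η - t))) (2 * Real.pi)
    simp only [← smul_sub] at this
    rw [this, finrank_euclideanSpace_fin, abs_of_nonneg (by positivity)]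
  simp only [Real.fourierInv_eq_fourier_neg]
  rw [h, Real.fourier_bilin_convolution_eq tensorL (ha.comp_smul two_pi_ne_zero)
    (hb.comp_smul two_pi_ne_zero)]

theorem integrable_weight_smul {F : Type*} [NormedAddCommGroup F] [NormedSpace ℂ F] {g : R3 → F}
    (hg : Integrable g) : Integrable (fun ξ => ((1 + ‖ξ‖ ^ 2 : ℝ) : ℂ)⁻¹ • g ξ) := by
  refine hg.mono ?_ (ae_of_all _ fun ξ => ?_)
  · refine AEStronglyMeasurable.smul ?_ hg.1
    refine Continuous.aestronglyMeasurable (Continuous.inv₀ (by fun_prop) fun ξ => ?_)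
    exact_mod_cast (by positivity : (0 : ℝ) < 1 + ‖ξ‖ ^ 2).ne'
  · rw [norm_smul, norm_inv, Complex.norm_real, Real.norm_of_nonneg (by positivity)]
    exact mul_le_of_le_one_left (norm_nonneg _) (inv_le_one_of_one_le₀ (by nlinarith [norm_nonneg ξ]))

theorem isTensor_of_hasFourierFn {U : 𝓢'(R3, C6)} {N : 𝓢'(R3, C3x6)} {a : R3 → C6}
    (hU : HasFourierFn U a) (ha : Integrable a) (hN : HasFourierFn N (tensorHat a a)) :
    IsTensor U N := by
  refine ⟨⟨_, hU.hasFn_fourierInv ha, ?_⟩, _, hN⟩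
  refine (hN.hasFn_fourierInv (integrable_tensorHat ha ha)).congr (ae_of_all _ fun x => ?_)
  rw [fourierInv_tensorHat ha ha]
  rfl

/-- If the velocity field has integrable Fourier transform, then the pointwise product
`u ⊗ U` has the convolution product as Fourier transform. -/
theorem IsTensor.hasFourierFn {U : 𝓢'(R3, C6)} {N : 𝓢'(R3, C3x6)} {a : R3 → C6}
    (h : IsTensor U N) (hU : HasFourierFn U a) (ha : Integrable a) :
    HasFourierFn N (tensorHat a a) := by
  obtain ⟨⟨b, hb, hN⟩, -⟩ := h
  obtain ⟨N', hN'⟩ := exists_hasFourierFn (integrable_weight_smul (integrable_tensorHat ha ha))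
  have h1 := hb.ae_eq (hU.hasFn_fourierInv ha)
  have h2 : HasFn N (𝓕⁻ (fun η => tensorHat a a ((2 * Real.pi) • η))) := by
    refine hN.congr ?_
    filter_upwards [h1] with x hx
    rw [fourierInv_tensorHat ha ha, hx]
    rfl
  rw [h2.eq (hN'.hasFn_fourierInv (integrable_tensorHat ha ha))]
  exact hN'

end Tensor

/-! ### The symbols of the linear flow and of the Duhamel term -/

section Symbols

/-- The symbol of `G(t)`, applied to a vector. -/
def flowHat (t : ℝ) (ξ : R3) (x : C6) : C6 := WithLp.toLp 2 ((symG t ξ).mulVec x.ofLp)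

/-- The symbol of `diag(𝐏, I) ∇·`, applied to a tensor. -/
def forceHat (ξ : R3) (n : C3x6) : C6 := WithLp.toLp 2 ((symP ξ).mulVec (divHat ξ n))

theorem norm_sq_R3 (ξ : R3) : ‖ξ‖ ^ 2 = ξ 0 ^ 2 + ξ 1 ^ 2 + ξ 2 ^ 2 := by
  rw [EuclideanSpace.real_norm_sq_eq, Fin.sum_univ_three]

/-- Coercivity of the symbol: writing `y = (a, b)`, the difference of the two sides is
`2 |b - (i/2) ξ × a|² + |ξ · a|² / 2 + |ξ|² |b|² / 2 + |ξ · b|²`. -/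
theorem half_norm_sq_le_re_inner_symA (ξ : R3) (y : C6) :
    ‖ξ‖ ^ 2 / 2 * ‖y‖ ^ 2 ≤ (inner ℂ y (WithLp.toLp 2 ((symA ξ).mulVec y.ofLp) : C6)).re := by
  obtain ⟨y, rfl⟩ := (WithLp.toLp_surjective 2) y
  rw [norm_sq_R3, EuclideanSpace.norm_sq_eq, PiLp.inner_apply]
  simp only [Fintype.sum_sum_type, Fin.sum_univ_three, symA, symB, symC, Matrix.mulVec, dotProduct,
    Matrix.fromBlocks_apply₁₁, Matrix.fromBlocks_apply₁₂, Matrix.fromBlocks_apply₂₁,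
    Matrix.fromBlocks_apply₂₂, Matrix.add_apply, Matrix.smul_apply, Matrix.one_apply,
    Matrix.of_apply, RCLike.inner_apply, norm_sq_R3]
  obtain ⟨a0, ha0⟩ : ∃ z, z = y (Sum.inl 0) := ⟨_, rfl⟩
  obtain ⟨a1, ha1⟩ : ∃ z, z = y (Sum.inl 1) := ⟨_, rfl⟩
  obtain ⟨a2, ha2⟩ : ∃ z, z = y (Sum.inl 2) := ⟨_, rfl⟩
  obtain ⟨b0, hb0⟩ : ∃ z, z = y (Sum.inr 0) := ⟨_, rfl⟩
  obtain ⟨b1, hb1⟩ : ∃ z, z = y (Sum.inr 1) := ⟨_, rfl⟩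
  obtain ⟨b2, hb2⟩ : ∃ z, z = y (Sum.inr 2) := ⟨_, rfl⟩
  obtain ⟨x, hx⟩ : ∃ z, z = ξ 0 := ⟨_, rfl⟩
  obtain ⟨u, hu⟩ : ∃ z, z = ξ 1 := ⟨_, rfl⟩
  obtain ⟨w, hw⟩ : ∃ z, z = ξ 2 := ⟨_, rfl⟩
  simp [← ha0, ← ha1, ← ha2, ← hb0, ← hb1, ← hb2, ← hx, ← hu, ← hw, Complex.sq_norm,
    Complex.normSq_apply, -Complex.ofReal_pow]
  rw [← sub_nonneg]
  have key : ∀ L R : ℝ, R - L =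
      2 * ((b0.re + (u * a2.im - w * a1.im) / 2) ^ 2 + (b0.im - (u * a2.re - w * a1.re) / 2) ^ 2
        + (b1.re + (w * a0.im - x * a2.im) / 2) ^ 2 + (b1.im - (w * a0.re - x * a2.re) / 2) ^ 2
        + (b2.re + (x * a1.im - u * a0.im) / 2) ^ 2 + (b2.im - (x * a1.re - u * a0.re) / 2) ^ 2)
      + ((x * a0.re + u * a1.re + w * a2.re) ^ 2 + (x * a0.im + u * a1.im + w * a2.im) ^ 2) / 2
      + (x ^ 2 + u ^ 2 + w ^ 2) * (b0.re ^ 2 + b0.im ^ 2 + b1.re ^ 2 + b1.im ^ 2 + b2.re ^ 2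
        + b2.im ^ 2) / 2
      + ((x * b0.re + u * b1.re + w * b2.re) ^ 2 + (x * b0.im + u * b1.im + w * b2.im) ^ 2)
      → 0 ≤ R - L := fun L R h => by rw [h]; positivity
  apply key
  ring

theorem continuous_symA : Continuous symA := by
  refine continuous_matrix fun i j => ?_
  rcases i with i | i <;> rcases j with j | j <;>
    simp only [symA, symC, Matrix.fromBlocks_apply₁₁, Matrix.fromBlocks_apply₁₂,
      Matrix.fromBlocks_apply₂₁, Matrix.fromBlocks_apply₂₂, Matrix.add_apply, Matrix.smul_apply,
      Matrix.of_apply, Matrix.one_apply]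
  · fun_prop
  · fin_cases i <;> fin_cases j <;> simp [symB] <;> fun_prop
  · fin_cases i <;> fin_cases j <;> simp [symB] <;> fun_prop
  · fun_prop

open scoped Matrix.Norms.Operator in
theorem continuous_symG : Continuous fun p : ℝ × R3 => symG p.1 p.2 := by
  have h : Continuous fun p : ℝ × R3 => ((-p.1 : ℝ) : ℂ) • symA p.2 :=
    (Complex.continuous_ofReal.comp continuous_fst.neg).smul (continuous_symA.comp continuous_snd)
  exact NormedSpace.exp_continuous.comp h

theorem continuous_flowHat : Continuous fun p : (ℝ × R3) × C6 => flowHat p.1.1 p.1.2 p.2 := by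
  refine (PiLp.continuous_toLp 2 _).comp ?_
  exact Continuous.matrix_mulVec (continuous_symG.comp continuous_fst)
    ((PiLp.continuous_ofLp 2 _).comp continuous_snd)

theorem flowHat_sub (t : ℝ) (ξ : R3) (x y : C6) :
    flowHat t ξ (x - y) = flowHat t ξ x - flowHat t ξ y := by
  simp [flowHat, Matrix.mulVec_sub]

theorem linearHat_eq (t : ℝ) (U₀ : 𝓢'(R3, C6)) (ξ : R3) :
    linearHat t U₀ ξ = flowHat t ξ (hat U₀ ξ) := rfl

theorem duhamelHat_eq (t : ℝ) (N : 𝓢'(R3, C3x6)) (ξ : R3) :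
    duhamelHat t N ξ = flowHat t ξ (forceHat ξ (hat N ξ)) := by
  simp [duhamelHat, flowHat, forceHat, Matrix.mulVec_mulVec]

open scoped Matrix.Norms.Operator in
theorem hasDerivAt_flowHat (t : ℝ) (ξ : R3) (x : C6) :
    HasDerivAt (fun s => flowHat s ξ x)
      (-(WithLp.toLp 2 ((symA ξ).mulVec (flowHat t ξ x).ofLp) : C6)) t := by
  let L : Matrix Idx Idx ℂ →ₗ[ℝ] C6 :=
    { toFun := fun M => WithLp.toLp 2 (M.mulVec x.ofLp)
      map_add' := fun M N => by simp [Matrix.add_mulVec]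
      map_smul' := fun c M => by simp [Matrix.smul_mulVec] }
  have h1 : ∀ s : ℝ, symG s ξ = NormedSpace.exp (s • (-symA ξ)) := fun s => by
    rw [symG]; congr 1; ext i j; simp
  have h2 := hasDerivAt_exp_smul_const' (𝕂 := ℝ) (-symA ξ) t
  have h3 := (LinearMap.toContinuousLinearMap L).hasFDerivAt.comp_hasDerivAt t h2
  have e : (fun s => flowHat s ξ x)
      = LinearMap.toContinuousLinearMap L ∘ fun u : ℝ => NormedSpace.exp (u • (-symA ξ)) := by
    ext1 s
    simp only [Function.comp, ← h1]
    rfl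
  rw [e]
  refine h3.congr_deriv ?_
  change (WithLp.toLp 2 ((-symA ξ * NormedSpace.exp (t • (-symA ξ))).mulVec x.ofLp) : C6) = _
  have h4 : NormedSpace.exp (t • (-symA ξ)) = symG t ξ := (h1 t).symm
  rw [h4]
  simp [flowHat, Matrix.mulVec_mulVec, Matrix.neg_mulVec]

/-- Dissipation: `exp(-t 𝒜(ξ))` decays like the heat semigroup. -/
theorem norm_flowHat_le {t : ℝ} (ht : 0 ≤ t) (ξ : R3) (x : C6) :
    ‖flowHat t ξ x‖ ≤ Real.exp (-(t * (‖ξ‖ ^ 2 / 2))) * ‖x‖ := by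
  set c : ℝ := ‖ξ‖ ^ 2 / 2
  have h0 : flowHat 0 ξ x = x := by
    simp [flowHat, symG]
  let f : ℝ → ℝ := fun s => Real.exp (2 * c * s) * ‖flowHat s ξ x‖ ^ 2
  have hd : ∀ s, HasDerivAt f (2 * c * Real.exp (2 * c * s) * ‖flowHat s ξ x‖ ^ 2
      - Real.exp (2 * c * s) * (2 * (inner ℂ (flowHat s ξ x)
        (WithLp.toLp 2 ((symA ξ).mulVec (flowHat s ξ x).ofLp) : C6)).re)) s := by
    intro s
    have hy := hasDerivAt_flowHat s ξ x
    have h1 : HasDerivAt (fun s => ‖flowHat s ξ x‖ ^ 2)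
        (-(2 * (inner ℂ (flowHat s ξ x)
          (WithLp.toLp 2 ((symA ξ).mulVec (flowHat s ξ x).ofLp) : C6)).re)) s := by
      have h2 := Complex.reCLM.hasFDerivAt.comp_hasDerivAt s (hy.inner ℂ hy)
      have e : (fun s => ‖flowHat s ξ x‖ ^ 2)
          = Complex.reCLM ∘ fun t => inner ℂ (flowHat t ξ x) (flowHat t ξ x) := by
        ext1 s
        exact norm_sq_eq_re_inner (𝕜 := ℂ) (flowHat s ξ x)
      rw [e]
      refine h2.congr_deriv ?_
      rw [Complex.reCLM_apply, inner_neg_left, inner_neg_right, Complex.add_re, Complex.neg_re,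
        Complex.neg_re, ← inner_conj_symm (WithLp.toLp 2 _), Complex.conj_re]
      ring
    have h3 : HasDerivAt (fun s => Real.exp (2 * c * s)) (Real.exp (2 * c * s) * (2 * c)) s := by
      simpa using ((hasDerivAt_id s).const_mul (2 * c)).exp
    refine (h3.mul h1).congr_deriv ?_
    ring
  have hanti : Antitone f := by
    refine antitone_of_hasDerivAt_nonpos hd fun s => ?_
    have h1 := half_norm_sq_le_re_inner_symA ξ (flowHat s ξ x)
    rw [show ‖ξ‖ ^ 2 / 2 = c from rfl] at h1
    have he := Real.exp_pos (2 * c * s)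
    simp only [Pi.zero_apply]
    nlinarith [mul_le_mul_of_nonneg_left h1 he.le]
  have h1 := hanti ht
  simp only [f, mul_zero, Real.exp_zero, one_mul, h0] at h1
  have h2 : ‖flowHat t ξ x‖ ^ 2 ≤ (Real.exp (-(t * c)) * ‖x‖) ^ 2 := by
    have e : Real.exp (-(t * c)) ^ 2 * Real.exp (2 * c * t) = 1 := by
      rw [← Real.exp_nat_mul, ← Real.exp_add, ← Real.exp_zero]; congr 1; push_cast; ring
    calc ‖flowHat t ξ x‖ ^ 2
        = Real.exp (-(t * c)) ^ 2 * (Real.exp (2 * c * t) * ‖flowHat t ξ x‖ ^ 2) := by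
          rw [← mul_assoc, e, one_mul]
      _ ≤ Real.exp (-(t * c)) ^ 2 * ‖x‖ ^ 2 := by gcongr
      _ = _ := by ring
  exact (pow_le_pow_iff_left₀ (norm_nonneg _) (by positivity) two_ne_zero).1 h2

theorem norm_divHat_le (ξ : R3) (n : C3x6) (k : Idx) : ‖divHat ξ n k‖ ≤ 3 * (‖ξ‖ * ‖n‖) := by
  calc ‖divHat ξ n k‖ ≤ ∑ i : Fin 3, ‖Complex.I * (ξ i : ℂ) * n (i, k)‖ := norm_sum_le _ _
    _ ≤ ∑ _i : Fin 3, ‖ξ‖ * ‖n‖ := by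
        refine Finset.sum_le_sum fun i _ => ?_
        rw [norm_mul, norm_mul, Complex.norm_I, one_mul, Complex.norm_real]
        exact mul_le_mul (PiLp.norm_apply_le ξ i) (PiLp.norm_apply_le n (i, k)) (norm_nonneg _)
          (norm_nonneg _)
    _ = _ := by simp

theorem norm_symP_le (ξ : R3) (k l : Idx) : ‖symP ξ k l‖ ≤ 2 := by
  have h1 : ∀ i j : Fin 3, ‖(ξ i : ℂ) * (ξ j : ℂ) / ((‖ξ‖ ^ 2 : ℝ) : ℂ)‖ ≤ 1 := fun i j => by
    rw [norm_div, norm_mul, Complex.norm_real, Complex.norm_real, Complex.norm_real,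
      Real.norm_of_nonneg (sq_nonneg ‖ξ‖)]
    refine div_le_one_of_le₀ ?_ (sq_nonneg _)
    rw [sq]
    exact mul_le_mul (PiLp.norm_apply_le ξ i) (PiLp.norm_apply_le ξ j) (norm_nonneg _)
      (norm_nonneg _)
  have h2 : ∀ i j : Fin 3, ‖(if i = j then (1 : ℂ) else 0)‖ ≤ 1 := fun i j => by
    split_ifs <;> simp
  rcases k with k | k <;> rcases l with l | l
  · simp only [symP, Matrix.fromBlocks_apply₁₁, Matrix.of_apply]
    exact (norm_sub_le _ _).trans (by linarith [h1 k l, h2 k l])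
  · simp [symP]
  · simp [symP]
  · simp only [symP, Matrix.fromBlocks_apply₂₂, Matrix.one_apply]
    linarith [h2 k l]

theorem norm_forceHat_le (ξ : R3) (n : C3x6) : ‖forceHat ξ n‖ ≤ 216 * (‖ξ‖ * ‖n‖) := by
  have hk : ∀ k, ‖forceHat ξ n k‖ ≤ 36 * (‖ξ‖ * ‖n‖) := fun k => by
    calc ‖forceHat ξ n k‖ ≤ ∑ l, ‖symP ξ k l * divHat ξ n l‖ :=
          norm_sum_le Finset.univ fun l => symP ξ k l * divHat ξ n l
      _ ≤ ∑ _l : Idx, 2 * (3 * (‖ξ‖ * ‖n‖)) := by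
          refine Finset.sum_le_sum fun l _ => ?_
          rw [norm_mul]
          exact mul_le_mul (norm_symP_le ξ k l) (norm_divHat_le ξ n l) (norm_nonneg _) zero_le_two
      _ = _ := by simp; ring
  have h2 : ‖forceHat ξ n‖ ^ 2 ≤ (216 * (‖ξ‖ * ‖n‖)) ^ 2 := by
    rw [EuclideanSpace.norm_sq_eq]
    calc _ ≤ ∑ _k : Idx, (36 * (‖ξ‖ * ‖n‖)) ^ 2 :=
          Finset.sum_le_sum fun k _ => pow_le_pow_left₀ (norm_nonneg _) (hk k) 2
      _ = 7776 * (‖ξ‖ * ‖n‖) ^ 2 := by simp; ring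
      _ ≤ _ := by nlinarith [sq_nonneg (‖ξ‖ * ‖n‖)]
  exact (pow_le_pow_iff_left₀ (norm_nonneg _) (by positivity) two_ne_zero).1 h2

theorem forceHat_sub (ξ : R3) (m n : C3x6) : forceHat ξ (m - n) = forceHat ξ m - forceHat ξ n := by
  have h : divHat ξ (m - n) = divHat ξ m - divHat ξ n := by
    ext k
    simp [divHat, mul_sub, Finset.sum_sub_distrib]
  simp [forceHat, h, Matrix.mulVec_sub]

theorem measurable_forceHat : Measurable fun p : R3 × C3x6 => forceHat p.1 p.2 := by
  refine (WithLp.measurable_toLp 2 _).comp (measurable_pi_iff.2 fun k => ?_)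
  have hξ : ∀ i : Fin 3, Measurable fun p : R3 × C3x6 => ((p.1 i : ℝ) : ℂ) := fun i => by fun_prop
  have hd : ∀ l, Measurable fun p : R3 × C3x6 => divHat p.1 p.2 l := fun l => by
    refine Finset.measurable_fun_sum _ fun i _ => ?_
    exact ((hξ i).const_mul _).mul (by fun_prop)
  have hP : ∀ l, Measurable fun p : R3 × C3x6 => symP p.1 k l := fun l => by
    rcases k with k | k <;> rcases l with l | l
    · simp only [symP, Matrix.fromBlocks_apply₁₁, Matrix.of_apply]
      exact measurable_const.sub (((hξ k).mul (hξ l)).div (by fun_prop))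
    · simp [symP]
    · simp [symP]
    · simp [symP]
  exact Finset.measurable_fun_sum Finset.univ
    (f := fun l (p : R3 × C3x6) => symP p.1 k l * divHat p.1 p.2 l) fun l _ => (hP l).mul (hd l)

-- Only the bounds, the linearity and the regularity proved above are needed from here on; unfolding
-- the matrix exponential would slow down unification.
attribute [irreducible] flowHat forceHat

end Symbols

/-! ### Inequalities for integrals and sequences -/

section Inequalities

/-- An integral operator whose kernel satisfies `‖K(·, y)‖_{L^q} ≤ A` uniformly in `y` maps `L¹` to
`L^q`. -/
theorem lintegral_rpow_lintegral_mul_le {X Y : Type*} [MeasurableSpace X] [MeasurableSpace Y]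
    {μ : Measure X} {ν : Measure Y} [SFinite μ] [SFinite ν] {K : X → Y → ℝ≥0∞}
    (hK : Measurable (Function.uncurry K)) {F : Y → ℝ≥0∞} (hF : Measurable F) {A : ℝ≥0∞} {q : ℝ}
    (hq : 1 ≤ q) (h : ∀ y, F y ≠ 0 → ∫⁻ x, K x y ^ q ∂μ ≤ A ^ q) :
    ∫⁻ x, (∫⁻ y, K x y * F y ∂ν) ^ q ∂μ ≤ (A * ∫⁻ y, F y ∂ν) ^ q := by
  have hq0 : 0 < q := by linarith
  have hKx : ∀ x, Measurable (K x) := fun x => hK.comp measurable_prodMk_left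
  have hKy : ∀ y, Measurable fun x => K x y := fun y => hK.comp measurable_prodMk_right
  -- Jensen's inequality for the measure `F dν`
  have jensen : ∀ x, (∫⁻ y, K x y * F y ∂ν) ^ q
      ≤ (∫⁻ y, F y ∂ν) ^ (q - 1) * ∫⁻ y, K x y ^ q * F y ∂ν := by
    intro x
    have e : ∀ y, K x y * F y = (K x y ^ q * F y) ^ (1 / q) * F y ^ (1 - 1 / q) := fun y => by
      rw [ENNReal.mul_rpow_of_nonneg _ _ (by positivity), ← ENNReal.rpow_mul, mul_one_div_cancel
        hq0.ne', ENNReal.rpow_one, mul_assoc, ← ENNReal.rpow_add_of_nonneg _ _ (by positivity)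
        (by rw [sub_nonneg, div_le_one hq0]; exact hq)]
      simp
    have h1 := ENNReal.lintegral_mul_norm_pow_le (μ := ν) (f := fun y => K x y ^ q * F y) (g := F)
      (((hKx x).pow_const q).mul hF).aemeasurable hF.aemeasurable (p := 1 / q) (q := 1 - 1 / q)
      (by positivity) (by rw [sub_nonneg, div_le_one hq0]; exact hq) (by ring)
    simp_rw [← e] at h1
    calc (∫⁻ y, K x y * F y ∂ν) ^ q
        ≤ ((∫⁻ y, K x y ^ q * F y ∂ν) ^ (1 / q) * (∫⁻ y, F y ∂ν) ^ (1 - 1 / q)) ^ q :=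
          ENNReal.rpow_le_rpow h1 hq0.le
      _ = _ := by
          rw [ENNReal.mul_rpow_of_nonneg _ _ hq0.le, ← ENNReal.rpow_mul, ← ENNReal.rpow_mul,
            one_div_mul_cancel hq0.ne', ENNReal.rpow_one, mul_comm]
          congr 2
          field_simp
  calc ∫⁻ x, (∫⁻ y, K x y * F y ∂ν) ^ q ∂μ
      ≤ ∫⁻ x, (∫⁻ y, F y ∂ν) ^ (q - 1) * ∫⁻ y, K x y ^ q * F y ∂ν ∂μ := lintegral_mono jensen
    _ = (∫⁻ y, F y ∂ν) ^ (q - 1) * ∫⁻ x, ∫⁻ y, K x y ^ q * F y ∂ν ∂μ := by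
        refine lintegral_const_mul _ (Measurable.lintegral_prod_right' (f := fun p : X × Y =>
          K p.1 p.2 ^ q * F p.2) ?_)
        exact (hK.pow_const q).mul (hF.comp measurable_snd)
    _ = (∫⁻ y, F y ∂ν) ^ (q - 1) * ∫⁻ y, (∫⁻ x, K x y ^ q ∂μ) * F y ∂ν := by
        rw [lintegral_lintegral_swap ((hK.pow_const q).mul (hF.comp measurable_snd)).aemeasurable]
        congr 1
        exact lintegral_congr fun y => lintegral_mul_const _ ((hKy y).pow_const q)
    _ ≤ (∫⁻ y, F y ∂ν) ^ (q - 1) * ∫⁻ y, A ^ q * F y ∂ν := by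
        gcongr _ * ?_
        refine lintegral_mono fun y => ?_
        by_cases hy : F y = 0
        · simp [hy]
        · exact mul_le_mul_left (h y hy) _
    _ = (A * ∫⁻ y, F y ∂ν) ^ q := by
        rw [lintegral_const_mul _ hF, ENNReal.mul_rpow_of_nonneg _ _ hq0.le, mul_left_comm]
        congr 1
        nth_rewrite 2 [← ENNReal.rpow_one (∫⁻ y, F y ∂ν)]
        rw [← ENNReal.rpow_add_of_nonneg _ _ (by linarith) zero_le_one]
        congr 1
        ring

theorem tsum_rpow_le_rpow_tsum {ι : Type*} (a : ι → ℝ≥0∞) {p : ℝ} (hp : 1 ≤ p) :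
    ∑' j, a j ^ p ≤ (∑' j, a j) ^ p := by
  have h : ∀ j, a j ^ p ≤ a j * (∑' k, a k) ^ (p - 1) := fun j => by
    calc a j ^ p = a j ^ (1 : ℝ) * a j ^ (p - 1) := by
          rw [← ENNReal.rpow_add_of_nonneg _ _ zero_le_one (by linarith)]; congr 1; ring
      _ ≤ _ := by
          rw [ENNReal.rpow_one]
          exact mul_le_mul_right (ENNReal.rpow_le_rpow (ENNReal.le_tsum j) (by linarith)) _
  calc _ ≤ ∑' j, a j * (∑' k, a k) ^ (p - 1) := ENNReal.tsum_le_tsum h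
    _ = (∑' k, a k) ^ (1 : ℝ) * (∑' k, a k) ^ (p - 1) := by
        rw [ENNReal.tsum_mul_right, ENNReal.rpow_one]
    _ = _ := by
        rw [← ENNReal.rpow_add_of_nonneg _ _ zero_le_one (by linarith)]; congr 1; ring

/-- The weight `2^{js}` of the dyadic norms. -/
def dyadicWeight (s : ℝ) (j : ℤ) : ℝ≥0∞ := ENNReal.ofReal ((2 : ℝ) ^ ((j : ℝ) * s))

theorem dyadicWeight_add (s t : ℝ) (j : ℤ) :
    dyadicWeight (s + t) j = dyadicWeight s j * dyadicWeight t j := by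
  rw [dyadicWeight, dyadicWeight, dyadicWeight, ← ENNReal.ofReal_mul (by positivity), mul_add,
    Real.rpow_add two_pos]

theorem dyadicWeight_zero (j : ℤ) : dyadicWeight 0 j = 1 := by simp [dyadicWeight]

theorem dyadicWeight_neg_mul (s : ℝ) (j : ℤ) : dyadicWeight (-s) j * dyadicWeight s j = 1 := by
  rw [← dyadicWeight_add, neg_add_cancel, dyadicWeight_zero]

theorem dyadicNorm_eq (s r : ℝ) (c : ℤ → ℝ≥0∞) :
    dyadicNorm s r c = (∑' j, (dyadicWeight s j * c j) ^ r) ^ (1 / r) := rfl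

theorem dyadicNorm_mono {s r : ℝ} (hr : 0 < r) {c d : ℤ → ℝ≥0∞} (h : ∀ j, c j ≤ d j) :
    dyadicNorm s r c ≤ dyadicNorm s r d := by
  rw [dyadicNorm_eq, dyadicNorm_eq]
  gcongr with j
  exact h j

theorem dyadicNorm_le_tsum {s r : ℝ} (hr : 1 ≤ r) (c : ℤ → ℝ≥0∞) :
    dyadicNorm s r c ≤ ∑' j, dyadicWeight s j * c j := by
  rw [dyadicNorm_eq]
  calc _ ≤ ((∑' j, dyadicWeight s j * c j) ^ r) ^ (1 / r) := by
        gcongr; exact tsum_rpow_le_rpow_tsum _ hr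
    _ = _ := by rw [← ENNReal.rpow_mul, mul_one_div_cancel (by linarith), ENNReal.rpow_one]

theorem le_dyadicNorm {s r : ℝ} (hr : 1 ≤ r) (c : ℤ → ℝ≥0∞) (j : ℤ) :
    dyadicWeight s j * c j ≤ dyadicNorm s r c := by
  rw [dyadicNorm_eq]
  calc _ = ((dyadicWeight s j * c j) ^ r) ^ (1 / r) := by
        rw [← ENNReal.rpow_mul, mul_one_div_cancel (by linarith), ENNReal.rpow_one]
    _ ≤ _ := by gcongr; exact ENNReal.le_tsum (f := fun j => (dyadicWeight s j * c j) ^ r) j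

theorem tsum_sq_le_dyadicNorm_sq {s r : ℝ} (hr : r ∈ Icc (1 : ℝ) 2) (c : ℤ → ℝ≥0∞) :
    ∑' j, (dyadicWeight s j * c j) ^ 2 ≤ dyadicNorm s r c ^ 2 := by
  have hr0 : 0 < r := by linarith [hr.1]
  rw [dyadicNorm_eq, ← ENNReal.rpow_two, ← ENNReal.rpow_mul]
  have := tsum_rpow_le_rpow_tsum (fun j => (dyadicWeight s j * c j) ^ r) (p := 1 / r * 2) (by
    rw [one_div_mul_eq_div, one_le_div hr0]; exact hr.2)
  refine le_trans (le_of_eq ?_) this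
  refine tsum_congr fun j => ?_
  rw [← ENNReal.rpow_mul, ← ENNReal.rpow_two]
  congr 1
  field_simp

theorem dyadicNorm_add_le {s r : ℝ} (hr : 1 ≤ r) (c d : ℤ → ℝ≥0∞) :
    dyadicNorm s r (fun j => c j + d j) ≤ dyadicNorm s r c + dyadicNorm s r d := by
  have := ENNReal.lintegral_Lp_add_le (μ := Measure.count) (p := r)
    (f := fun j : ℤ => dyadicWeight s j * c j) (g := fun j => dyadicWeight s j * d j)
    (measurable_of_countable _).aemeasurable (measurable_of_countable _).aemeasurable hr
  simp only [lintegral_count, Pi.add_apply] at this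
  simpa only [dyadicNorm_eq, mul_add] using this

theorem dyadicNorm_const_mul {s r : ℝ} (hr : 0 < r) (a : ℝ≥0∞) (c : ℤ → ℝ≥0∞) :
    dyadicNorm s r (fun j => a * c j) = a * dyadicNorm s r c := by
  simp only [dyadicNorm_eq, mul_left_comm _ a, ENNReal.mul_rpow_of_nonneg _ _ hr.le]
  rw [ENNReal.tsum_mul_left, ENNReal.mul_rpow_of_nonneg _ _ (by positivity), ← ENNReal.rpow_mul,
    mul_one_div_cancel hr.ne', ENNReal.rpow_one]

theorem ennreal_mul_le_sq_add_sq (a b : ℝ≥0∞) : a * b ≤ a ^ 2 + b ^ 2 := by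
  rcases le_total a b with h | h
  · exact (mul_le_mul_left h b).trans (by rw [← sq]; exact le_add_self)
  · exact (mul_le_mul_right h a).trans (by rw [← sq]; exact le_self_add)

theorem tsum_two_pow_neg_abs_lt_top {a : ℝ} (ha : 0 < a) :
    ∑' m : ℤ, ENNReal.ofReal ((2 : ℝ) ^ (-(|(m : ℝ)| * a))) < ∞ := by
  have hr : (2 : ℝ) ^ (-a) < 1 := Real.rpow_lt_one_of_one_lt_of_neg one_lt_two (by linarith)
  have hs : Summable fun n : ℕ => ((2 : ℝ) ^ (-a)) ^ n :=
    summable_geometric_of_lt_one (by positivity) hr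
  have e : ∀ n : ℕ, (2 : ℝ) ^ (-((n : ℝ) * a)) = ((2 : ℝ) ^ (-a)) ^ n := fun n => by
    rw [← Real.rpow_natCast, ← Real.rpow_mul two_pos.le]; congr 1; ring
  have : Summable fun m : ℤ => (2 : ℝ) ^ (-(|(m : ℝ)| * a)) := by
    refine Summable.of_nat_of_neg ?_ ?_
    · simpa [e] using hs
    · simpa [e] using hs
  rw [← ENNReal.ofReal_tsum_of_nonneg (fun m => by positivity) this]
  exact ENNReal.ofReal_lt_top

/-- The interpolation `L̃^p FḂ^α ∩ L̃^{p'} FḂ^{-α} ⊂ L² L¹`, in terms of the block norms `c_j`: by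
Hölder's inequality `∫ c_j c_k ≤ 2^{-α|j-k|} A_j B_k`, or the same with `j` and `k` exchanged. -/
theorem exists_interpolation {α : ℝ} (hα : 0 < α) :
    ∃ C : ℝ≥0∞, C < ∞ ∧ ∀ (μ : Measure ℝ) (p q : ℝ), p.HolderConjugate q →
      ∀ c : ℤ → ℝ → ℝ≥0∞, (∀ j, AEMeasurable (c j) μ) →
        ∫⁻ t, (∑' j, c j t) ^ 2 ∂μ ≤
          C * (∑' j, (dyadicWeight α j * (∫⁻ t, c j t ^ p ∂μ) ^ (1 / p)) ^ 2
            + ∑' j, (dyadicWeight (-α) j * (∫⁻ t, c j t ^ q ∂μ) ^ (1 / q)) ^ 2) := by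
  let w : ℤ → ℝ≥0∞ := fun m => ENNReal.ofReal ((2 : ℝ) ^ (-(|(m : ℝ)| * α)))
  refine ⟨2 * ∑' m, w m, ENNReal.mul_lt_top (by simp) (tsum_two_pow_neg_abs_lt_top hα), ?_⟩
  intro μ p q hpq c hc
  set A : ℤ → ℝ≥0∞ := fun j => dyadicWeight α j * (∫⁻ t, c j t ^ p ∂μ) ^ (1 / p) with hA
  set B : ℤ → ℝ≥0∞ := fun j => dyadicWeight (-α) j * (∫⁻ t, c j t ^ q ∂μ) ^ (1 / q) with hB
  have hw : ∀ j k : ℤ, k ≤ j → w (j - k) = dyadicWeight (-α) j * dyadicWeight α k := by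
    intro j k hjk
    have : (0 : ℝ) ≤ (j : ℝ) - k := sub_nonneg.2 (by exact_mod_cast hjk)
    simp only [w, dyadicWeight]
    rw [← ENNReal.ofReal_mul (by positivity), ← Real.rpow_add two_pos]
    push_cast
    rw [abs_of_nonneg this]
    congr 2
    ring
  have hw_symm : ∀ j k : ℤ, w (j - k) = w (k - j) := fun j k => by
    simp only [w]; push_cast; rw [abs_sub_comm]
  have hle : ∀ j k : ℤ, k ≤ j → ∫⁻ t, c j t * c k t ∂μ ≤ w (j - k) * (A j * B k) := by
    intro j k hjk
    refine (ENNReal.lintegral_mul_le_Lp_mul_Lq μ hpq (hc j) (hc k)).trans (le_of_eq ?_)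
    rw [hw j k hjk, hA, hB]
    simp only
    calc _ = (dyadicWeight (-α) j * dyadicWeight α j) * (dyadicWeight (-α) k * dyadicWeight α k) *
          ((∫⁻ t, c j t ^ p ∂μ) ^ (1 / p) * (∫⁻ t, c k t ^ q ∂μ) ^ (1 / q)) := by
            rw [dyadicWeight_neg_mul, dyadicWeight_neg_mul, one_mul, one_mul]
      _ = _ := by ring
  let S : ℤ → ℝ≥0∞ := fun j => A j ^ 2 + B j ^ 2
  have hle' : ∀ j k : ℤ, ∫⁻ t, c j t * c k t ∂μ ≤ w (j - k) * S j + w (j - k) * S k := by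
    have aux : ∀ j k : ℤ, A j * B k ≤ S j + S k := fun j k =>
      (ennreal_mul_le_sq_add_sq _ _).trans (add_le_add le_self_add le_add_self)
    intro j k
    rw [← mul_add]
    rcases le_total k j with h | h
    · exact (hle j k h).trans (mul_le_mul_right (aux j k) _)
    · simp_rw [mul_comm (c j _)]
      rw [hw_symm, add_comm]
      exact (hle k j h).trans (mul_le_mul_right (aux k j) _)
  have e1 : ∀ t, (∑' j, c j t) ^ 2 = ∑' j, ∑' k, c j t * c k t := fun t => by
    rw [sq, ← ENNReal.tsum_mul_right]
    exact tsum_congr fun j => ENNReal.tsum_mul_left.symm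
  have e2 : ∀ j : ℤ, ∑' k, w (j - k) = ∑' m, w m := fun j => (Equiv.subLeft j).tsum_eq w
  have e3 : ∑' j, ∑' k, w (j - k) * S j = (∑' m, w m) * ∑' j, S j := by
    simp_rw [ENNReal.tsum_mul_right, e2, ENNReal.tsum_mul_left]
  have e4 : ∑' j, ∑' k, w (j - k) * S k = (∑' m, w m) * ∑' j, S j := by
    rw [ENNReal.tsum_comm, ← e3]
    exact tsum_congr fun j => tsum_congr fun k => by rw [hw_symm]
  calc ∫⁻ t, (∑' j, c j t) ^ 2 ∂μ = ∑' j, ∑' k, ∫⁻ t, c j t * c k t ∂μ := by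
        have hm : ∀ j k, AEMeasurable (fun t => c j t * c k t) μ := fun j k => (hc j).mul (hc k)
        simp_rw [e1]
        rw [lintegral_tsum fun j => AEMeasurable.tsum fun k => hm j k]
        exact tsum_congr fun j => lintegral_tsum fun k => hm j k
    _ ≤ ∑' j, ∑' k, (w (j - k) * S j + w (j - k) * S k) :=
        ENNReal.tsum_le_tsum fun j => ENNReal.tsum_le_tsum fun k => hle' j k
    _ = 2 * (∑' m, w m) * ∑' j, S j := by
        simp_rw [ENNReal.tsum_add]
        rw [e3, e4, ← two_mul, mul_assoc]
    _ = _ := congrArg _ ENNReal.tsum_add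

end Inequalities

/-! ### Littlewood-Paley blocks -/

section Blocks

/-- The cut-off function `ψ(2^{-j} ξ)`, with values in `[0, ∞]`. -/
def blockCut (D : LittlewoodPaley) (j : ℤ) (ξ : R3) : ℝ≥0∞ :=
  ENNReal.ofReal (D.ψ ((2 : ℝ) ^ (-j) • ξ))

/-- The `L¹` norm of the `j`-th block, for a function on the Fourier side. -/
def blockMass {F : Type*} [NormedAddCommGroup F] (D : LittlewoodPaley) (j : ℤ) (g : R3 → F) :
    ℝ≥0∞ :=
  ∫⁻ ξ, blockCut D j ξ * ‖g ξ‖ₑ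

variable (D : LittlewoodPaley)

theorem blockNorm_eq (j : ℤ) (f : 𝓢'(R3, C6)) : blockNorm D j f = blockMass D j (hat f) := by
  refine lintegral_congr fun ξ => ?_
  rw [enorm_smul, Real.enorm_of_nonneg (D.ψ_nonneg _)]
  rfl

theorem measurable_blockCut (j : ℤ) : Measurable (blockCut D j) :=
  (D.ψ.continuous.comp (continuous_const_smul _)).measurable.ennreal_ofReal

theorem blockMass_congr {F : Type*} [NormedAddCommGroup F] {f g : R3 → F} (h : f =ᵐ[volume] g)
    (j : ℤ) : blockMass D j f = blockMass D j g :=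
  lintegral_congr_ae (h.mono fun ξ hξ => by simp only [hξ])

theorem HasFourierFn.blockNorm_eq {f : 𝓢'(R3, C6)} {g : R3 → C6} (h : HasFourierFn f g) (j : ℤ) :
    blockNorm D j f = blockMass D j g := by
  rw [Micropolar.blockNorm_eq, blockMass_congr D h.hat_ae_eq]

theorem blockCut_support {j : ℤ} {ξ : R3} (h : blockCut D j ξ ≠ 0) :
    3 / 4 * (2 : ℝ) ^ (j : ℝ) ≤ ‖ξ‖ ∧ ‖ξ‖ ≤ 8 / 3 * (2 : ℝ) ^ (j : ℝ) := by
  have h1 : D.ψ ((2 : ℝ) ^ (-j) • ξ) ≠ 0 := fun h0 => h (by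
    rw [blockCut, h0, ENNReal.ofReal_zero])
  have h2 := D.ψ_support _ h1
  have hp : (0 : ℝ) < 2 ^ j := by positivity
  rw [norm_smul, Real.norm_of_nonneg (by positivity), zpow_neg, ← div_eq_inv_mul,
    le_div_iff₀ hp, div_le_iff₀ hp] at h2
  rwa [Real.rpow_intCast]

theorem tsum_blockCut {ξ : R3} (hξ : ξ ≠ 0) : ∑' j, blockCut D j ξ = 1 := by
  have h := D.sum_ψ ξ hξ
  unfold blockCut
  rw [← ENNReal.ofReal_tsum_of_nonneg (fun j => D.ψ_nonneg _) h.summable, h.tsum_eq,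
    ENNReal.ofReal_one]

theorem ae_ne_zero_R3 : ∀ᵐ ξ : R3, ξ ≠ 0 := Measure.ae_ne volume 0

theorem lintegral_eq_tsum_blockCut {h : R3 → ℝ≥0∞} (hm : AEMeasurable h) :
    ∫⁻ ξ, h ξ = ∑' j, ∫⁻ ξ, blockCut D j ξ * h ξ := by
  have hm' : ∀ j, AEMeasurable fun ξ => blockCut D j ξ * h ξ := fun j =>
    (measurable_blockCut D j).aemeasurable.mul hm
  rw [← lintegral_tsum hm']
  refine lintegral_congr_ae (ae_ne_zero_R3.mono fun ξ hξ => ?_)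
  simp only
  rw [ENNReal.tsum_mul_right, tsum_blockCut D hξ, one_mul]

theorem lintegral_enorm_eq_tsum_blockMass {F : Type*} [NormedAddCommGroup F] {g : R3 → F}
    (hg : AEStronglyMeasurable g) : ∫⁻ ξ, ‖g ξ‖ₑ = ∑' j, blockMass D j g :=
  lintegral_eq_tsum_blockCut D hg.enorm

theorem weight_le_of_blockCut_ne_zero {j : ℤ} {ξ : R3} (h : blockCut D j ξ ≠ 0) :
    (1 + ‖ξ‖ ^ 2)⁻¹ ≤ 2 * (2 : ℝ) ^ (-(|(j : ℝ)| * 1)) * (2 : ℝ) ^ ((j : ℝ) * (-1)) := by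
  have hs := (blockCut_support D h).1
  have hpos : (0 : ℝ) < 2 ^ (j : ℝ) := by positivity
  rw [mul_assoc, ← Real.rpow_add two_pos]
  rcases le_total 0 j with hj | hj
  · have : (0 : ℝ) ≤ j := by exact_mod_cast hj
    rw [abs_of_nonneg this, show -((j : ℝ) * 1) + j * (-1) = -(j + j) by ring,
      Real.rpow_neg two_pos.le, Real.rpow_add two_pos, ← div_eq_mul_inv, inv_eq_one_div,
      div_le_div_iff₀ (by positivity) (by positivity)]
    nlinarith
  · have : (j : ℝ) ≤ 0 := by exact_mod_cast hj
    rw [abs_of_nonpos this, show -(-(j : ℝ) * 1) + j * (-1) = 0 by ring, Real.rpow_zero]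
    exact (inv_le_one_of_one_le₀ (by nlinarith [norm_nonneg ξ])).trans (by norm_num)

/-- The embedding `FḂ^{-1}_{1,∞} ⊂ L¹((1 + |ξ|²)⁻¹ dξ)`. -/
theorem exists_lintegral_weight_le : ∃ C : ℝ≥0∞, C < ∞ ∧ ∀ (D : LittlewoodPaley) (g : R3 → C6)
    (M : ℝ≥0∞), AEStronglyMeasurable g → (∀ j, dyadicWeight (-1) j * blockMass D j g ≤ M) →
      ∫⁻ ξ, ENNReal.ofReal ((1 + ‖ξ‖ ^ 2)⁻¹) * ‖g ξ‖ₑ ≤ C * M := by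
  refine ⟨2 * ∑' m : ℤ, ENNReal.ofReal ((2 : ℝ) ^ (-(|(m : ℝ)| * 1))),
    ENNReal.mul_lt_top (by simp) (tsum_two_pow_neg_abs_lt_top one_pos), fun D g M hg hM => ?_⟩
  have hw : Measurable fun ξ : R3 => ENNReal.ofReal ((1 + ‖ξ‖ ^ 2)⁻¹) := by fun_prop
  have hwg : AEMeasurable fun ξ : R3 => ENNReal.ofReal ((1 + ‖ξ‖ ^ 2)⁻¹) * ‖g ξ‖ₑ :=
    hw.aemeasurable.mul hg.enorm
  rw [lintegral_eq_tsum_blockCut D hwg, mul_assoc,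
    ← ENNReal.tsum_mul_right, ← ENNReal.tsum_mul_left]
  refine ENNReal.tsum_le_tsum fun j => ?_
  calc ∫⁻ ξ, blockCut D j ξ * (ENNReal.ofReal ((1 + ‖ξ‖ ^ 2)⁻¹) * ‖g ξ‖ₑ)
      ≤ ∫⁻ ξ, (2 * ENNReal.ofReal ((2 : ℝ) ^ (-(|(j : ℝ)| * 1))) * dyadicWeight (-1) j) *
          (blockCut D j ξ * ‖g ξ‖ₑ) := by
        refine lintegral_mono fun ξ => ?_
        by_cases h : blockCut D j ξ = 0
        · simp [h]
        · rw [mul_left_comm]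
          refine mul_le_mul_left ?_ _
          refine (ENNReal.ofReal_le_ofReal (weight_le_of_blockCut_ne_zero D h)).trans (le_of_eq ?_)
          rw [ENNReal.ofReal_mul (by positivity), ENNReal.ofReal_mul two_pos.le,
            ENNReal.ofReal_ofNat]
          rfl
    _ = 2 * (ENNReal.ofReal ((2 : ℝ) ^ (-(|(j : ℝ)| * 1))) * (dyadicWeight (-1) j *
          blockMass D j g)) := by
        have hm : AEMeasurable fun ξ => blockCut D j ξ * ‖g ξ‖ₑ :=
          (measurable_blockCut D j).aemeasurable.mul hg.enorm
        rw [lintegral_const_mul'' _ hm]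
        simp only [blockMass, mul_assoc]
    _ ≤ _ := by gcongr; exact hM j

theorem dyadicWeight_mul_enorm_le {j : ℤ} {ξ : R3} (h : blockCut D j ξ ≠ 0) :
    dyadicWeight (-1) j * ‖ξ‖ₑ ≤ 3 := by
  have hs := (blockCut_support D h).2
  rw [dyadicWeight, ← ofReal_norm, ← ENNReal.ofReal_mul (by positivity), ← ENNReal.ofReal_ofNat 3]
  refine ENNReal.ofReal_le_ofReal ?_
  rw [mul_neg_one, Real.rpow_neg two_pos.le, inv_mul_le_iff₀ (by positivity)]
  have : (0 : ℝ) < 2 ^ (j : ℝ) := by positivity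
  linarith

/-- The embedding `L¹(|ξ|⁻¹ dξ) ⊂ FḂ^{-1}_{1,1}`. -/
theorem tsum_blockMass_le {g : R3 → C6} {h : R3 → ℝ≥0∞} (hh : AEMeasurable h)
    (hgh : ∀ᵐ ξ, ‖g ξ‖ₑ ≤ ‖ξ‖ₑ * h ξ) :
    ∑' j, dyadicWeight (-1) j * blockMass D j g ≤ 3 * ∫⁻ ξ, h ξ := by
  rw [lintegral_eq_tsum_blockCut D hh, ← ENNReal.tsum_mul_left]
  refine ENNReal.tsum_le_tsum fun j => ?_
  have hm : AEMeasurable fun ξ => blockCut D j ξ * h ξ :=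
    (measurable_blockCut D j).aemeasurable.mul hh
  have hw : dyadicWeight (-1) j ≠ ∞ := ENNReal.ofReal_ne_top
  rw [← lintegral_const_mul'' _ hm, blockMass, ← lintegral_const_mul' _ _ hw]
  refine lintegral_mono_ae (hgh.mono fun ξ hξ => ?_)
  by_cases h0 : blockCut D j ξ = 0
  · simp [h0]
  have hd := dyadicWeight_mul_enorm_le D h0
  calc dyadicWeight (-1) j * (blockCut D j ξ * ‖g ξ‖ₑ)
      ≤ dyadicWeight (-1) j * (blockCut D j ξ * (‖ξ‖ₑ * h ξ)) := by gcongr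
    _ = (dyadicWeight (-1) j * ‖ξ‖ₑ) * (blockCut D j ξ * h ξ) := by ring
    _ ≤ 3 * (blockCut D j ξ * h ξ) := by gcongr

end Blocks

section HeatKernel

/-- The factor `exp(-(t - τ) |ξ|² / 2)` for `τ < t`, extended by zero to `t ≤ τ`. -/
def heatFactor (t τ : ℝ) (ξ : R3) : ℝ≥0∞ :=
  if τ < t then ENNReal.ofReal (Real.exp (-((t - τ) * (‖ξ‖ ^ 2 / 2)))) else 0

theorem measurable_heatFactor : Measurable fun p : ℝ × (ℝ × R3) => heatFactor p.1 p.2.1 p.2.2 := by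
  refine Measurable.ite (measurableSet_lt (by fun_prop) (by fun_prop)) ?_ measurable_const
  fun_prop

theorem lintegral_heatFactor_rpow {q : ℝ} (hq : 0 < q) (τ : ℝ) {ξ : R3} (hξ : ξ ≠ 0) :
    ∫⁻ t, heatFactor t τ ξ ^ q = ENNReal.ofReal (2 / (q * ‖ξ‖ ^ 2)) := by
  have hx : 0 < ‖ξ‖ := norm_pos_iff.2 hξ
  set a : ℝ := -(q * (‖ξ‖ ^ 2 / 2)) with ha
  have ha0 : a < 0 := by rw [ha]; simp only [Left.neg_neg_iff]; positivity
  have e : ∀ t, heatFactor t τ ξ ^ q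
      = (Ioi τ).indicator (fun t => ENNReal.ofReal (Real.exp (-a * τ) * Real.exp (a * t))) t := by
    intro t
    by_cases h : τ < t
    · rw [indicator_of_mem (mem_Ioi.2 h), heatFactor, if_pos h,
        ENNReal.ofReal_rpow_of_pos (Real.exp_pos _), ← Real.exp_mul, ← Real.exp_add]
      congr 2
      rw [ha]; ring
    · rw [indicator_of_notMem (by simpa using h), heatFactor, if_neg h, ENNReal.zero_rpow_of_pos hq]
  simp_rw [e]
  rw [lintegral_indicator measurableSet_Ioi, ← ofReal_integral_eq_lintegral_ofReal
    ((integrableOn_exp_mul_Ioi ha0 τ).const_mul _) (ae_of_all _ fun t => by positivity),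
    integral_const_mul, integral_exp_mul_Ioi ha0]
  congr 1
  rw [neg_div, mul_neg, ← mul_div_assoc, ← Real.exp_add, neg_mul, neg_add_cancel, Real.exp_zero, ha]
  field_simp

/-- The parabolic gain of `2 / q` derivatives in `L^q_t`, for a single block. -/
theorem lintegral_dyadicWeight_heatFactor_le (D : LittlewoodPaley) {q : ℝ} (hq : 1 ≤ q) {j : ℤ}
    (τ : ℝ) {ξ : R3} (h : blockCut D j ξ ≠ 0) :
    ∫⁻ t, (dyadicWeight (-1 + 2 / q) j * heatFactor t τ ξ) ^ q
      ≤ (4 * dyadicWeight (-1) j) ^ q := by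
  have hq0 : 0 < q := by linarith
  have hs := (blockCut_support D h).1
  have hp : (0 : ℝ) < 2 ^ (j : ℝ) := by positivity
  have hx : 0 < ‖ξ‖ := lt_of_lt_of_le (by positivity) hs
  have hξ : ξ ≠ 0 := norm_pos_iff.1 hx
  simp_rw [ENNReal.mul_rpow_of_nonneg _ _ hq0.le]
  have hw : dyadicWeight (-1 + 2 / q) j ^ q ≠ ∞ :=
    ENNReal.rpow_ne_top_of_nonneg hq0.le ENNReal.ofReal_ne_top
  rw [lintegral_const_mul' _ _ hw,
    lintegral_heatFactor_rpow hq0 τ hξ, dyadicWeight, dyadicWeight,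
    ENNReal.ofReal_rpow_of_pos (by positivity), ENNReal.ofReal_rpow_of_pos (by positivity),
    ← ENNReal.ofReal_mul (by positivity), ← ENNReal.ofReal_ofNat 4,
    ENNReal.ofReal_rpow_of_pos (by positivity), ← ENNReal.ofReal_mul (by positivity)]
  refine ENNReal.ofReal_le_ofReal ?_
  rw [← Real.rpow_mul two_pos.le, ← Real.rpow_mul two_pos.le,
    show (j : ℝ) * (-1 + 2 / q) * q = j + j + j * (-1) * q by field_simp; ring,
    Real.rpow_add two_pos, Real.rpow_add two_pos]
  have h4 : (4 : ℝ) ≤ 4 ^ q := by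
    calc (4 : ℝ) = 4 ^ (1 : ℝ) := (Real.rpow_one _).symm
      _ ≤ _ := Real.rpow_le_rpow_of_exponent_le (by norm_num) hq
  have h5 : (2 : ℝ) ^ (j : ℝ) * 2 ^ (j : ℝ) * (2 / (q * ‖ξ‖ ^ 2)) ≤ 4 := by
    rw [mul_div_assoc', div_le_iff₀ (by positivity)]
    have h6 : (3 / 4 * (2 : ℝ) ^ (j : ℝ)) ^ 2 ≤ ‖ξ‖ ^ 2 := pow_le_pow_left₀ (by positivity) hs 2
    nlinarith [mul_le_mul_of_nonneg_right hq (sq_nonneg ‖ξ‖)]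
  calc _ = ((2 : ℝ) ^ (j : ℝ) * 2 ^ (j : ℝ) * (2 / (q * ‖ξ‖ ^ 2))) * 2 ^ ((j : ℝ) * -1 * q) := by ring
    _ ≤ _ := mul_le_mul_of_nonneg_right (h5.trans h4) (by positivity)

end HeatKernel

/-! ### The linear flow -/

section TimeIntervals

theorem measurableSet_timeIoo (T : EReal) : MeasurableSet (timeIoo T) :=
  measurableSet_Ioi.inter (measurable_coe_real_ereal measurableSet_Iio)

theorem timeIoo_subset_timeIco (T : EReal) : timeIoo T ⊆ timeIco T := fun _ h => ⟨h.1.le, h.2⟩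

theorem Ioo_subset_timeIoo {T : EReal} {t : ℝ} (ht : t ∈ timeIco T) : Ioo 0 t ⊆ timeIoo T :=
  fun _ h => ⟨h.1, (EReal.coe_lt_coe_iff.2 h.2).trans ht.2⟩

theorem timeIoo_coe (T : ℝ) : timeIoo (T : EReal) = Ioo 0 T := by
  ext t; simp [timeIoo]

/-- The measure `dt dξ` on `(0, T) × ℝ³`. -/
def spaceTime (T : EReal) : Measure (ℝ × R3) := (volume.restrict (timeIoo T)).prod volume

instance (T : EReal) : SFinite (spaceTime T) := by unfold spaceTime; infer_instance

end TimeIntervals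

section LinearFlow

theorem enorm_flowHat_le {t : ℝ} (ht : 0 ≤ t) (ξ : R3) (x : C6) : ‖flowHat t ξ x‖ₑ ≤ ‖x‖ₑ := by
  rw [← ofReal_norm, ← ofReal_norm]
  refine ENNReal.ofReal_le_ofReal ((norm_flowHat_le ht ξ x).trans ?_)
  refine mul_le_of_le_one_left (norm_nonneg _) (Real.exp_le_one_iff.2 ?_)
  have : 0 ≤ t * (‖ξ‖ ^ 2 / 2) := by positivity
  linarith

theorem enorm_flowHat_le_heatFactor {t τ : ℝ} (h : τ < t) (ξ : R3) (x : C6) :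
    ‖flowHat (t - τ) ξ x‖ₑ ≤ heatFactor t τ ξ * ‖x‖ₑ := by
  rw [heatFactor, if_pos h, ← ofReal_norm, ← ofReal_norm, ← ENNReal.ofReal_mul (by positivity)]
  exact ENNReal.ofReal_le_ofReal (norm_flowHat_le (by linarith) ξ x)

theorem stronglyMeasurable_flowHat {v₀ : R3 → C6} (hv : StronglyMeasurable v₀) :
    StronglyMeasurable (Function.uncurry fun (t : ℝ) (ξ : R3) => flowHat t ξ (v₀ ξ)) := by
  have h : StronglyMeasurable fun p : ℝ × R3 => ((p, v₀ p.2) : (ℝ × R3) × C6) :=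
    stronglyMeasurable_id.prodMk (hv.comp_measurable measurable_snd)
  exact continuous_flowHat.comp_stronglyMeasurable h

theorem continuous_flowHat_time (ξ : R3) (x : C6) : Continuous fun t => flowHat t ξ x :=
  continuous_flowHat.comp (((continuous_id.prodMk continuous_const)).prodMk continuous_const)

/-- Parabolic smoothing of a block in `L^q_t`, for functions dominated by the heat flow of a
source `G`. -/
theorem dyadicWeight_mul_lintegral_rpow_le (D : LittlewoodPaley) {q : ℝ} (hq : 1 ≤ q) {j : ℤ}
    {I : Set ℝ} (hI : MeasurableSet I) {ν : Measure (ℝ × R3)} [SFinite ν] {f : ℝ → ℝ≥0∞}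
    {G : ℝ × R3 → ℝ≥0∞} (hG : Measurable G) (hG0 : ∀ z, G z ≠ 0 → blockCut D j z.2 ≠ 0)
    (hf : ∀ t ∈ I, f t ≤ ∫⁻ z, heatFactor t z.1 z.2 * G z ∂ν) :
    dyadicWeight (-1 + 2 / q) j * (∫⁻ t in I, f t ^ q) ^ (1 / q)
      ≤ 4 * (dyadicWeight (-1) j * ∫⁻ z, G z ∂ν) := by
  have hq0 : 0 < q := by linarith
  set w := dyadicWeight (-1 + 2 / q) j
  have hw : w ≠ ∞ := ENNReal.ofReal_ne_top
  have hwq : w ^ q ≠ ∞ := ENNReal.rpow_ne_top_of_nonneg hq0.le hw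
  have hK : Measurable (Function.uncurry fun (t : ℝ) (z : ℝ × R3) => w * heatFactor t z.1 z.2) :=
    measurable_heatFactor.const_mul w
  have h1 := lintegral_rpow_lintegral_mul_le (μ := volume) (ν := ν) hK hG hq
    (A := 4 * dyadicWeight (-1) j)
    (fun z hz => lintegral_dyadicWeight_heatFactor_le D hq z.1 (hG0 z hz))
  calc w * (∫⁻ t in I, f t ^ q) ^ (1 / q) = (∫⁻ t in I, (w * f t) ^ q) ^ (1 / q) := by
        simp_rw [ENNReal.mul_rpow_of_nonneg _ _ hq0.le]
        rw [lintegral_const_mul' _ _ hwq, ENNReal.mul_rpow_of_nonneg _ _ (by positivity),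
          ← ENNReal.rpow_mul, mul_one_div_cancel hq0.ne', ENNReal.rpow_one]
    _ ≤ (∫⁻ t, (∫⁻ z, w * heatFactor t z.1 z.2 * G z ∂ν) ^ q) ^ (1 / q) := by
        refine ENNReal.rpow_le_rpow ?_ (by positivity)
        refine (setLIntegral_mono' hI fun t ht => ?_).trans (setLIntegral_le_lintegral _ _)
        refine ENNReal.rpow_le_rpow ?_ hq0.le
        simp_rw [mul_assoc]
        rw [lintegral_const_mul' _ _ hw]
        gcongr
        exact hf t ht
    _ ≤ ((4 * dyadicWeight (-1) j * ∫⁻ z, G z ∂ν) ^ q) ^ (1 / q) := by gcongr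
    _ = _ := by
        rw [← ENNReal.rpow_mul, mul_one_div_cancel hq0.ne', ENNReal.rpow_one, mul_assoc]

theorem blockMass_flowHat_le (D : LittlewoodPaley) {q : ℝ} (hq : 1 ≤ q) (T : EReal) {v₀ : R3 → C6}
    (hv : StronglyMeasurable v₀) (j : ℤ) :
    dyadicWeight (-1 + 2 / q) j *
        (∫⁻ t in timeIoo T, blockMass D j (fun ξ => flowHat t ξ (v₀ ξ)) ^ q) ^ (1 / q)
      ≤ 4 * (dyadicWeight (-1) j * blockMass D j v₀) := by
  have hG : Measurable fun z : ℝ × R3 => blockCut D j z.2 * ‖v₀ z.2‖ₑ :=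
    ((measurable_blockCut D j).comp measurable_snd).mul (hv.enorm.comp measurable_snd)
  have hint : ∀ G : ℝ × R3 → ℝ≥0∞, Measurable G →
      ∫⁻ z, G z ∂((Measure.dirac (0 : ℝ)).prod (volume : Measure R3)) = ∫⁻ ξ, G (0, ξ) :=
    fun G hG => by
      rw [lintegral_prod _ hG.aemeasurable, lintegral_dirac' _ hG.lintegral_prod_right']
  have h := dyadicWeight_mul_lintegral_rpow_le D hq (measurableSet_timeIoo T)
    (ν := (Measure.dirac (0 : ℝ)).prod (volume : Measure R3))
    (f := fun t => blockMass D j fun ξ => flowHat t ξ (v₀ ξ)) hG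
    (fun z hz => left_ne_zero_of_mul hz) (j := j) fun t ht => by
      have hm : Measurable fun z : ℝ × R3 =>
          heatFactor t z.1 z.2 * (blockCut D j z.2 * ‖v₀ z.2‖ₑ) :=
        (measurable_heatFactor.comp (measurable_const.prodMk measurable_id)).mul hG
      rw [hint _ hm]
      refine lintegral_mono fun ξ => ?_
      rw [mul_left_comm]
      gcongr
      have := enorm_flowHat_le_heatFactor ht.1 ξ (v₀ ξ)
      rwa [sub_zero] at this
  rwa [hint _ hG] at h

theorem dyadicNorm_flowHat_le (D : LittlewoodPaley) {q r : ℝ} (hq : 1 ≤ q) (hr : 1 ≤ r) (T : EReal)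
    {v₀ : R3 → C6} (hv : StronglyMeasurable v₀) :
    dyadicNorm (-1 + 2 / q) r (fun j =>
        (∫⁻ t in timeIoo T, blockMass D j (fun ξ => flowHat t ξ (v₀ ξ)) ^ q) ^ (1 / q))
      ≤ 4 * dyadicNorm (-1) r (fun j => blockMass D j v₀) := by
  have hr0 : 0 < r := by linarith
  rw [← dyadicNorm_const_mul hr0]
  simp only [dyadicNorm_eq]
  refine ENNReal.rpow_le_rpow (ENNReal.tsum_le_tsum fun j => ENNReal.rpow_le_rpow ?_ hr0.le)
    (by positivity)
  rw [mul_left_comm]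
  exact blockMass_flowHat_le D hq T hv j

theorem blockMass_lt_top {D : LittlewoodPaley} {r : ℝ} (hr : 1 ≤ r) {v₀ : R3 → C6}
    (h : dyadicNorm (-1) r (fun j => blockMass D j v₀) < ∞) (j : ℤ) : blockMass D j v₀ < ∞ := by
  have h1 := (le_dyadicNorm (s := -1) hr (fun j => blockMass D j v₀) j).trans_lt h
  refine lt_of_mul_lt_mul_right' (a := dyadicWeight (-1) j) ?_
  rw [ENNReal.top_mul]
  · rwa [mul_comm] at h1
  · exact (ENNReal.ofReal_pos.2 (by positivity)).ne'

/-- Continuity in time of the linear flow, with values in `FḂ^{-1}_{1,r}`. -/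
theorem tendsto_dyadicNorm_flowHat_sub (D : LittlewoodPaley) {r : ℝ} (hr : 1 ≤ r) (T : EReal)
    {v₀ : R3 → C6} (hv : StronglyMeasurable v₀)
    (hfin : dyadicNorm (-1) r (fun j => blockMass D j v₀) < ∞) {t₀ : ℝ} (ht₀ : t₀ ∈ timeIco T) :
    Tendsto (fun t => dyadicNorm (-1) r
        (fun j => blockMass D j fun ξ => flowHat t ξ (v₀ ξ) - flowHat t₀ ξ (v₀ ξ)))
      (𝓝[timeIco T] t₀) (𝓝 0) := by
  have hr0 : 0 < r := by linarith
  have hbound : ∀ t ∈ timeIco T, ∀ ξ, ‖flowHat t ξ (v₀ ξ) - flowHat t₀ ξ (v₀ ξ)‖ₑ ≤ 2 * ‖v₀ ξ‖ₑ :=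
    fun t ht ξ => by
      rw [two_mul]
      exact enorm_sub_le.trans
        (add_le_add (enorm_flowHat_le ht.1 _ _) (enorm_flowHat_le ht₀.1 _ _))
  have hmeas : ∀ t, StronglyMeasurable fun ξ => flowHat t ξ (v₀ ξ) := fun t =>
    (stronglyMeasurable_flowHat hv).comp_measurable measurable_prodMk_left
  have hcut : ∀ j, Measurable fun ξ => blockCut D j ξ * (2 * ‖v₀ ξ‖ₑ) := fun j =>
    (measurable_blockCut D j).mul (hv.enorm.const_mul 2)
  have h2 : ∀ j, ∫⁻ ξ, blockCut D j ξ * (2 * ‖v₀ ξ‖ₑ) = 2 * blockMass D j v₀ := fun j => by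
    simp_rw [mul_left_comm _ (2 : ℝ≥0∞)]
    rw [lintegral_const_mul' _ _ (by simp)]
    rfl
  have hblock : ∀ j, Tendsto
      (fun t => blockMass D j fun ξ => flowHat t ξ (v₀ ξ) - flowHat t₀ ξ (v₀ ξ))
      (𝓝[timeIco T] t₀) (𝓝 0) := by
    intro j
    have := tendsto_lintegral_filter_of_dominated_convergence (μ := volume)
      (l := 𝓝[timeIco T] t₀)
      (F := fun t ξ => blockCut D j ξ * ‖flowHat t ξ (v₀ ξ) - flowHat t₀ ξ (v₀ ξ)‖ₑ)
      (f := fun _ => 0) (fun ξ => blockCut D j ξ * (2 * ‖v₀ ξ‖ₑ))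
      (Eventually.of_forall fun t => (measurable_blockCut D j).mul ((hmeas t).sub (hmeas t₀)).enorm)
      (eventually_mem_nhdsWithin.mono fun t ht => ae_of_all _ fun ξ => by
        gcongr; exact hbound t ht ξ)
      (by rw [h2]; exact (ENNReal.mul_lt_top (by simp) (blockMass_lt_top hr hfin j)).ne)
      (ae_of_all _ fun ξ => by
        have hc : Tendsto (fun t => ‖flowHat t ξ (v₀ ξ) - flowHat t₀ ξ (v₀ ξ)‖ₑ)
            (𝓝[timeIco T] t₀) (𝓝 0) := by
          have hcont : Continuous fun t => ‖flowHat t ξ (v₀ ξ) - flowHat t₀ ξ (v₀ ξ)‖ₑ :=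
            ((continuous_flowHat_time ξ (v₀ ξ)).sub continuous_const).enorm
          have := hcont.tendsto t₀
          simp only [sub_self, enorm_zero] at this
          exact this.mono_left nhdsWithin_le_nhds
        have := ENNReal.Tendsto.const_mul (a := blockCut D j ξ) hc
          (Or.inr ENNReal.ofReal_ne_top)
        simpa using this)
    simpa [blockMass] using this
  have hle : ∀ t ∈ timeIco T, ∀ j,
      blockMass D j (fun ξ => flowHat t ξ (v₀ ξ) - flowHat t₀ ξ (v₀ ξ)) ≤ 2 * blockMass D j v₀ :=
    fun t ht j => by
      rw [← h2]
      exact lintegral_mono fun ξ => mul_le_mul_right (hbound t ht ξ) _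
  have hsum : Tendsto (fun t => ∑' j, (dyadicWeight (-1) j *
      blockMass D j fun ξ => flowHat t ξ (v₀ ξ) - flowHat t₀ ξ (v₀ ξ)) ^ r)
      (𝓝[timeIco T] t₀) (𝓝 0) := by
    have := tendsto_lintegral_filter_of_dominated_convergence (μ := (Measure.count : Measure ℤ))
      (l := 𝓝[timeIco T] t₀)
      (F := fun t j => (dyadicWeight (-1) j *
        blockMass D j fun ξ => flowHat t ξ (v₀ ξ) - flowHat t₀ ξ (v₀ ξ)) ^ r)
      (f := fun _ => 0) (fun j => (dyadicWeight (-1) j * (2 * blockMass D j v₀)) ^ r)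
      (Eventually.of_forall fun t => measurable_of_countable _)
      (eventually_mem_nhdsWithin.mono fun t ht => ae_of_all _ fun j => by
        gcongr; exact hle t ht j)
      (by
        rw [lintegral_count]
        have h3 : dyadicNorm (-1) r (fun j => 2 * blockMass D j v₀) < ∞ := by
          rw [dyadicNorm_const_mul hr0]
          exact ENNReal.mul_lt_top (by simp) hfin
        rw [dyadicNorm_eq, ENNReal.rpow_lt_top_iff_of_pos (by positivity)] at h3
        exact h3.ne)
      (ae_of_all _ fun j => by
        have h4 := ENNReal.Tendsto.const_mul (a := dyadicWeight (-1) j) (hblock j)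
          (Or.inr ENNReal.ofReal_ne_top)
        rw [mul_zero] at h4
        have h5 := (ENNReal.continuous_rpow_const (y := r)).tendsto 0 |>.comp h4
        simpa [Function.comp_def, ENNReal.zero_rpow_of_pos hr0] using h5)
    simpa [lintegral_count] using this
  have h6 := (ENNReal.continuous_rpow_const (y := 1 / r)).tendsto 0 |>.comp hsum
  simpa [Function.comp_def, ENNReal.zero_rpow_of_pos (inv_pos.2 hr0), dyadicNorm_eq] using h6

end LinearFlow

/-! ### The Duhamel integral -/

section Duhamel

/-- The Fourier transform of `∫_0^t G(t-τ) 𝐏̃ ∇·N(τ) dτ`, where `n(τ, ·)` is the Fourier transform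
of `N(τ)`. -/
def duhamelInt (n : ℝ × R3 → C3x6) (t : ℝ) (ξ : R3) : C6 :=
  ∫ τ in Ioo 0 t, flowHat (t - τ) ξ (forceHat ξ (n (τ, ξ)))

variable {n : ℝ × R3 → C3x6}

theorem enorm_forceHat_le (ξ : R3) (m : C3x6) : ‖forceHat ξ m‖ₑ ≤ 216 * (‖ξ‖ₑ * ‖m‖ₑ) := by
  rw [← ofReal_norm, ← ofReal_norm, ← ofReal_norm, ← ENNReal.ofReal_mul (norm_nonneg _),
    ← ENNReal.ofReal_ofNat 216, ← ENNReal.ofReal_mul (by norm_num)]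
  exact ENNReal.ofReal_le_ofReal (norm_forceHat_le ξ m)

theorem enorm_flowHat_forceHat_le {t τ : ℝ} (h : τ < t) (ξ : R3) (m : C3x6) :
    ‖flowHat (t - τ) ξ (forceHat ξ m)‖ₑ ≤ 216 * (heatFactor t τ ξ * (‖ξ‖ₑ * ‖m‖ₑ)) := by
  refine (enorm_flowHat_le_heatFactor h ξ _).trans ?_
  rw [mul_left_comm]
  gcongr
  exact enorm_forceHat_le ξ m

theorem heatFactor_le_one (t τ : ℝ) (ξ : R3) : heatFactor t τ ξ ≤ 1 := by
  unfold heatFactor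
  split_ifs with h
  · refine ENNReal.ofReal_le_one.2 (Real.exp_le_one_iff.2 ?_)
    have : 0 ≤ (t - τ) * (‖ξ‖ ^ 2 / 2) := mul_nonneg (by linarith) (by positivity)
    linarith
  · exact zero_le_one

theorem enorm_duhamelInt_le {T : EReal} {t : ℝ} (ht : t ∈ timeIco T) (ξ : R3) :
    ‖duhamelInt n t ξ‖ₑ
      ≤ 216 * ∫⁻ τ in timeIoo T, heatFactor t τ ξ * (‖ξ‖ₑ * ‖n (τ, ξ)‖ₑ) := by
  rw [← lintegral_const_mul' _ _ (by simp)]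
  refine (enorm_integral_le_lintegral_enorm _).trans ?_
  refine (setLIntegral_mono' measurableSet_Ioo fun τ hτ => ?_).trans
    (lintegral_mono_set (Ioo_subset_timeIoo ht))
  exact enorm_flowHat_forceHat_le hτ.2 ξ _

theorem enorm_duhamelInt_le_norm_mul {T : EReal} {t : ℝ} (ht : t ∈ timeIco T) (ξ : R3) :
    ‖duhamelInt n t ξ‖ₑ ≤ ‖ξ‖ₑ * (216 * ∫⁻ τ in timeIoo T, ‖n (τ, ξ)‖ₑ) := by
  refine (enorm_duhamelInt_le ht ξ).trans ?_
  rw [mul_left_comm]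
  refine mul_le_mul_right ?_ _
  rw [← lintegral_const_mul' _ _ enorm_ne_top]
  exact lintegral_mono fun τ => mul_le_of_le_one_left zero_le (heatFactor_le_one _ _ _)

theorem stronglyMeasurable_duhamel_integrand (hn : StronglyMeasurable n) :
    StronglyMeasurable fun p : (ℝ × R3) × ℝ =>
      flowHat (p.1.1 - p.2) p.1.2 (forceHat p.1.2 (n (p.2, p.1.2))) := by
  have h1 : StronglyMeasurable fun p : (ℝ × R3) × ℝ => forceHat p.1.2 (n (p.2, p.1.2)) := by
    have h : Measurable fun p : (ℝ × R3) × ℝ => ((p.1.2, n (p.2, p.1.2)) : R3 × C3x6) :=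
      (by fun_prop : Measurable fun p : (ℝ × R3) × ℝ => p.1.2).prodMk
        (hn.measurable.comp (by fun_prop : Measurable fun p : (ℝ × R3) × ℝ => (p.2, p.1.2)))
    exact (measurable_forceHat.comp h).stronglyMeasurable
  have h2 : StronglyMeasurable fun p : (ℝ × R3) × ℝ => ((p.1.1 - p.2, p.1.2) : ℝ × R3) :=
    Measurable.stronglyMeasurable (by fun_prop)
  exact continuous_flowHat.comp_stronglyMeasurable (h2.prodMk h1)

theorem stronglyMeasurable_duhamelInt (hn : StronglyMeasurable n) :
    StronglyMeasurable (Function.uncurry (duhamelInt n)) := by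
  have h1 : StronglyMeasurable fun p : (ℝ × R3) × ℝ => (Ioo 0 p.1.1).indicator
      (fun τ => flowHat (p.1.1 - τ) p.1.2 (forceHat p.1.2 (n (τ, p.1.2)))) p.2 := by
    have hs : MeasurableSet {p : (ℝ × R3) × ℝ | 0 < p.2 ∧ p.2 < p.1.1} :=
      (measurableSet_lt measurable_const measurable_snd).inter
        (measurableSet_lt measurable_snd (measurable_fst.comp measurable_fst))
    exact (stronglyMeasurable_duhamel_integrand hn).indicator hs
  have h2 := h1.integral_prod_right' (ν := volume)
  have e : Function.uncurry (duhamelInt n) = fun p : ℝ × R3 => ∫ τ, (Ioo 0 p.1).indicator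
      (fun τ => flowHat (p.1 - τ) p.2 (forceHat p.2 (n (τ, p.2)))) τ := by
    ext1 p
    rw [integral_indicator measurableSet_Ioo]
    rfl
  rw [e]
  exact h2

/-- Duhamel integrals of `L¹` functions are in `L²(0, T; L¹)`: the kernel `|ξ| e^{-(t-τ)|ξ|²/2}` has
norm at most `1` in `L²` of the time variable. -/
theorem lintegral_sq_duhamelInt_le (hn : StronglyMeasurable n) (T : EReal) :
    ∫⁻ t in timeIoo T, (∫⁻ ξ, ‖duhamelInt n t ξ‖ₑ) ^ 2
      ≤ (216 * ∫⁻ z, ‖n z‖ₑ ∂spaceTime T) ^ 2 := by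
  have hK : Measurable (Function.uncurry fun (t : ℝ) (z : ℝ × R3) =>
      216 * (heatFactor t z.1 z.2 * ‖z.2‖ₑ)) :=
    (measurable_heatFactor.mul
      (by fun_prop : Measurable fun p : ℝ × (ℝ × R3) => ‖p.2.2‖ₑ)).const_mul _
  have h1 := lintegral_rpow_lintegral_mul_le (μ := volume.restrict (timeIoo T)) (ν := spaceTime T)
    hK hn.enorm (A := 216) (q := 2) one_le_two (fun z _ => by
      refine (lintegral_mono' Measure.restrict_le_self le_rfl).trans ?_
      simp_rw [ENNReal.mul_rpow_of_nonneg _ _ zero_le_two]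
      rw [lintegral_const_mul' _ _ (by simp)]
      refine mul_le_of_le_one_right zero_le ?_
      have hne : ‖z.2‖ₑ ^ (2 : ℝ) ≠ ∞ := ENNReal.rpow_ne_top_of_nonneg zero_le_two enorm_ne_top
      rw [lintegral_mul_const' _ _ hne]
      by_cases hz : z.2 = 0
      · simp [hz]
      have hz' : 0 < ‖z.2‖ := norm_pos_iff.2 hz
      rw [lintegral_heatFactor_rpow two_pos z.1 hz, ← ofReal_norm,
        ENNReal.ofReal_rpow_of_pos hz', ← ENNReal.ofReal_mul (by positivity)]
      refine ENNReal.ofReal_le_one.2 (le_of_eq ?_)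
      rw [Real.rpow_two]
      field_simp)
  simp only [ENNReal.rpow_two] at h1
  refine le_trans ?_ h1
  refine setLIntegral_mono' (measurableSet_timeIoo T) fun t ht => ?_
  gcongr
  have hm : Measurable fun z : ℝ × R3 => 216 * (heatFactor t z.1 z.2 * ‖z.2‖ₑ) * ‖n z‖ₑ :=
    (hK.comp measurable_prodMk_left).mul hn.enorm
  rw [spaceTime, lintegral_prod_symm' _ hm]
  refine lintegral_mono fun ξ => (enorm_duhamelInt_le (timeIoo_subset_timeIco T ht) ξ).trans ?_
  rw [← lintegral_const_mul' _ _ (by simp)]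
  simp only [mul_assoc]
  exact le_rfl

theorem blockMass_duhamelInt_le (D : LittlewoodPaley) (hn : StronglyMeasurable n) {T : EReal}
    {t : ℝ} (ht : t ∈ timeIco T) (j : ℤ) :
    blockMass D j (duhamelInt n t) ≤
      ∫⁻ z, heatFactor t z.1 z.2 * (216 * (blockCut D j z.2 * (‖z.2‖ₑ * ‖n z‖ₑ))) ∂spaceTime T := by
  have hm : Measurable fun z : ℝ × R3 =>
      heatFactor t z.1 z.2 * (216 * (blockCut D j z.2 * (‖z.2‖ₑ * ‖n z‖ₑ))) :=
    (measurable_heatFactor.comp measurable_prodMk_left).mul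
      ((((measurable_blockCut D j).comp measurable_snd).mul
        ((by fun_prop : Measurable fun z : ℝ × R3 => ‖z.2‖ₑ).mul hn.enorm)).const_mul _)
  rw [spaceTime, lintegral_prod_symm' _ hm]
  refine lintegral_mono fun ξ => (mul_le_mul_right (enorm_duhamelInt_le ht ξ) _).trans ?_
  have hc : blockCut D j ξ * 216 ≠ ∞ := ENNReal.mul_ne_top ENNReal.ofReal_ne_top (by simp)
  rw [← mul_assoc, ← lintegral_const_mul' _ _ hc]
  refine lintegral_mono fun τ => le_of_eq ?_
  ring

theorem tsum_blockCut_le_one (D : LittlewoodPaley) (ξ : R3) : ∑' j, blockCut D j ξ ≤ 1 := by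
  by_cases hξ : ξ = 0
  · have : ∀ j, blockCut D j ξ = 0 := fun j => by
      by_contra h
      have h1 := (blockCut_support D h).1
      rw [hξ, norm_zero] at h1
      have : (0 : ℝ) < 3 / 4 * 2 ^ (j : ℝ) := by positivity
      linarith
    simp [this]
  · exact (tsum_blockCut D hξ).le

/-- Duhamel integrals of `L¹` functions are in `L̃^q(0, T; FḂ^{-1+2/q}_{1,1})`. -/
theorem dyadicNorm_duhamelInt_le (D : LittlewoodPaley) (hn : StronglyMeasurable n) {q r : ℝ}
    (hq : 1 ≤ q) (hr : 1 ≤ r) (T : EReal) :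
    dyadicNorm (-1 + 2 / q) r (fun j =>
        (∫⁻ t in timeIoo T, blockMass D j (duhamelInt n t) ^ q) ^ (1 / q))
      ≤ 2592 * ∫⁻ z, ‖n z‖ₑ ∂spaceTime T := by
  have hcut : ∀ j, Measurable fun z : ℝ × R3 => blockCut D j z.2 * ‖n z‖ₑ := fun j =>
    ((measurable_blockCut D j).comp measurable_snd).mul hn.enorm
  have hG : ∀ j, Measurable fun z : ℝ × R3 => 216 * (blockCut D j z.2 * (‖z.2‖ₑ * ‖n z‖ₑ)) :=
    fun j => (((measurable_blockCut D j).comp measurable_snd).mul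
      ((by fun_prop : Measurable fun z : ℝ × R3 => ‖z.2‖ₑ).mul hn.enorm)).const_mul _
  refine (dyadicNorm_le_tsum hr _).trans ?_
  calc _ ≤ ∑' j, 2592 * ∫⁻ z, blockCut D j z.2 * ‖n z‖ₑ ∂spaceTime T := by
        refine ENNReal.tsum_le_tsum fun j => ?_
        refine (dyadicWeight_mul_lintegral_rpow_le D hq (measurableSet_timeIoo T)
          (ν := spaceTime T) (hG j) (fun z hz => left_ne_zero_of_mul (right_ne_zero_of_mul hz))
          (fun t ht => blockMass_duhamelInt_le D hn (timeIoo_subset_timeIco T ht) j)).trans ?_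
        have hw : dyadicWeight (-1) j ≠ ∞ := ENNReal.ofReal_ne_top
        rw [← lintegral_const_mul' _ _ hw, ← lintegral_const_mul' _ _ (by simp),
          ← lintegral_const_mul' _ _ (by simp)]
        refine lintegral_mono fun z => ?_
        by_cases h0 : blockCut D j z.2 = 0
        · simp [h0]
        have hd := dyadicWeight_mul_enorm_le D h0
        calc 4 * (dyadicWeight (-1) j * (216 * (blockCut D j z.2 * (‖z.2‖ₑ * ‖n z‖ₑ))))
            = 864 * (dyadicWeight (-1) j * ‖z.2‖ₑ) * (blockCut D j z.2 * ‖n z‖ₑ) := by ring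
          _ ≤ 864 * 3 * (blockCut D j z.2 * ‖n z‖ₑ) := by gcongr
          _ = _ := by norm_num
    _ = 2592 * ∫⁻ z, ∑' j, blockCut D j z.2 * ‖n z‖ₑ ∂spaceTime T := by
        rw [ENNReal.tsum_mul_left, lintegral_tsum fun j => (hcut j).aemeasurable]
    _ ≤ _ := by
        gcongr with z
        rw [ENNReal.tsum_mul_right]
        exact mul_le_of_le_one_left zero_le (tsum_blockCut_le_one D z.2)

theorem lintegral_spaceTime_symm (hn : StronglyMeasurable n) (T : EReal) :
    ∫⁻ ξ, ∫⁻ τ in timeIoo T, ‖n (τ, ξ)‖ₑ = ∫⁻ z, ‖n z‖ₑ ∂spaceTime T := by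
  rw [spaceTime, lintegral_prod_symm' _ hn.enorm]

theorem measurable_lintegral_time (hn : StronglyMeasurable n) (T : EReal) :
    Measurable fun ξ => ∫⁻ τ in timeIoo T, ‖n (τ, ξ)‖ₑ :=
  (hn.enorm.comp measurable_swap).lintegral_prod_right'

theorem ae_lintegral_time_lt_top (hn : StronglyMeasurable n) {T : EReal}
    (hfin : ∫⁻ z, ‖n z‖ₑ ∂spaceTime T < ∞) : ∀ᵐ ξ, ∫⁻ τ in timeIoo T, ‖n (τ, ξ)‖ₑ < ∞ := by
  rw [← lintegral_spaceTime_symm hn] at hfin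
  exact ae_lt_top (measurable_lintegral_time hn T) hfin.ne

/-- Duhamel integrals of `L¹` functions are bounded in `FḂ^{-1}_{1,1}`. -/
theorem tsum_blockMass_duhamelInt_le (D : LittlewoodPaley) (hn : StronglyMeasurable n) {T : EReal}
    {t : ℝ} (ht : t ∈ timeIco T) :
    ∑' j, dyadicWeight (-1) j * blockMass D j (duhamelInt n t)
      ≤ 648 * ∫⁻ z, ‖n z‖ₑ ∂spaceTime T := by
  refine (tsum_blockMass_le D ((measurable_lintegral_time hn T).const_mul 216).aemeasurable
    (ae_of_all _ fun ξ => enorm_duhamelInt_le_norm_mul ht ξ)).trans (le_of_eq ?_)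
  rw [lintegral_const_mul' _ _ (by simp), lintegral_spaceTime_symm hn, ← mul_assoc]
  norm_num

theorem integrableOn_duhamel_integrand (hn : StronglyMeasurable n) {T : EReal} {ξ : R3}
    (hξ : ∫⁻ τ in timeIoo T, ‖n (τ, ξ)‖ₑ < ∞) {t : ℝ} (ht : t ∈ timeIco T) :
    IntegrableOn (fun τ => flowHat (t - τ) ξ (forceHat ξ (n (τ, ξ)))) (Ioo 0 t) := by
  have hm : StronglyMeasurable fun τ => flowHat (t - τ) ξ (forceHat ξ (n (τ, ξ))) :=
    (stronglyMeasurable_duhamel_integrand hn).comp_measurable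
      (measurable_prodMk_left (x := ((t, ξ) : ℝ × R3)))
  refine ⟨hm.aestronglyMeasurable, ?_⟩
  have hle : ∀ τ ∈ Ioo 0 t, ‖flowHat (t - τ) ξ (forceHat ξ (n (τ, ξ)))‖ₑ
      ≤ 216 * (‖ξ‖ₑ * ‖n (τ, ξ)‖ₑ) := fun τ hτ =>
    (enorm_flowHat_le (sub_pos.2 hτ.2).le _ _).trans (enorm_forceHat_le _ _)
  refine (setLIntegral_mono' measurableSet_Ioo hle).trans_lt ?_
  rw [lintegral_const_mul' _ _ (by simp), lintegral_const_mul' _ _ enorm_ne_top]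
  exact ENNReal.mul_lt_top (by simp) (ENNReal.mul_lt_top enorm_lt_top
    ((lintegral_mono_set (Ioo_subset_timeIoo ht)).trans_lt hξ))

theorem tendsto_duhamelInt (hn : StronglyMeasurable n) {T : EReal} {ξ : R3}
    (hξ : ∫⁻ τ in timeIoo T, ‖n (τ, ξ)‖ₑ < ∞) {t₀ : ℝ} (ht₀ : t₀ ∈ timeIco T) :
    Tendsto (fun t => duhamelInt n t ξ) (𝓝[timeIco T] t₀) (𝓝 (duhamelInt n t₀ ξ)) := by
  have hind : ∀ t, t ∈ timeIco T → duhamelInt n t ξ = ∫ τ in timeIoo T, (Iio t).indicator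
      (fun τ => flowHat (t - τ) ξ (forceHat ξ (n (τ, ξ)))) τ := fun t ht => by
    rw [duhamelInt, setIntegral_indicator measurableSet_Iio]
    congr 2
    ext τ
    exact ⟨fun h => ⟨Ioo_subset_timeIoo ht h, h.2⟩, fun h => ⟨h.1.1, h.2⟩⟩
  rw [hind t₀ ht₀]
  refine Tendsto.congr' (eventually_mem_nhdsWithin.mono fun t ht => (hind t ht).symm) ?_
  have hnξ : StronglyMeasurable fun τ => n (τ, ξ) :=
    hn.comp_measurable (measurable_prodMk_right (y := ξ))
  have hm : ∀ t : ℝ, StronglyMeasurable fun τ => flowHat (t - τ) ξ (forceHat ξ (n (τ, ξ))) :=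
    fun t => (stronglyMeasurable_duhamel_integrand hn).comp_measurable
      (measurable_prodMk_left (x := ((t, ξ) : ℝ × R3)))
  refine tendsto_integral_filter_of_dominated_convergence
    (fun τ => 216 * (‖ξ‖ * ‖n (τ, ξ)‖))
    (Eventually.of_forall fun t => ((hm t).indicator measurableSet_Iio).aestronglyMeasurable)
    (Eventually.of_forall fun t => ae_of_all _ fun τ => ?_) ?_ ?_
  · by_cases hτ : τ < t
    · rw [indicator_of_mem (mem_Iio.2 hτ)]
      refine le_trans ?_ (norm_forceHat_le ξ (n (τ, ξ)))
      refine (norm_flowHat_le (sub_pos.2 hτ).le ξ _).trans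
        (mul_le_of_le_one_left (norm_nonneg _) (Real.exp_le_one_iff.2 ?_))
      have : 0 ≤ (t - τ) * (‖ξ‖ ^ 2 / 2) := mul_nonneg (sub_pos.2 hτ).le (by positivity)
      linarith
    · rw [indicator_of_notMem (by simpa using hτ), norm_zero]
      positivity
  · have hi : IntegrableOn (fun τ => n (τ, ξ)) (timeIoo T) := ⟨hnξ.aestronglyMeasurable, hξ⟩
    exact (hi.norm.const_mul _).const_mul _
  · have hne : ∀ᵐ τ ∂(volume.restrict (timeIoo T)), τ ≠ t₀ :=
      ae_restrict_of_ae (Measure.ae_ne volume t₀)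
    filter_upwards [hne] with τ hτ
    rcases lt_or_gt_of_ne hτ with h | h
    · rw [indicator_of_mem (mem_Iio.2 h)]
      have hc : Continuous fun t : ℝ => flowHat (t - τ) ξ (forceHat ξ (n (τ, ξ))) :=
        (continuous_flowHat_time ξ _).comp (continuous_id.sub continuous_const)
      refine ((hc.tendsto t₀).mono_left nhdsWithin_le_nhds).congr' ?_
      filter_upwards [mem_nhdsWithin_of_mem_nhds (Ioi_mem_nhds h)] with t ht
      exact (indicator_of_mem (s := Iio t) (mem_Ioi.1 ht)
        fun τ => flowHat (t - τ) ξ (forceHat ξ (n (τ, ξ)))).symm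
    · rw [indicator_of_notMem (by simpa using h.le)]
      refine tendsto_const_nhds.congr' ?_
      filter_upwards [mem_nhdsWithin_of_mem_nhds (Iio_mem_nhds h)] with t ht
      exact (indicator_of_notMem (s := Iio t) (not_lt.2 (mem_Iio.1 ht).le)
        fun τ => flowHat (t - τ) ξ (forceHat ξ (n (τ, ξ)))).symm

/-- Continuity in time of Duhamel integrals, with values in `FḂ^{-1}_{1,1}`. -/
theorem tendsto_tsum_blockMass_duhamelInt_sub (D : LittlewoodPaley) (hn : StronglyMeasurable n)
    {T : EReal} (hfin : ∫⁻ z, ‖n z‖ₑ ∂spaceTime T < ∞) {t₀ : ℝ} (ht₀ : t₀ ∈ timeIco T) :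
    Tendsto (fun t => ∑' j, dyadicWeight (-1) j *
        blockMass D j fun ξ => duhamelInt n t ξ - duhamelInt n t₀ ξ) (𝓝[timeIco T] t₀) (𝓝 0) := by
  have hm : ∀ t, StronglyMeasurable (duhamelInt n t) := fun t =>
    (stronglyMeasurable_duhamelInt hn).comp_measurable measurable_prodMk_left
  have hh : ∀ t, Measurable fun ξ : R3 => ‖ξ‖ₑ⁻¹ * ‖duhamelInt n t ξ - duhamelInt n t₀ ξ‖ₑ :=
    fun t => (by fun_prop : Measurable fun ξ : R3 => ‖ξ‖ₑ⁻¹).mul ((hm t).sub (hm t₀)).enorm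
  have hle : ∀ t, ∑' j, dyadicWeight (-1) j *
      blockMass D j (fun ξ => duhamelInt n t ξ - duhamelInt n t₀ ξ)
        ≤ 3 * ∫⁻ ξ, ‖ξ‖ₑ⁻¹ * ‖duhamelInt n t ξ - duhamelInt n t₀ ξ‖ₑ := fun t => by
    refine tsum_blockMass_le D (hh t).aemeasurable (ae_ne_zero_R3.mono fun ξ hξ => ?_)
    rw [← mul_assoc, ENNReal.mul_inv_cancel (by simpa using hξ) enorm_ne_top, one_mul]
  have hlim : Tendsto (fun t => ∫⁻ ξ, ‖ξ‖ₑ⁻¹ * ‖duhamelInt n t ξ - duhamelInt n t₀ ξ‖ₑ)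
      (𝓝[timeIco T] t₀) (𝓝 (∫⁻ _ : R3, 0)) := by
    refine tendsto_lintegral_filter_of_dominated_convergence
      (fun ξ => 432 * ∫⁻ τ in timeIoo T, ‖n (τ, ξ)‖ₑ)
      (Eventually.of_forall hh) (eventually_mem_nhdsWithin.mono fun t ht => ?_) ?_ ?_
    · filter_upwards [ae_ne_zero_R3] with ξ hξ
      have h1 : ‖duhamelInt n t ξ - duhamelInt n t₀ ξ‖ₑ
          ≤ ‖ξ‖ₑ * (432 * ∫⁻ τ in timeIoo T, ‖n (τ, ξ)‖ₑ) := by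
        refine (enorm_sub_le.trans (add_le_add (enorm_duhamelInt_le_norm_mul ht ξ)
          (enorm_duhamelInt_le_norm_mul ht₀ ξ))).trans (le_of_eq ?_)
        ring
      calc _ ≤ ‖ξ‖ₑ⁻¹ * (‖ξ‖ₑ * (432 * ∫⁻ τ in timeIoo T, ‖n (τ, ξ)‖ₑ)) := by gcongr
        _ = _ := by
            rw [← mul_assoc, ENNReal.inv_mul_cancel (by simpa using hξ) enorm_ne_top, one_mul]
    · rw [lintegral_const_mul' _ _ (by simp), lintegral_spaceTime_symm hn]
      exact (ENNReal.mul_lt_top (by simp) hfin).ne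
    · filter_upwards [ae_lintegral_time_lt_top hn hfin, ae_ne_zero_R3] with ξ hξ hξ0
      have h1 : Tendsto (fun t => ‖duhamelInt n t ξ - duhamelInt n t₀ ξ‖ₑ)
          (𝓝[timeIco T] t₀) (𝓝 0) := by
        have h2 := ((tendsto_duhamelInt hn hξ ht₀).sub_const (duhamelInt n t₀ ξ)).enorm
        simpa only [sub_self, enorm_zero] using h2
      have := ENNReal.Tendsto.const_mul (a := ‖ξ‖ₑ⁻¹) h1
        (Or.inr (ENNReal.inv_ne_top.2 (by simpa using hξ0)))
      simpa using this
  rw [lintegral_zero] at hlim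
  have h3 := ENNReal.Tendsto.const_mul (a := 3) hlim (Or.inr (by simp))
  rw [mul_zero] at h3
  exact tendsto_of_tendsto_of_tendsto_of_le_of_le tendsto_const_nhds h3 (fun _ => zero_le) hle

end Duhamel

/-! ### The fixed point problem for the nonlinearity -/

section FixedPoint

theorem lintegral_mul_le_of_lintegral_sq_le {X : Type*} [MeasurableSpace X] {μ : Measure X}
    {f g : X → ℝ≥0∞} (hf : AEMeasurable f μ) (hg : AEMeasurable g μ) {A B : ℝ≥0∞}
    (hA : ∫⁻ x, f x ^ 2 ∂μ ≤ A ^ 2) (hB : ∫⁻ x, g x ^ 2 ∂μ ≤ B ^ 2) :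
    ∫⁻ x, f x * g x ∂μ ≤ A * B := by
  have h := ENNReal.lintegral_mul_le_Lp_mul_Lq μ Real.HolderConjugate.two_two hf hg
  simp only [ENNReal.rpow_two, Pi.mul_apply] at h
  have hs : ∀ x : ℝ≥0∞, (x ^ 2) ^ (1 / 2 : ℝ) = x := fun x => by
    rw [← ENNReal.rpow_two, ← ENNReal.rpow_mul]; norm_num
  refine h.trans (mul_le_mul' ?_ ?_)
  · exact (ENNReal.rpow_le_rpow hA (by norm_num)).trans (hs A).le
  · exact (ENNReal.rpow_le_rpow hB (by norm_num)).trans (hs B).le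

theorem measurable_lintegral_enorm {v : ℝ → R3 → C6}
    (hv : StronglyMeasurable (Function.uncurry v)) : Measurable fun t => ∫⁻ ξ, ‖v t ξ‖ₑ :=
  hv.enorm.lintegral_prod_right'

theorem stronglyMeasurable_slice {F : Type*} [TopologicalSpace F] {v : ℝ → R3 → F}
    (hv : StronglyMeasurable (Function.uncurry v)) (t : ℝ) : StronglyMeasurable (v t) :=
  hv.comp_measurable measurable_prodMk_left

theorem ae_integrable_of_lintegral_sq {μ : Measure ℝ} {v : ℝ → R3 → C6}
    (hv : StronglyMeasurable (Function.uncurry v)) (h : ∫⁻ t, (∫⁻ ξ, ‖v t ξ‖ₑ) ^ 2 ∂μ < ∞) :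
    ∀ᵐ t ∂μ, Integrable (v t) := by
  filter_upwards [ae_lt_top ((measurable_lintegral_enorm hv).pow_const 2) h.ne] with t ht
  refine ⟨(stronglyMeasurable_slice hv t).aestronglyMeasurable, lt_top_iff_ne_top.2 fun h0 => ?_⟩
  exact ht.ne (by rw [h0]; rfl)

theorem lintegral_tensorHat_self_le {μ : Measure ℝ} {v : ℝ → R3 → C6}
    (hv : StronglyMeasurable (Function.uncurry v)) :
    ∫⁻ t, (∫⁻ ξ, ‖tensorHat (v t) (v t) ξ‖ₑ) ∂μ ≤ ∫⁻ t, (∫⁻ ξ, ‖v t ξ‖ₑ) ^ 2 ∂μ := by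
  refine lintegral_mono fun t => ?_
  have hm := (stronglyMeasurable_slice hv t).aestronglyMeasurable (μ := volume)
  exact (lintegral_tensorHat_le hm hm).trans (by rw [sq])

/-- The quadratic nonlinearity is Lipschitz from bounded sets of `L²_t L¹` to `L¹_t L¹`. -/
theorem lintegral_tensorHat_self_sub_le {μ : Measure ℝ} {v w : ℝ → R3 → C6}
    (hv : StronglyMeasurable (Function.uncurry v)) (hw : StronglyMeasurable (Function.uncurry w))
    {A B E : ℝ≥0∞} (hA : ∫⁻ t, (∫⁻ ξ, ‖v t ξ‖ₑ) ^ 2 ∂μ ≤ A ^ 2)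
    (hB : ∫⁻ t, (∫⁻ ξ, ‖w t ξ‖ₑ) ^ 2 ∂μ ≤ B ^ 2) (hAt : A < ∞) (hBt : B < ∞)
    (hE : ∫⁻ t, (∫⁻ ξ, ‖v t ξ - w t ξ‖ₑ) ^ 2 ∂μ ≤ E ^ 2) :
    ∫⁻ t, (∫⁻ ξ, ‖tensorHat (v t) (v t) ξ - tensorHat (w t) (w t) ξ‖ₑ) ∂μ ≤ (A + B) * E := by
  have hvm := measurable_lintegral_enorm hv
  have hwm := measurable_lintegral_enorm hw
  have hdm : Measurable fun t => ∫⁻ ξ, ‖v t ξ - w t ξ‖ₑ :=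
    measurable_lintegral_enorm (v := fun t ξ => v t ξ - w t ξ) (hv.sub hw)
  calc _ ≤ ∫⁻ t, ((∫⁻ ξ, ‖v t ξ‖ₑ) * (∫⁻ ξ, ‖v t ξ - w t ξ‖ₑ)
        + (∫⁻ ξ, ‖w t ξ‖ₑ) * ∫⁻ ξ, ‖v t ξ - w t ξ‖ₑ) ∂μ := by
        refine lintegral_mono_ae ?_
        filter_upwards [ae_integrable_of_lintegral_sq hv (hA.trans_lt (ENNReal.pow_lt_top hAt)),
          ae_integrable_of_lintegral_sq hw (hB.trans_lt (ENNReal.pow_lt_top hBt))] with t h1 h2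
        exact (lintegral_tensorHat_sub_le h1 h2).trans (add_mul _ _ _).le
    _ ≤ A * E + B * E := by
        have hm : Measurable fun t => (∫⁻ ξ, ‖v t ξ‖ₑ) * ∫⁻ ξ, ‖v t ξ - w t ξ‖ₑ := hvm.mul hdm
        rw [lintegral_add_left hm]
        exact add_le_add
          (lintegral_mul_le_of_lintegral_sq_le hvm.aemeasurable hdm.aemeasurable hA hE)
          (lintegral_mul_le_of_lintegral_sq_le hwm.aemeasurable hdm.aemeasurable hB hE)
    _ = _ := (add_mul _ _ _).symm

/-- Duhamel integrals depend linearly on the source. -/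
theorem ae_duhamelInt_sub {n n' : ℝ × R3 → C3x6} (hn : StronglyMeasurable n)
    (hn' : StronglyMeasurable n') {T : EReal} (hfin : ∫⁻ z, ‖n z‖ₑ ∂spaceTime T < ∞)
    (hfin' : ∫⁻ z, ‖n' z‖ₑ ∂spaceTime T < ∞) :
    ∀ᵐ ξ, ∀ t ∈ timeIco T, duhamelInt n t ξ - duhamelInt n' t ξ
      = duhamelInt (fun z => n z - n' z) t ξ := by
  filter_upwards [ae_lintegral_time_lt_top hn hfin, ae_lintegral_time_lt_top hn' hfin']
    with ξ h h' t ht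
  rw [duhamelInt, duhamelInt, ← integral_sub (integrableOn_duhamel_integrand hn h ht)
    (integrableOn_duhamel_integrand hn' h' ht), duhamelInt]
  refine integral_congr_ae (ae_of_all _ fun τ => ?_)
  simp only [← flowHat_sub, ← forceHat_sub]

/-- The Fourier transform of the right-hand side of the mild formulation, where `v₀` is the Fourier
transform of the initial data and `n` that of the quadratic term `u ⊗ U`. -/
def velHat (v₀ : R3 → C6) (n : ℝ × R3 → C3x6) (t : ℝ) (ξ : R3) : C6 :=
  flowHat t ξ (v₀ ξ) - duhamelInt n t ξ

theorem stronglyMeasurable_velHat {v₀ : R3 → C6} (hv : StronglyMeasurable v₀)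
    {n : ℝ × R3 → C3x6} (hn : StronglyMeasurable n) :
    StronglyMeasurable (Function.uncurry (velHat v₀ n)) :=
  (stronglyMeasurable_flowHat hv).sub (stronglyMeasurable_duhamelInt hn)

theorem ennreal_add_sq_le (a b : ℝ≥0∞) : (a + b) ^ 2 ≤ 2 * a ^ 2 + 2 * b ^ 2 := by
  have h := ENNReal.rpow_add_le_mul_rpow_add_rpow a b (p := 2) one_le_two
  norm_num [ENNReal.rpow_two] at h
  rwa [mul_add] at h

theorem lintegral_sq_velHat_le {v₀ : R3 → C6} (hv : StronglyMeasurable v₀)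
    {n : ℝ × R3 → C3x6} (hn : StronglyMeasurable n) (T : EReal) :
    ∫⁻ t in timeIoo T, (∫⁻ ξ, ‖velHat v₀ n t ξ‖ₑ) ^ 2 ≤
      2 * (∫⁻ t in timeIoo T, (∫⁻ ξ, ‖flowHat t ξ (v₀ ξ)‖ₑ) ^ 2)
        + 2 * (216 * ∫⁻ z, ‖n z‖ₑ ∂spaceTime T) ^ 2 := by
  have hf := stronglyMeasurable_flowHat hv
  have hfm : Measurable fun t : ℝ => ∫⁻ ξ, ‖flowHat t ξ (v₀ ξ)‖ₑ := measurable_lintegral_enorm hf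
  calc _ ≤ ∫⁻ t in timeIoo T, (2 * (∫⁻ ξ, ‖flowHat t ξ (v₀ ξ)‖ₑ) ^ 2
        + 2 * (∫⁻ ξ, ‖duhamelInt n t ξ‖ₑ) ^ 2) := by
        refine lintegral_mono fun t => le_trans ?_ (ennreal_add_sq_le _ _)
        gcongr
        rw [← lintegral_add_left (stronglyMeasurable_slice hf t).enorm]
        exact lintegral_mono fun ξ => enorm_sub_le
    _ ≤ _ := by
        rw [lintegral_add_left ((hfm.pow_const 2).const_mul 2),
          lintegral_const_mul' _ _ (by simp), lintegral_const_mul' _ _ (by simp)]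
        gcongr
        exact lintegral_sq_duhamelInt_le hn T

/-- `n` is the Fourier transform of `u ⊗ U` for a mild solution `U` on `(0, T)`: a fixed point of
the map which sends a candidate for the quadratic term to the actual quadratic term. -/
structure IsFixedPoint (T : EReal) (v₀ : R3 → C6) (n : ℝ × R3 → C3x6) : Prop where
  stronglyMeasurable : StronglyMeasurable n
  lintegral_lt_top : ∫⁻ z, ‖n z‖ₑ ∂spaceTime T < ∞
  ae_eq : n =ᵐ[spaceTime T] fun z => tensorHat (velHat v₀ n z.1) (velHat v₀ n z.1) z.2

theorem lintegral_sq_velHat_sub_le {v₀ : R3 → C6} {n n' : ℝ × R3 → C3x6}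
    (hn : StronglyMeasurable n) (hn' : StronglyMeasurable n') {T : EReal}
    (hfin : ∫⁻ z, ‖n z‖ₑ ∂spaceTime T < ∞) (hfin' : ∫⁻ z, ‖n' z‖ₑ ∂spaceTime T < ∞) :
    ∫⁻ t in timeIoo T, (∫⁻ ξ, ‖velHat v₀ n t ξ - velHat v₀ n' t ξ‖ₑ) ^ 2
      ≤ (216 * ∫⁻ z, ‖n z - n' z‖ₑ ∂spaceTime T) ^ 2 := by
  refine le_trans (le_of_eq ?_) (lintegral_sq_duhamelInt_le (hn.sub hn') T)
  refine setLIntegral_congr_fun (measurableSet_timeIoo T) fun t ht => ?_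
  congr 1
  refine lintegral_congr_ae ?_
  filter_upwards [ae_duhamelInt_sub hn hn' hfin hfin'] with ξ h
  have h1 := h t (timeIoo_subset_timeIco T ht)
  rw [velHat, velHat, sub_sub_sub_cancel_left, ← neg_sub, enorm_neg, h1]
  rfl

theorem lintegral_spaceTime {F : Type*} [NormedAddCommGroup F] {f : ℝ × R3 → F}
    (hf : StronglyMeasurable f) (T : EReal) :
    ∫⁻ z, ‖f z‖ₑ ∂spaceTime T = ∫⁻ t in timeIoo T, ∫⁻ ξ, ‖f (t, ξ)‖ₑ :=
  lintegral_prod _ hf.enorm.aemeasurable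

/-- The quadratic term of a mild solution, as the fixed point of a contraction of a ball of
`L¹((0, T) × ℝ³)`, when the free evolution is small in `L²(0, T; L¹)`. -/
theorem exists_isFixedPoint {v₀ : R3 → C6} (hv : StronglyMeasurable v₀) {T : EReal}
    (h : ∫⁻ t in timeIoo T, (∫⁻ ξ, ‖flowHat t ξ (v₀ ξ)‖ₑ) ^ 2 ≤ ((1728 : ℝ≥0∞)⁻¹) ^ 2) :
    ∃ n, IsFixedPoint T v₀ n := by
  -- On the ball of radius `(2δ)²`, `velHat v₀ n` has norm at most `2δ` in `L²(0, T; L¹)`, so that the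
  -- Lipschitz constant is `(2δ + 2δ) * 216 = 1 / 2`.
  set δ : ℝ≥0∞ := 1728⁻¹ with hδ
  have hδ1 : 1728 * δ = 1 := ENNReal.mul_inv_cancel (by simp) (by simp)
  have hδt : 2 * δ < ∞ := ENNReal.mul_lt_top (by simp) (by simp [hδ])
  -- the map whose fixed points are sought
  let Q : (ℝ × R3 → C3x6) → ℝ × R3 → C3x6 := fun n z =>
    tensorHat (velHat v₀ n z.1) (velHat v₀ n z.1) z.2
  have hQm : ∀ {n}, StronglyMeasurable n → StronglyMeasurable (Q n) := fun hn =>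
    stronglyMeasurable_tensorHat (stronglyMeasurable_velHat hv hn)
  have hQle : ∀ {n}, StronglyMeasurable n → ∫⁻ z, ‖Q n z‖ₑ ∂spaceTime T
      ≤ ∫⁻ t in timeIoo T, (∫⁻ ξ, ‖velHat v₀ n t ξ‖ₑ) ^ 2 := fun hn => by
    rw [lintegral_spaceTime (hQm hn)]
    exact lintegral_tensorHat_self_le (stronglyMeasurable_velHat hv hn)
  have hball : ∀ {n}, StronglyMeasurable n → ∫⁻ z, ‖n z‖ₑ ∂spaceTime T ≤ (2 * δ) ^ 2 →
      ∫⁻ t in timeIoo T, (∫⁻ ξ, ‖velHat v₀ n t ξ‖ₑ) ^ 2 ≤ (2 * δ) ^ 2 := fun {n} hn hle => by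
    refine (lintegral_sq_velHat_le hv hn T).trans ?_
    calc _ ≤ 2 * δ ^ 2 + 2 * (216 * (2 * δ) ^ 2) ^ 2 := by gcongr
      _ ≤ 2 * δ ^ 2 + 2 * (1728 * δ * δ) ^ 2 := by
          gcongr 2 * δ ^ 2 + 2 * ?_ ^ 2
          calc 216 * (2 * δ) ^ 2 = 864 * (δ * δ) := by ring
            _ ≤ 1728 * (δ * δ) := by gcongr; norm_num
            _ = _ := by ring
      _ = _ := by rw [hδ1]; ring
  have hlt : ∀ {n}, StronglyMeasurable n → ∫⁻ z, ‖n z‖ₑ ∂spaceTime T < ∞ →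
      ∫⁻ z, ‖Q n z‖ₑ ∂spaceTime T < ∞ := fun hn hfin => by
    refine ((hQle hn).trans (lintegral_sq_velHat_le hv hn T)).trans_lt ?_
    refine ENNReal.add_lt_top.2 ⟨ENNReal.mul_lt_top (by simp) (h.trans_lt ?_),
      ENNReal.mul_lt_top (by simp) (ENNReal.pow_lt_top (ENNReal.mul_lt_top (by simp) hfin))⟩
    exact ENNReal.pow_lt_top (by simp [hδ])
  have hLp : ∀ f : Lp C3x6 1 (spaceTime T), ∫⁻ z, ‖f z‖ₑ ∂spaceTime T = ‖f‖ₑ := fun f => by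
    rw [Lp.enorm_def, eLpNorm_one_eq_lintegral_enorm]
  have hInt : ∀ f : Lp C3x6 1 (spaceTime T), Integrable (Q f) (spaceTime T) := fun f =>
    ⟨(hQm (Lp.stronglyMeasurable f)).aestronglyMeasurable,
      hlt (Lp.stronglyMeasurable f) (by rw [hLp]; exact enorm_lt_top)⟩
  let Φ : Lp C3x6 1 (spaceTime T) → Lp C3x6 1 (spaceTime T) := fun f => (hInt f).toL1
  have hΦ : ∀ f, Φ f =ᵐ[spaceTime T] Q f := fun f => (hInt f).coeFn_toL1
  let s : Set (Lp C3x6 1 (spaceTime T)) := {f | ‖f‖ₑ ≤ (2 * δ) ^ 2}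
  have hs : IsComplete s := by
    refine IsClosed.isComplete (isClosed_le ?_ continuous_const)
    exact continuous_enorm
  have hmaps : MapsTo Φ s s := fun f hf => by
    have h1 : ‖Φ f‖ₑ = ∫⁻ z, ‖Q f z‖ₑ ∂spaceTime T := by
      rw [← hLp]
      exact lintegral_congr_ae ((hΦ f).mono fun z hz => by simp only [hz])
    have hf' : ∫⁻ z, ‖f z‖ₑ ∂spaceTime T ≤ (2 * δ) ^ 2 := by rw [hLp]; exact hf
    show ‖Φ f‖ₑ ≤ _
    rw [h1]
    exact (hQle (Lp.stronglyMeasurable f)).trans (hball (Lp.stronglyMeasurable f) hf')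
  have hcontr : ContractingWith (1 / 2) (hmaps.restrict Φ s s) := by
    refine ⟨by norm_num, fun f g => ?_⟩
    have hfm := Lp.stronglyMeasurable f.1
    have hgm := Lp.stronglyMeasurable g.1
    have hf' : ∫⁻ z, ‖f.1 z‖ₑ ∂spaceTime T ≤ (2 * δ) ^ 2 := by rw [hLp]; exact f.2
    have hg' : ∫⁻ z, ‖g.1 z‖ₑ ∂spaceTime T ≤ (2 * δ) ^ 2 := by rw [hLp]; exact g.2
    have hfg : ∫⁻ z, ‖f.1 z - g.1 z‖ₑ ∂spaceTime T = edist f.1 g.1 := by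
      rw [Lp.edist_def, eLpNorm_one_eq_lintegral_enorm]
      rfl
    have hΦfg : edist (Φ f.1) (Φ g.1) = ∫⁻ z, ‖Q f.1 z - Q g.1 z‖ₑ ∂spaceTime T := by
      rw [Lp.edist_def, eLpNorm_one_eq_lintegral_enorm]
      refine lintegral_congr_ae ?_
      filter_upwards [hΦ f.1, hΦ g.1] with z h1 h2
      simp only [Pi.sub_apply, h1, h2]
    show edist (Φ f.1) (Φ g.1) ≤ _ * edist f.1 g.1
    rw [hΦfg, ← hfg, lintegral_spaceTime (f := fun z => Q f.1 z - Q g.1 z) ((hQm hfm).sub (hQm hgm))]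
    refine (lintegral_tensorHat_self_sub_le (stronglyMeasurable_velHat hv hfm)
      (stronglyMeasurable_velHat hv hgm) (hball hfm hf') (hball hgm hg') hδt hδt
      (lintegral_sq_velHat_sub_le hfm hgm (hf'.trans_lt (ENNReal.pow_lt_top hδt))
        (hg'.trans_lt (ENNReal.pow_lt_top hδt)))).trans (le_of_eq ?_)
    rw [← mul_assoc]
    congr 1
    calc (2 * δ + 2 * δ) * 216 = (1728 * δ) * 2⁻¹ := by
          rw [show (1728 : ℝ≥0∞) = 864 * 2 by norm_num, mul_right_comm, mul_assoc 864,
            ENNReal.mul_inv_cancel (by simp) (by simp)]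
          ring
      _ = _ := by rw [hδ1]; simp
  obtain ⟨f, -, hf, -⟩ := ContractingWith.exists_fixedPoint' hs hmaps hcontr
    (x := 0) (by show ‖(0 : Lp C3x6 1 (spaceTime T))‖ₑ ≤ _; simp) (edist_ne_top _ _)
  refine ⟨f, Lp.stronglyMeasurable f, by rw [hLp]; exact enorm_lt_top, ?_⟩
  have := hΦ f
  rw [hf.eq] at this
  exact this

end FixedPoint

section FixedPointUnique

variable {n n' : ℝ × R3 → C3x6}

theorem duhamelInt_ae_eq_zero {d : ℝ × R3 → C3x6} (hd : StronglyMeasurable d) {t : ℝ}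
    (h : ∫⁻ τ in Ioo 0 t, ∫⁻ ξ, ‖d (τ, ξ)‖ₑ = 0) : duhamelInt d t =ᵐ[volume] 0 := by
  have h1 : ∫⁻ ξ, ∫⁻ τ in Ioo 0 t, ‖d (τ, ξ)‖ₑ = 0 := by
    rw [← timeIoo_coe, lintegral_spaceTime_symm hd, lintegral_spaceTime hd, timeIoo_coe, h]
  rw [lintegral_eq_zero_iff (by
    rw [← timeIoo_coe]; exact measurable_lintegral_time hd _)] at h1
  filter_upwards [h1] with ξ hξ
  have h2 : ‖duhamelInt d t ξ‖ₑ ≤ ∫⁻ τ in Ioo 0 t, 216 * (‖ξ‖ₑ * ‖d (τ, ξ)‖ₑ) :=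
    (enorm_integral_le_lintegral_enorm _).trans <| setLIntegral_mono' measurableSet_Ioo
      fun τ hτ => (enorm_flowHat_le (sub_pos.2 hτ.2).le _ _).trans (enorm_forceHat_le _ _)
  rw [lintegral_const_mul' _ _ (by simp), lintegral_const_mul' _ _ enorm_ne_top, hξ] at h2
  simpa using h2

theorem isClosed_setOf_setLIntegral_eq_zero (f : ℝ → ℝ≥0∞) :
    IsClosed {t : ℝ | ∫⁻ τ in Ioo 0 t, f τ = 0} := by
  rw [← isOpen_compl_iff, isOpen_iff_mem_nhds]
  intro t ht
  obtain ⟨t', ht', h0⟩ : ∃ t' < t, ∫⁻ τ in Ioo 0 t', f τ ≠ 0 := by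
    by_contra! hc
    obtain ⟨u, -, hu, hlim⟩ := exists_seq_strictMono_tendsto t
    refine ht (le_antisymm ?_ zero_le)
    have hU : Ioo 0 t ⊆ ⋃ k, Ioo 0 (u k) := fun τ hτ => by
      obtain ⟨k, hk⟩ := (hlim.eventually (lt_mem_nhds hτ.2)).exists
      exact mem_iUnion.2 ⟨k, hτ.1, hk⟩
    refine (lintegral_mono_set hU).trans ((lintegral_iUnion_le _ _).trans ?_)
    simp [fun k => hc (u k) (hu k)]
  refine mem_of_superset (Ioi_mem_nhds ht') fun s hs hs0 => h0 ?_
  exact le_antisymm ((lintegral_mono_set (Ioo_subset_Ioo_right (mem_Ioi.1 hs).le)).trans hs0.le)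
    zero_le

theorem setLIntegral_timeIoo_of_subset {T : EReal} {t : ℝ} (ht : t ∈ timeIco T)
    (f : ℝ → ℝ≥0∞) : ∫⁻ τ in timeIoo (t : EReal), f τ ≤ ∫⁻ τ in timeIoo T, f τ := by
  rw [timeIoo_coe]
  exact lintegral_mono_set (Ioo_subset_timeIoo ht)

theorem IsFixedPoint.lintegral_sq_velHat_lt_top {T : EReal} {v₀ : R3 → C6}
    (hv : StronglyMeasurable v₀)
    (hlin : ∫⁻ t in timeIoo T, (∫⁻ ξ, ‖flowHat t ξ (v₀ ξ)‖ₑ) ^ 2 < ∞)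
    (h : IsFixedPoint T v₀ n) : ∫⁻ t in timeIoo T, (∫⁻ ξ, ‖velHat v₀ n t ξ‖ₑ) ^ 2 < ∞ :=
  (lintegral_sq_velHat_le hv h.1 T).trans_lt (ENNReal.add_lt_top.2
    ⟨ENNReal.mul_lt_top (by simp) hlin, ENNReal.mul_lt_top (by simp)
      (ENNReal.pow_lt_top (ENNReal.mul_lt_top (by simp) h.2))⟩)

/-- Two fixed points coincide. If they agree up to a time `x`, they agree up to a slightly larger
time, as `L²(x, z; L¹)` norms are small when `z` is close to `x`. -/
theorem IsFixedPoint.lintegral_sub_eq_zero {T : EReal} {v₀ : R3 → C6}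
    (hv : StronglyMeasurable v₀)
    (hlin : ∫⁻ t in timeIoo T, (∫⁻ ξ, ‖flowHat t ξ (v₀ ξ)‖ₑ) ^ 2 < ∞)
    (h : IsFixedPoint T v₀ n) (h' : IsFixedPoint T v₀ n') {t : ℝ} (ht : t ∈ timeIco T) :
    ∫⁻ τ in Ioo 0 t, ∫⁻ ξ, ‖n (τ, ξ) - n' (τ, ξ)‖ₑ = 0 := by
  set X : ℝ → ℝ≥0∞ := fun t => ∫⁻ ξ, ‖velHat v₀ n t ξ‖ₑ with hX
  set X' : ℝ → ℝ≥0∞ := fun t => ∫⁻ ξ, ‖velHat v₀ n' t ξ‖ₑ with hX'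
  set d : ℝ → ℝ≥0∞ := fun τ => ∫⁻ ξ, ‖n (τ, ξ) - n' (τ, ξ)‖ₑ with hd
  have hdm : StronglyMeasurable fun z => n z - n' z := h.1.sub h'.1
  have hdfin : ∫⁻ τ in timeIoo T, d τ < ∞ := by
    have h1 : ∫⁻ z, ‖n z - n' z‖ₑ ∂spaceTime T < ∞ := by
      refine (lintegral_mono fun z => enorm_sub_le).trans_lt ?_
      rw [lintegral_add_left h.1.enorm]
      exact ENNReal.add_lt_top.2 ⟨h.2, h'.2⟩
    rwa [lintegral_spaceTime hdm] at h1
  have hdeq : ∀ᵐ τ ∂(volume.restrict (timeIoo T)), d τ =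
      ∫⁻ ξ, ‖tensorHat (velHat v₀ n τ) (velHat v₀ n τ) ξ
        - tensorHat (velHat v₀ n' τ) (velHat v₀ n' τ) ξ‖ₑ := by
    filter_upwards [Measure.ae_ae_of_ae_prod h.3, Measure.ae_ae_of_ae_prod h'.3] with τ h1 h2
    refine lintegral_congr_ae ?_
    filter_upwards [h1, h2] with ξ h3 h4
    rw [h3, h4]
  suffices hs : Icc 0 t ⊆ {t : ℝ | ∫⁻ τ in Ioo 0 t, d τ = 0} from hs (right_mem_Icc.2 ht.1)
  refine IsClosed.Icc_subset_of_forall_exists_gt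
    ((isClosed_setOf_setLIntegral_eq_zero d).inter isClosed_Icc) (by simp) ?_
  rintro x ⟨hx0, hx⟩ y hy
  set ε : ℝ≥0∞ := 864⁻¹ with hε
  have hε0 : ε ^ 2 ≠ 0 := by simp [hε]
  have hεt : ε < ∞ := by simp [hε]
  obtain ⟨δ, hδ, hδ1⟩ := exists_pos_setLIntegral_lt_of_measure_lt
    (h.lintegral_sq_velHat_lt_top hv hlin).ne hε0
  obtain ⟨δ', hδ', hδ1'⟩ := exists_pos_setLIntegral_lt_of_measure_lt
    (h'.lintegral_sq_velHat_lt_top hv hlin).ne hε0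
  -- a time `z` slightly larger than `x`
  obtain ⟨η, hη, hηδ⟩ : ∃ η : ℝ, 0 < η ∧ ENNReal.ofReal η < min δ δ' := by
    obtain ⟨η, h0, h1⟩ := ENNReal.lt_iff_exists_nnreal_btwn.1 (lt_min hδ hδ')
    exact ⟨η, by exact_mod_cast h0, by simpa using h1⟩
  set z : ℝ := min (min y t) (x + η) with hz
  have hxz : x < z := lt_min (lt_min hy hx.2) (by linarith)
  have hzt : z ≤ t := (min_le_left _ _).trans (min_le_right _ _)
  have hzT : z ∈ timeIco T :=
    ⟨hx.1.trans hxz.le, (EReal.coe_le_coe_iff.2 hzt).trans_lt ht.2⟩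
  refine ⟨z, ?_, hxz, (min_le_left _ _).trans (min_le_left _ _)⟩
  have hsub : Ioo x z ⊆ Ioo 0 z := Ioo_subset_Ioo_left hx.1
  have hsubT : Ioo x z ⊆ timeIoo T := hsub.trans (Ioo_subset_timeIoo hzT)
  have hvol : volume.restrict (timeIoo T) (Ioo x z) < min δ δ' := by
    refine (Measure.restrict_apply_le _ _).trans_lt (lt_of_le_of_lt ?_ hηδ)
    rw [Real.volume_Ioo]
    exact ENNReal.ofReal_le_ofReal (by linarith [min_le_right (min y t) (x + η)])
  have hres : (volume.restrict (timeIoo T)).restrict (Ioo x z) = volume.restrict (Ioo x z) := by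
    rw [Measure.restrict_restrict measurableSet_Ioo, inter_eq_left.2 hsubT]
  have hA := (hδ1 _ (hvol.trans_le (min_le_left _ _))).le
  have hB := (hδ1' _ (hvol.trans_le (min_le_right _ _))).le
  rw [hres] at hA hB
  set M : ℝ≥0∞ := ∫⁻ τ in Ioo 0 z, d τ with hM
  have hMfin : M < ∞ := (lintegral_mono_set (Ioo_subset_timeIoo hzT)).trans_lt hdfin
  have hMz : ∫⁻ w, ‖n w - n' w‖ₑ ∂spaceTime (z : EReal) = M := by
    rw [lintegral_spaceTime hdm, timeIoo_coe]
  have hfinz : ∀ {m}, IsFixedPoint T v₀ m → ∫⁻ w, ‖m w‖ₑ ∂spaceTime (z : EReal) < ∞ := fun hm => by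
    rw [lintegral_spaceTime hm.1]
    refine (setLIntegral_timeIoo_of_subset hzT _).trans_lt ?_
    rw [← lintegral_spaceTime hm.1]
    exact hm.2
  have hE := lintegral_sq_velHat_sub_le (v₀ := v₀) h.1 h'.1 (hfinz h) (hfinz h')
  rw [hMz, timeIoo_coe] at hE
  have hstep : ∫⁻ τ in Ioo x z, d τ ≤ (ε + ε) * (216 * M) := by
    have h1 : ∀ᵐ τ ∂(volume.restrict (Ioo x z)), d τ =
        ∫⁻ ξ, ‖tensorHat (velHat v₀ n τ) (velHat v₀ n τ) ξ
          - tensorHat (velHat v₀ n' τ) (velHat v₀ n' τ) ξ‖ₑ := by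
      rw [← hres]
      exact ae_restrict_of_ae hdeq
    rw [lintegral_congr_ae h1]
    exact lintegral_tensorHat_self_sub_le (stronglyMeasurable_velHat hv h.1)
      (stronglyMeasurable_velHat hv h'.1) hA hB hεt hεt ((lintegral_mono_set hsub).trans hE)
  have hcover : Ioo 0 z ⊆ Ioo 0 x ∪ Ico x z := fun τ hτ => by
    rcases lt_or_ge τ x with h | h
    · exact Or.inl ⟨hτ.1, h⟩
    · exact Or.inr ⟨h, hτ.2⟩
  have hMle : M ≤ 2⁻¹ * M := by
    calc M ≤ ∫⁻ τ in Ioo 0 x ∪ Ico x z, d τ := lintegral_mono_set hcover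
      _ ≤ (∫⁻ τ in Ioo 0 x, d τ) + ∫⁻ τ in Ico x z, d τ := lintegral_union_le _ _ _
      _ = ∫⁻ τ in Ioo x z, d τ := by
          rw [show ∫⁻ τ in Ioo 0 x, d τ = 0 from hx0, zero_add,
            setLIntegral_congr Ioo_ae_eq_Ico.symm]
      _ ≤ (ε + ε) * (216 * M) := hstep
      _ = 2⁻¹ * (864 * ε) * M := by
          rw [show (864 : ℝ≥0∞) = 2 * 432 by norm_num, ← mul_assoc 2⁻¹, ← mul_assoc 2⁻¹,
            ENNReal.inv_mul_cancel (by simp) (by simp)]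
          ring
      _ = 2⁻¹ * M := by rw [hε, ENNReal.mul_inv_cancel (by simp) (by simp), mul_one]
  show M = 0
  by_contra hM0
  refine absurd hMle (not_le.2 ?_)
  calc 2⁻¹ * M < 1 * M := by
        rw [ENNReal.mul_lt_mul_iff_left hM0 hMfin.ne]
        exact ENNReal.inv_lt_one.2 (by norm_num)
    _ = M := one_mul M

theorem IsFixedPoint.velHat_ae_eq {T : EReal} {v₀ : R3 → C6}
    (hv : StronglyMeasurable v₀)
    (hlin : ∫⁻ t in timeIoo T, (∫⁻ ξ, ‖flowHat t ξ (v₀ ξ)‖ₑ) ^ 2 < ∞)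
    (h : IsFixedPoint T v₀ n) (h' : IsFixedPoint T v₀ n') {t : ℝ} (ht : t ∈ timeIco T) :
    velHat v₀ n t =ᵐ[volume] velHat v₀ n' t := by
  filter_upwards [ae_duhamelInt_sub h.1 h'.1 h.2 h'.2, duhamelInt_ae_eq_zero (h.1.sub h'.1)
    (h.lintegral_sub_eq_zero hv hlin h' ht)] with ξ h1 h2
  have h3 : duhamelInt n t ξ - duhamelInt n' t ξ = 0 := (h1 t ht).trans h2
  rw [velHat, velHat, sub_eq_zero.1 h3]

end FixedPointUnique

/-! ### Regularity of the solution -/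

section Regularity

theorem blockMass_sub_le (D : LittlewoodPaley) {f g : R3 → C6} (hf : AEStronglyMeasurable f)
    (j : ℤ) : blockMass D j (fun ξ => f ξ - g ξ) ≤ blockMass D j f + blockMass D j g := by
  have hm : AEMeasurable fun ξ => blockCut D j ξ * ‖f ξ‖ₑ :=
    (measurable_blockCut D j).aemeasurable.mul hf.enorm
  rw [blockMass, blockMass, blockMass, ← lintegral_add_left' hm]
  refine lintegral_mono fun ξ => ?_
  rw [← mul_add]
  gcongr
  exact enorm_sub_le

theorem measurable_blockMass (D : LittlewoodPaley) {v : ℝ → R3 → C6}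
    (hv : StronglyMeasurable (Function.uncurry v)) (j : ℤ) :
    Measurable fun t => blockMass D j (v t) := by
  have h : Measurable fun p : ℝ × R3 => blockCut D j p.2 * ‖Function.uncurry v p‖ₑ :=
    ((measurable_blockCut D j).comp measurable_snd).mul hv.enorm
  exact h.lintegral_prod_right'

/-- Functions with finite `FḂ^{-1}_{1,r}` norm on the Fourier side have at most polynomial growth in
the mean, so that they are Fourier transforms of tempered distributions. -/
theorem integrable_weight_of_dyadicNorm (D : LittlewoodPaley) {r : ℝ} (hr : 1 ≤ r) {g : R3 → C6}
    (hg : AEStronglyMeasurable g) (h : dyadicNorm (-1) r (fun j => blockMass D j g) < ∞) :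
    Integrable fun ξ => ((1 + ‖ξ‖ ^ 2 : ℝ) : ℂ)⁻¹ • g ξ := by
  obtain ⟨C, hC, hle⟩ := exists_lintegral_weight_le
  have hw : Continuous fun ξ : R3 => ((1 + ‖ξ‖ ^ 2 : ℝ) : ℂ)⁻¹ := by
    refine Continuous.inv₀ (by fun_prop) fun ξ => ?_
    exact_mod_cast (by positivity : (0 : ℝ) < 1 + ‖ξ‖ ^ 2).ne'
  refine ⟨hw.aestronglyMeasurable.smul hg, ?_⟩
  refine lt_of_le_of_lt (le_of_eq ?_)
    ((hle D g _ hg (le_dyadicNorm hr _)).trans_lt (ENNReal.mul_lt_top hC h))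
  refine lintegral_congr fun ξ => ?_
  rw [enorm_smul]
  congr 1
  rw [← Complex.ofReal_inv, ← ofReal_norm, Complex.norm_real, Real.norm_of_nonneg (by positivity)]

variable {D : LittlewoodPaley} {r : ℝ} {T : EReal} {v₀ : R3 → C6} {n : ℝ × R3 → C3x6}

theorem dyadicNorm_flowHat_slice_le (D : LittlewoodPaley) {r : ℝ} (hr : 1 ≤ r) {t : ℝ} (ht : 0 ≤ t)
    (v₀ : R3 → C6) : dyadicNorm (-1) r (fun j => blockMass D j fun ξ => flowHat t ξ (v₀ ξ))
      ≤ dyadicNorm (-1) r (fun j => blockMass D j v₀) := by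
  refine dyadicNorm_mono (by linarith) fun j => ?_
  refine lintegral_mono fun ξ => ?_
  gcongr
  exact enorm_flowHat_le ht _ _

theorem dyadicNorm_duhamelInt_slice_le (D : LittlewoodPaley) (hr : 1 ≤ r)
    (hn : StronglyMeasurable n) {t : ℝ} (ht : t ∈ timeIco T) :
    dyadicNorm (-1) r (fun j => blockMass D j (duhamelInt n t))
      ≤ 648 * ∫⁻ z, ‖n z‖ₑ ∂spaceTime T :=
  (dyadicNorm_le_tsum hr _).trans (tsum_blockMass_duhamelInt_le D hn ht)

theorem dyadicNorm_velHat_slice_le (D : LittlewoodPaley) (hr : 1 ≤ r) (hv : StronglyMeasurable v₀)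
    (hn : StronglyMeasurable n) {t : ℝ} (ht : t ∈ timeIco T) :
    dyadicNorm (-1) r (fun j => blockMass D j (velHat v₀ n t))
      ≤ dyadicNorm (-1) r (fun j => blockMass D j v₀) + 648 * ∫⁻ z, ‖n z‖ₑ ∂spaceTime T := by
  refine (dyadicNorm_mono (by linarith) fun j => blockMass_sub_le D (stronglyMeasurable_slice
    (stronglyMeasurable_flowHat hv) t).aestronglyMeasurable j).trans ?_
  exact (dyadicNorm_add_le hr _ _).trans (add_le_add (dyadicNorm_flowHat_slice_le D hr ht.1 v₀)
    (dyadicNorm_duhamelInt_slice_le D hr hn ht))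

theorem tendsto_dyadicNorm_velHat_sub (D : LittlewoodPaley) (hr : 1 ≤ r)
    (hv : StronglyMeasurable v₀) (hfin : dyadicNorm (-1) r (fun j => blockMass D j v₀) < ∞)
    (hn : StronglyMeasurable n) (hnfin : ∫⁻ z, ‖n z‖ₑ ∂spaceTime T < ∞) {t₀ : ℝ}
    (ht₀ : t₀ ∈ timeIco T) :
    Tendsto (fun t => dyadicNorm (-1) r
        (fun j => blockMass D j fun ξ => velHat v₀ n t ξ - velHat v₀ n t₀ ξ))
      (𝓝[timeIco T] t₀) (𝓝 0) := by
  have h1 := (tendsto_dyadicNorm_flowHat_sub D hr T hv hfin ht₀).add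
    (tendsto_tsum_blockMass_duhamelInt_sub D hn hnfin ht₀)
  rw [add_zero] at h1
  refine tendsto_of_tendsto_of_tendsto_of_le_of_le tendsto_const_nhds h1 (fun _ => zero_le)
    fun t => ?_
  have hm := stronglyMeasurable_slice (stronglyMeasurable_flowHat hv)
  refine le_trans (dyadicNorm_mono (by linarith) fun j => ?_) ((dyadicNorm_add_le hr _ _).trans
    (add_le_add le_rfl (dyadicNorm_le_tsum hr _)))
  refine le_trans (le_of_eq ?_) (blockMass_sub_le D ((hm t).sub (hm t₀)).aestronglyMeasurable j)
  congr 1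
  ext1 ξ
  exact sub_sub_sub_comm _ _ _ _

theorem dyadicNorm_velHat_lt_top (D : LittlewoodPaley) {q : ℝ} (hq : 1 ≤ q) (hr : 1 ≤ r)
    (hv : StronglyMeasurable v₀) (hfin : dyadicNorm (-1) r (fun j => blockMass D j v₀) < ∞)
    (hn : StronglyMeasurable n) (hnfin : ∫⁻ z, ‖n z‖ₑ ∂spaceTime T < ∞) :
    dyadicNorm (-1 + 2 / q) r (fun j =>
      (∫⁻ t in timeIoo T, blockMass D j (velHat v₀ n t) ^ q) ^ (1 / q)) < ∞ := by
  have hq0 : 0 < q := by linarith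
  have hf := stronglyMeasurable_flowHat hv
  refine lt_of_le_of_lt ?_ (ENNReal.add_lt_top.2
    ⟨(dyadicNorm_flowHat_le D hq hr T hv).trans_lt (ENNReal.mul_lt_top (by simp) hfin),
      (dyadicNorm_duhamelInt_le D hn hq hr T).trans_lt (ENNReal.mul_lt_top (by simp) hnfin)⟩)
  refine le_trans (dyadicNorm_mono (by linarith) fun j => ?_) (dyadicNorm_add_le hr _ _)
  refine le_trans ?_ (ENNReal.lintegral_Lp_add_le (measurable_blockMass D hf j).aemeasurable
    (measurable_blockMass D (stronglyMeasurable_duhamelInt hn) j).aemeasurable hq)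
  gcongr with t
  exact blockMass_sub_le D (stronglyMeasurable_slice hf t).aestronglyMeasurable j

theorem φ_le_one (D : LittlewoodPaley) (ξ : R3) : D.φ ξ ≤ 1 :=
  sub_nonneg.1 ((D.φ_add_sum_ψ ξ).nonneg fun _ => D.ψ_nonneg _)

/-- A function which is bounded in `FḂ^{-1}_{1,∞}` has small low frequencies. -/
theorem exists_lintegral_lowCut_le : ∃ C : ℝ≥0∞, C < ∞ ∧ ∀ (D : LittlewoodPaley) (g : R3 → C6)
    (M : ℝ≥0∞), AEStronglyMeasurable g → (∀ j, dyadicWeight (-1) j * blockMass D j g ≤ M) →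
      ∀ j : ℤ, ∫⁻ ξ, ‖D.φ ((2 : ℝ) ^ (-j) • ξ)‖ₑ * ‖g ξ‖ₑ ≤ dyadicWeight 1 j * (C * M) := by
  refine ⟨∑' m : ℤ, ENNReal.ofReal ((2 : ℝ) ^ (-(|(m : ℝ)| * 1))),
    tsum_two_pow_neg_abs_lt_top one_pos, fun D g M hg hM j => ?_⟩
  have hφm : Continuous fun ξ : R3 => D.φ ((2 : ℝ) ^ (-j) • ξ) :=
    D.φ.continuous.comp (continuous_const_smul _)
  have hm : AEMeasurable fun ξ => ‖D.φ ((2 : ℝ) ^ (-j) • ξ)‖ₑ * ‖g ξ‖ₑ :=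
    hφm.measurable.enorm.aemeasurable.mul hg.enorm
  rw [lintegral_eq_tsum_blockCut D hm]
  have hterm : ∀ k : ℤ, ∫⁻ ξ, blockCut D k ξ * (‖D.φ ((2 : ℝ) ^ (-j) • ξ)‖ₑ * ‖g ξ‖ₑ)
      ≤ dyadicWeight 1 j * (ENNReal.ofReal ((2 : ℝ) ^ (-(|((k - j : ℤ) : ℝ)| * 1))) * M) := by
    intro k
    rcases le_or_gt k j with hk | hk
    · have hkj : ((k - j : ℤ) : ℝ) ≤ 0 := by exact_mod_cast sub_nonpos.2 hk
      have e : dyadicWeight 1 j * ENNReal.ofReal ((2 : ℝ) ^ (-(|((k - j : ℤ) : ℝ)| * 1)))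
          = dyadicWeight 1 k := by
        rw [dyadicWeight, dyadicWeight, ← ENNReal.ofReal_mul (by positivity),
          ← Real.rpow_add two_pos, abs_of_nonpos hkj]
        congr 2
        push_cast
        ring
      rw [← mul_assoc, e]
      calc _ ≤ blockMass D k g := by
            refine lintegral_mono fun ξ => ?_
            gcongr
            refine mul_le_of_le_one_left zero_le ?_
            rw [Real.enorm_of_nonneg (D.φ_nonneg _)]
            exact ENNReal.ofReal_le_one.2 (φ_le_one D _)
        _ = dyadicWeight 1 k * (dyadicWeight (-1) k * blockMass D k g) := by
            rw [← mul_assoc, mul_comm (dyadicWeight 1 k), dyadicWeight_neg_mul, one_mul]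
        _ ≤ _ := by gcongr; exact hM k
    · -- the block `k` does not meet the support of the low frequency cut-off
      refine le_trans (le_of_eq ?_) zero_le
      refine (lintegral_congr fun ξ => ?_).trans lintegral_zero
      by_contra h0
      have h1 := (blockCut_support D (left_ne_zero_of_mul h0)).1
      have h2 : D.φ ((2 : ℝ) ^ (-j) • ξ) ≠ 0 := by
        simpa using left_ne_zero_of_mul (right_ne_zero_of_mul h0)
      have h3 := D.φ_support _ h2
      have hp : (0 : ℝ) < 2 ^ j := by positivity
      rw [norm_smul, Real.norm_of_nonneg (by positivity), zpow_neg, inv_mul_le_iff₀ hp] at h3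
      have h4 : (2 : ℝ) ^ (j + 1) ≤ 2 ^ k := zpow_le_zpow_right₀ one_le_two hk
      rw [zpow_add_one₀ two_ne_zero] at h4
      rw [Real.rpow_intCast] at h1
      linarith
  refine (ENNReal.tsum_le_tsum hterm).trans (le_of_eq ?_)
  rw [ENNReal.tsum_mul_left, ENNReal.tsum_mul_right]
  congr 2
  exact (Equiv.subRight j).tsum_eq
    fun m : ℤ => ENNReal.ofReal ((2 : ℝ) ^ (-(|(m : ℝ)| * 1)))

theorem tendsto_dyadicWeight_one : Tendsto (fun j : ℤ => dyadicWeight 1 j) atBot (𝓝 0) := by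
  have h : Tendsto (fun j : ℤ => (2 : ℝ) ^ ((j : ℝ) * 1)) atBot (𝓝 0) := by
    simp only [mul_one]
    exact (tendsto_rpow_atBot_of_base_gt_one 2 one_lt_two).comp (tendsto_intCast_atBot_iff.2 tendsto_id)
  simpa [dyadicWeight] using ENNReal.tendsto_ofReal h

/-- The low frequency cut-off `S_j`, on the Fourier side. -/
def lowFreqHat (D : LittlewoodPaley) (j : ℤ) (g : R3 → C6) (x : R3) : C6 :=
  ((2 * Real.pi : ℝ) ^ (-3 : ℤ)) •
    ∫ ξ, Complex.exp (Complex.I * (inner ℝ x ξ : ℝ)) • D.φ ((2 : ℝ) ^ (-j) • ξ) • g ξ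

theorem HasFourierFn.lowFreq_eq {f : 𝓢'(R3, C6)} {g : R3 → C6} (h : HasFourierFn f g)
    (D : LittlewoodPaley) (j : ℤ) (x : R3) : lowFreq D j f x = lowFreqHat D j g x := by
  rw [lowFreq, lowFreqHat]
  congr 1
  exact integral_congr_ae (h.hat_ae_eq.mono fun ξ hξ => by simp only [hξ])

theorem enorm_lowFreqHat_le (D : LittlewoodPaley) (j : ℤ) (g : R3 → C6) (x : R3) :
    ‖lowFreqHat D j g x‖ₑ ≤ ∫⁻ ξ, ‖D.φ ((2 : ℝ) ^ (-j) • ξ)‖ₑ * ‖g ξ‖ₑ := by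
  rw [lowFreqHat, enorm_smul]
  refine (mul_le_of_le_one_left zero_le ?_).trans
    ((enorm_integral_le_lintegral_enorm _).trans (lintegral_mono fun ξ => ?_))
  · rw [Real.enorm_of_nonneg (by positivity), zpow_neg]
    exact ENNReal.ofReal_le_one.2 two_pi_pow_inv_le_one
  · rw [enorm_smul, enorm_smul]
    refine mul_le_of_le_one_left zero_le (le_of_eq ?_)
    rw [← ofReal_norm, mul_comm, Complex.norm_exp_ofReal_mul_I, ENNReal.ofReal_one]

theorem stronglyMeasurable_lowFreqHat (D : LittlewoodPaley) (j : ℤ) {v : ℝ → R3 → C6}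
    (hv : StronglyMeasurable (Function.uncurry v)) :
    StronglyMeasurable fun z : ℝ × R3 => lowFreqHat D j (v z.1) z.2 := by
  have h1 : Continuous fun p : (ℝ × R3) × R3 =>
      Complex.exp (Complex.I * (inner ℝ p.1.2 p.2 : ℝ)) := by fun_prop
  have h2 : Continuous fun p : (ℝ × R3) × R3 => D.φ ((2 : ℝ) ^ (-j) • p.2) :=
    D.φ.continuous.comp (by fun_prop)
  have h3 : StronglyMeasurable fun p : (ℝ × R3) × R3 => v p.1.1 p.2 :=
    hv.comp_measurable (g := fun p : (ℝ × R3) × R3 => (p.1.1, p.2)) (by fun_prop)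
  have h4 := (h1.stronglyMeasurable.smul (h2.stronglyMeasurable.smul h3)).integral_prod_right'
    (ν := volume)
  exact h4.const_smul ((2 * Real.pi : ℝ) ^ (-3 : ℤ))

/-- A function which is bounded in `FḂ^{-1}_{1,∞}` satisfies the condition `S_j U → 0` of the
Chemin-Lerner spaces. -/
theorem tendsto_integral_smul_lowFreqHat (D : LittlewoodPaley) {v : ℝ → R3 → C6}
    (hv : StronglyMeasurable (Function.uncurry v)) {M : ℝ≥0∞} (hMt : M < ∞) {T : EReal}
    (hM : ∀ t ∈ timeIoo T, ∀ j, dyadicWeight (-1) j * blockMass D j (v t) ≤ M) (Φ : 𝓢(ℝ × R3, ℂ)) :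
    (∀ j : ℤ, IntegrableOn (fun z : ℝ × R3 => Φ z • lowFreqHat D j (v z.1) z.2)
      (timeIoo T ×ˢ univ)) ∧
    Tendsto (fun j : ℤ => ∫ z in timeIoo T ×ˢ univ, Φ z • lowFreqHat D j (v z.1) z.2)
      atBot (𝓝 0) := by
  obtain ⟨C, hC, hle⟩ := exists_lintegral_lowCut_le
  have hms : MeasurableSet (timeIoo T ×ˢ (univ : Set R3)) :=
    (measurableSet_timeIoo T).prod MeasurableSet.univ
  have : (volume : Measure (ℝ × R3)).IsAddHaarMeasure := Measure.prod.instIsAddHaarMeasure _ _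
  have hΦ : ∫⁻ z, ‖Φ z‖ₑ < ∞ := Φ.integrable.2
  have hbd : ∀ j : ℤ, ∫⁻ z in timeIoo T ×ˢ univ, ‖Φ z • lowFreqHat D j (v z.1) z.2‖ₑ
      ≤ dyadicWeight 1 j * (C * M) * ∫⁻ z, ‖Φ z‖ₑ := fun j => by
    have hc : dyadicWeight 1 j * (C * M) ≠ ∞ :=
      ENNReal.mul_ne_top ENNReal.ofReal_ne_top (ENNReal.mul_lt_top hC hMt).ne
    rw [← lintegral_const_mul' _ _ hc]
    refine (setLIntegral_mono' hms fun z hz => ?_).trans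
      (lintegral_mono' Measure.restrict_le_self le_rfl)
    rw [enorm_smul, mul_comm]
    gcongr
    exact (enorm_lowFreqHat_le D j _ _).trans (hle D _ M
      (stronglyMeasurable_slice hv z.1).aestronglyMeasurable (hM z.1 hz.1) j)
  refine ⟨fun j => ⟨(Φ.continuous.stronglyMeasurable.smul
    (stronglyMeasurable_lowFreqHat D j hv)).aestronglyMeasurable, (hbd j).trans_lt
      (ENNReal.mul_lt_top (ENNReal.mul_lt_top ENNReal.ofReal_lt_top
        (ENNReal.mul_lt_top hC hMt)) hΦ)⟩, ?_⟩
  rw [tendsto_zero_iff_enorm_tendsto_zero]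
  have h0 : Tendsto (fun j : ℤ => dyadicWeight 1 j * (C * M) * ∫⁻ z, ‖Φ z‖ₑ) atBot (𝓝 0) := by
    have := ENNReal.Tendsto.mul_const (b := C * M * ∫⁻ z, ‖Φ z‖ₑ) tendsto_dyadicWeight_one
      (Or.inr (ENNReal.mul_lt_top (ENNReal.mul_lt_top hC hMt) hΦ).ne)
    simpa only [zero_mul, mul_assoc] using this
  exact tendsto_of_tendsto_of_tendsto_of_le_of_le tendsto_const_nhds h0 (fun _ => zero_le)
    fun j => (enorm_integral_le_lintegral_enorm _).trans (hbd j)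

end Regularity

/-! ### Existence of mild solutions -/

section Existence

variable {D : LittlewoodPaley} {r α : ℝ} {T : EReal} {v₀ : R3 → C6} {n : ℝ × R3 → C3x6}
  {U₀ : 𝓢'(R3, C6)}

theorem exists_hasFourierFn_of_dyadicNorm (D : LittlewoodPaley) (hr : 1 ≤ r) {g : R3 → C6}
    (hg : AEStronglyMeasurable g) (h : dyadicNorm (-1) r (fun j => blockMass D j g) < ∞) :
    ∃ f, HasFourierFn f g :=
  exists_hasFourierFn (integrable_weight_of_dyadicNorm D hr hg h)

theorem locallyIntegrable_of_dyadicNorm (D : LittlewoodPaley) (hr : 1 ≤ r) {g : R3 → C6}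
    (hg : AEStronglyMeasurable g) (h : dyadicNorm (-1) r (fun j => blockMass D j g) < ∞) :
    LocallyIntegrable g :=
  (exists_hasFourierFn_of_dyadicNorm D hr hg h).choose_spec.locallyIntegrable

theorem HasFourierFn.fbNorm_eq {f : 𝓢'(R3, C6)} {g : R3 → C6} (h : HasFourierFn f g)
    (D : LittlewoodPaley) (s r : ℝ) :
    fbNorm D s r f = dyadicNorm s r fun j => blockMass D j g := by
  rw [fbNorm]
  congr 1
  ext1 j
  exact h.blockNorm_eq D j

theorem two_div_exponents (hα : α ∈ Ioo (0 : ℝ) 1) :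
    1 ≤ 2 / (1 + α) ∧ 1 ≤ 2 / (1 - α) ∧ -1 + 2 / (2 / (1 + α)) = α ∧
      -1 + 2 / (2 / (1 - α)) = -α := by
  have h1 : 0 < 1 + α := by linarith [hα.1]
  have h2 : 0 < 1 - α := by linarith [hα.2]
  refine ⟨(one_le_div h1).2 (by linarith [hα.2]), (one_le_div h2).2 (by linarith [hα.1]), ?_, ?_⟩
  · field_simp; ring
  · field_simp; ring

theorem clNorm_eq {U : ℝ → 𝓢'(R3, C6)} {v : ℝ → R3 → C6}
    (hU : ∀ t ∈ timeIco T, HasFourierFn (U t) (v t)) (D : LittlewoodPaley) (s r q : ℝ) :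
    clNorm D s r q T U = dyadicNorm s r (fun j =>
      (∫⁻ t in timeIoo T, blockMass D j (v t) ^ q) ^ (1 / q)) := by
  rw [clNorm]
  congr 1
  ext1 j
  congr 1
  refine setLIntegral_congr_fun (measurableSet_timeIoo T) fun t ht => ?_
  simp only [(hU t (timeIoo_subset_timeIco T ht)).blockNorm_eq D j]

theorem memCL_of_hasFourierFn {U : ℝ → 𝓢'(R3, C6)} {v : ℝ → R3 → C6}
    (hv : StronglyMeasurable (Function.uncurry v))
    (hU : ∀ t ∈ timeIco T, HasFourierFn (U t) (v t)) {M : ℝ≥0∞} (hMt : M < ∞)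
    (hM : ∀ t ∈ timeIoo T, ∀ j, dyadicWeight (-1) j * blockMass D j (v t) ≤ M) {s q : ℝ}
    (hfin : dyadicNorm s r (fun j =>
      (∫⁻ t in timeIoo T, blockMass D j (v t) ^ q) ^ (1 / q)) < ∞) : MemCL D s r q T U := by
  refine ⟨?_, by rwa [clNorm_eq hU], fun Φ _ => ?_⟩
  · filter_upwards [ae_restrict_mem (measurableSet_timeIoo T)] with t ht
    exact ⟨_, hU t (timeIoo_subset_timeIco T ht)⟩
  have hms : MeasurableSet (timeIoo T ×ˢ (univ : Set R3)) :=
    (measurableSet_timeIoo T).prod MeasurableSet.univ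
  have he : ∀ j : ℤ, EqOn (fun z : ℝ × R3 => Φ z • lowFreqHat D j (v z.1) z.2)
      (fun z => Φ z • lowFreq D j (U z.1) z.2) (timeIoo T ×ˢ univ) := fun j z hz => by
    simp only [(hU z.1 (timeIoo_subset_timeIco T hz.1)).lowFreq_eq D j z.2]
  obtain ⟨h1, h2⟩ := tendsto_integral_smul_lowFreqHat D hv hMt hM Φ
  exact ⟨fun j => (h1 j).congr_fun (he j) hms,
    h2.congr fun j => setIntegral_congr_fun hms (he j)⟩

theorem solutionClass_of_hasFourierFn (hr : 1 ≤ r) (hα : α ∈ Ioo (0 : ℝ) 1)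
    (hv : StronglyMeasurable v₀) (hfin : dyadicNorm (-1) r (fun j => blockMass D j v₀) < ∞)
    (hn : StronglyMeasurable n) (hnfin : ∫⁻ z, ‖n z‖ₑ ∂spaceTime T < ∞) {U : ℝ → 𝓢'(R3, C6)}
    (hU : ∀ t ∈ timeIco T, HasFourierFn (U t) (velHat v₀ n t)) : SolutionClass D r α T U := by
  obtain ⟨hq1, hq2, e1, e2⟩ := two_div_exponents hα
  have hvm := stronglyMeasurable_velHat hv hn
  have hMt : dyadicNorm (-1) r (fun j => blockMass D j v₀)
      + 648 * ∫⁻ z, ‖n z‖ₑ ∂spaceTime T < ∞ :=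
    ENNReal.add_lt_top.2 ⟨hfin, ENNReal.mul_lt_top (by simp) hnfin⟩
  have hM : ∀ t ∈ timeIoo T, ∀ j, dyadicWeight (-1) j * blockMass D j (velHat v₀ n t) ≤ _ :=
    fun t ht j => (le_dyadicNorm hr _ j).trans
      (dyadicNorm_velHat_slice_le D hr hv hn (timeIoo_subset_timeIco T ht))
  refine ⟨⟨fun t ht => ⟨⟨_, hU t ht⟩, ?_⟩, fun t₀ ht₀ => ?_⟩,
    memCL_of_hasFourierFn hvm hU hMt hM ?_, memCL_of_hasFourierFn hvm hU hMt hM ?_⟩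
  · rw [(hU t ht).fbNorm_eq]
    exact (dyadicNorm_velHat_slice_le D hr hv hn ht).trans_lt hMt
  · refine (tendsto_dyadicNorm_velHat_sub D hr hv hfin hn hnfin ht₀).congr' ?_
    filter_upwards [self_mem_nhdsWithin] with t ht
    exact (((hU t ht).sub (hU t₀ ht₀)).fbNorm_eq D (-1) r).symm
  · have := dyadicNorm_velHat_lt_top (T := T) D hq1 hr hv hfin hn hnfin
    rwa [e1] at this
  · have := dyadicNorm_velHat_lt_top (T := T) D hq2 hr hv hfin hn hnfin
    rwa [e2] at this

theorem exists_norm_mul_norm_le (φ : 𝓢(R3, ℂ)) : ∃ C : ℝ≥0∞, C < ∞ ∧ ∀ ξ, ‖φ ξ‖ₑ * ‖ξ‖ₑ ≤ C := by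
  obtain ⟨C, -, hC⟩ := φ.decay 1 0
  refine ⟨ENNReal.ofReal C, ENNReal.ofReal_lt_top, fun ξ => ?_⟩
  have := hC ξ
  rw [pow_one, norm_iteratedFDeriv_zero] at this
  rw [← ofReal_norm, ← ofReal_norm, ← ENNReal.ofReal_mul (norm_nonneg _), mul_comm]
  exact ENNReal.ofReal_le_ofReal this

/-- The Duhamel term of the mild formulation, tested with `φ`. -/
theorem integral_smul_duhamelInt (hn : StronglyMeasurable n)
    (hnfin : ∫⁻ z, ‖n z‖ₑ ∂spaceTime T < ∞) {N : ℝ → 𝓢'(R3, C3x6)}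
    (hN : ∀ᵐ τ ∂(volume.restrict (timeIoo T)), hat (N τ) =ᵐ[volume] fun ξ => n (τ, ξ)) {t : ℝ}
    (ht : t ∈ timeIco T) (φ : 𝓢(R3, ℂ)) :
    IntervalIntegrable (fun τ => ∫ ξ, φ ξ • duhamelHat (t - τ) (N τ) ξ) volume 0 t ∧
      ∫ τ in (0 : ℝ)..t, ∫ ξ, φ ξ • duhamelHat (t - τ) (N τ) ξ = ∫ ξ, φ ξ • duhamelInt n t ξ := by
  set f : ℝ × R3 → C6 := fun z => φ z.2 • flowHat (t - z.1) z.2 (forceHat z.2 (n z)) with hf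
  have hfm : StronglyMeasurable f := by
    have h1 : StronglyMeasurable fun z : ℝ × R3 => flowHat (t - z.1) z.2 (forceHat z.2 (n z)) :=
      (stronglyMeasurable_duhamel_integrand hn).comp_measurable
        (g := fun z : ℝ × R3 => (((t, z.2) : ℝ × R3), z.1)) (by fun_prop)
    exact (φ.continuous.comp continuous_snd).stronglyMeasurable.smul h1
  have hfi : Integrable f ((volume.restrict (Ioo 0 t)).prod volume) := by
    obtain ⟨C, hC, hle⟩ := exists_norm_mul_norm_le φ
    refine ⟨hfm.aestronglyMeasurable, ?_⟩
    have h1 : ∫⁻ z, ‖f z‖ₑ ∂((volume.restrict (Ioo 0 t)).prod volume)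
        ≤ 216 * C * ∫⁻ z, ‖n z‖ₑ ∂spaceTime T := by
      rw [lintegral_prod _ hfm.enorm.aemeasurable, lintegral_spaceTime hn,
        ← lintegral_const_mul' _ _ (ENNReal.mul_lt_top (by simp) hC).ne]
      refine (setLIntegral_mono' measurableSet_Ioo fun τ hτ => ?_).trans
        (lintegral_mono_set (Ioo_subset_timeIoo ht))
      rw [← lintegral_const_mul' _ _ (ENNReal.mul_lt_top (by simp) hC).ne]
      refine lintegral_mono fun ξ => ?_
      rw [hf, enorm_smul]
      calc _ ≤ ‖φ ξ‖ₑ * (216 * (‖ξ‖ₑ * ‖n (τ, ξ)‖ₑ)) := by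
            gcongr
            exact (enorm_flowHat_le (sub_pos.2 hτ.2).le _ _).trans (enorm_forceHat_le _ _)
        _ = 216 * (‖φ ξ‖ₑ * ‖ξ‖ₑ) * ‖n (τ, ξ)‖ₑ := by ring
        _ ≤ _ := by gcongr; exact hle ξ
    exact h1.trans_lt (ENNReal.mul_lt_top (ENNReal.mul_lt_top (by simp) hC) hnfin)
  have hN' : ∀ᵐ τ ∂(volume.restrict (Ioo 0 t)),
      ∫ ξ, f (τ, ξ) = ∫ ξ, φ ξ • duhamelHat (t - τ) (N τ) ξ := by
    filter_upwards [ae_restrict_of_ae_restrict_of_subset (Ioo_subset_timeIoo ht) hN] with τ hτ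
    refine integral_congr_ae (hτ.mono fun ξ hξ => ?_)
    simp only [hf, duhamelHat_eq, hξ]
  have hint : IntegrableOn (fun τ => ∫ ξ, φ ξ • duhamelHat (t - τ) (N τ) ξ) (Ioo 0 t) :=
    hfi.integral_prod_left.congr hN'
  refine ⟨(intervalIntegrable_iff_integrableOn_Ioo_of_le ht.1).2 hint, ?_⟩
  rw [intervalIntegral.integral_of_le ht.1, integral_Ioc_eq_integral_Ioo,
    ← integral_congr_ae hN', integral_integral_swap hfi]
  refine integral_congr_ae (ae_of_all _ fun ξ => ?_)
  simp only [hf, duhamelInt, integral_smul]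

/-- The mild formulation, tested with `φ`. -/
theorem integral_smul_velHat (hr : 1 ≤ r) (hv : StronglyMeasurable v₀)
    (hfin : dyadicNorm (-1) r (fun j => blockMass D j v₀) < ∞) (hv₀ : hat U₀ =ᵐ[volume] v₀)
    (hn : StronglyMeasurable n) (hnfin : ∫⁻ z, ‖n z‖ₑ ∂spaceTime T < ∞) {t : ℝ}
    (ht : t ∈ timeIco T) (φ : 𝓢(R3, ℂ)) (hφ : HasCompactSupport φ) :
    ∫ ξ, φ ξ • velHat v₀ n t ξ
      = (∫ ξ, φ ξ • linearHat t U₀ ξ) - ∫ ξ, φ ξ • duhamelInt n t ξ := by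
  have h1 : LocallyIntegrable fun ξ => flowHat t ξ (v₀ ξ) :=
    locallyIntegrable_of_dyadicNorm D hr
      (stronglyMeasurable_slice (stronglyMeasurable_flowHat hv) t).aestronglyMeasurable
      ((dyadicNorm_flowHat_slice_le D hr ht.1 v₀).trans_lt hfin)
  have h2 : LocallyIntegrable (duhamelInt n t) :=
    locallyIntegrable_of_dyadicNorm D hr
      (stronglyMeasurable_slice (stronglyMeasurable_duhamelInt hn) t).aestronglyMeasurable
      ((dyadicNorm_duhamelInt_slice_le D hr hn ht).trans_lt (ENNReal.mul_lt_top (by simp) hnfin))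
  have h3 : ∫ ξ, φ ξ • linearHat t U₀ ξ = ∫ ξ, φ ξ • flowHat t ξ (v₀ ξ) :=
    integral_congr_ae (hv₀.mono fun ξ hξ => by simp only [linearHat_eq, hξ])
  rw [h3, ← integral_sub (h1.integrable_smul_left_of_hasCompactSupport φ.continuous hφ)
    (h2.integrable_smul_left_of_hasCompactSupport φ.continuous hφ)]
  simp only [velHat, smul_sub]

open Classical in
/-- A fixed point gives a mild solution. -/
theorem IsFixedPoint.isMildSolution (hr : 1 ≤ r) (hv : StronglyMeasurable v₀)
    (hfin : dyadicNorm (-1) r (fun j => blockMass D j v₀) < ∞) (hv₀ : hat U₀ =ᵐ[volume] v₀)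
    (hlin : ∫⁻ t in timeIoo T, (∫⁻ ξ, ‖flowHat t ξ (v₀ ξ)‖ₑ) ^ 2 < ∞)
    (h : IsFixedPoint T v₀ n) {U : ℝ → 𝓢'(R3, C6)}
    (hU : ∀ t ∈ timeIco T, HasFourierFn (U t) (velHat v₀ n t)) : IsMildSolution T U₀ U := by
  have hvm := stronglyMeasurable_velHat hv h.1
  let N : ℝ → 𝓢'(R3, C3x6) := fun τ =>
    if hτ : ∃ f, HasFourierFn f (tensorHat (velHat v₀ n τ) (velHat v₀ n τ)) then hτ.choose else 0
  have hN : ∀ᵐ τ ∂(volume.restrict (timeIoo T)), Integrable (velHat v₀ n τ) ∧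
      HasFourierFn (N τ) (tensorHat (velHat v₀ n τ) (velHat v₀ n τ)) := by
    filter_upwards [ae_integrable_of_lintegral_sq hvm (h.lintegral_sq_velHat_lt_top hv hlin)]
      with τ hτ
    have hex := exists_hasFourierFn (integrable_weight_smul (integrable_tensorHat hτ hτ))
    refine ⟨hτ, ?_⟩
    simp only [N, dif_pos hex]
    exact hex.choose_spec
  have hNn : ∀ᵐ τ ∂(volume.restrict (timeIoo T)), hat (N τ) =ᵐ[volume] fun ξ => n (τ, ξ) := by
    filter_upwards [hN, Measure.ae_ae_of_ae_prod h.ae_eq] with τ h1 h2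
    exact h1.2.hat_ae_eq.trans (EventuallyEq.symm h2)
  refine ⟨fun t ht => ⟨_, hU t ht⟩, N, ?_, fun t ht φ hφ => ?_⟩
  · filter_upwards [hN, ae_restrict_mem (measurableSet_timeIoo T)] with τ h1 h2
    exact isTensor_of_hasFourierFn (hU τ (timeIoo_subset_timeIco T h2)) h1.1 h1.2
  · obtain ⟨h1, h2⟩ := integral_smul_duhamelInt h.1 h.2 hNn ht φ
    refine ⟨h1, ?_⟩
    rw [h2, ← integral_smul_velHat hr hv hfin hv₀ h.1 h.2 ht φ hφ]
    exact integral_congr_ae ((hU t ht).hat_ae_eq.mono fun ξ hξ => by simp only [hξ])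

end Existence

/-! ### Uniqueness of mild solutions -/

section JointMeasurability

/-- A measurable curve in `L¹(ℝ³)` has a jointly measurable representative: it is the limit of
curves which take values in a countable dense set, at a rate uniform in time. -/
theorem exists_stronglyMeasurable_uncurry {G : ℝ → Lp C6 1 (volume : Measure R3)}
    (hG : ∀ f, Measurable fun t => edist f (G t)) :
    ∃ w : ℝ → R3 → C6, StronglyMeasurable (Function.uncurry w) ∧ ∀ t, w t =ᵐ[volume] G t := by
  classical
  have : Fact ((1 : ℝ≥0∞) ≠ ∞) := ⟨ENNReal.one_ne_top⟩
  have : TopologicalSpace.SeparableSpace (Lp C6 1 (volume : Measure R3)) := inferInstance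
  let d := TopologicalSpace.denseSeq (Lp C6 1 (volume : Measure R3))
  have hex : ∀ (m : ℕ) (t : ℝ), ∃ k, edist (d k) (G t) < 2⁻¹ ^ m := fun m t => by
    obtain ⟨y, hy, k, rfl⟩ := EMetric.dense_iff.1
      (TopologicalSpace.denseRange_denseSeq (Lp C6 1 (volume : Measure R3))) (G t) (2⁻¹ ^ m)
      (ENNReal.pow_pos (by simp) m)
    exact ⟨k, hy⟩
  let K : ℕ → ℝ → ℕ := fun m t => Nat.find (hex m t)
  have hK : ∀ m, Measurable (K m) := fun m =>
    measurable_find (hex m) fun k => measurableSet_lt (hG (d k)) measurable_const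
  let f : ℕ → ℝ × R3 → C6 := fun m z => d (K m z.1) z.2
  have hf : ∀ m, StronglyMeasurable (f m) := fun m => by
    have h1 : Measurable fun p : ℕ × R3 => d p.1 p.2 :=
      measurable_from_prod_countable_right fun k => (Lp.stronglyMeasurable (d k)).measurable
    exact (h1.comp (((hK m).comp measurable_fst).prodMk measurable_snd)).stronglyMeasurable
  have hlim : StronglyMeasurable fun z => limUnder atTop fun m => f m z :=
    StronglyMeasurable.limUnder hf
  refine ⟨fun t ξ => limUnder atTop fun m => f m (t, ξ), hlim, fun t => ?_⟩
  have hm : ∀ m, AEMeasurable (fun ξ => ‖f m (t, ξ) - G t ξ‖ₑ) volume := fun m =>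
    (((hf m).comp_measurable measurable_prodMk_left).sub (Lp.stronglyMeasurable _)).enorm.aemeasurable
  have hle : ∀ m, ∫⁻ ξ, ‖f m (t, ξ) - G t ξ‖ₑ ≤ 2⁻¹ ^ m := fun m => by
    refine le_trans (le_of_eq ?_) (Nat.find_spec (hex m t)).le
    rw [Lp.edist_def, eLpNorm_one_eq_lintegral_enorm]
    rfl
  have hsum : ∫⁻ ξ, ∑' m, ‖f m (t, ξ) - G t ξ‖ₑ ≠ ∞ := by
    rw [lintegral_tsum hm]
    refine ((ENNReal.tsum_le_tsum hle).trans_lt ?_).ne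
    rw [ENNReal.tsum_geometric, ENNReal.one_sub_inv_two, inv_inv]
    simp
  filter_upwards [ae_lt_top' (AEMeasurable.tsum hm) hsum] with ξ hξ
  refine Tendsto.limUnder_eq ?_
  rw [tendsto_iff_edist_tendsto_0]
  simpa only [edist_eq_enorm_sub] using ENNReal.tendsto_atTop_zero_of_tsum_ne_top hξ.ne

end JointMeasurability

section Uniqueness

variable {D : LittlewoodPaley} {r α : ℝ} {T : EReal}

theorem measurableSet_timeIco (T : EReal) : MeasurableSet (timeIco T) :=
  measurableSet_Ici.inter (measurable_coe_real_ereal measurableSet_Iio)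

open Classical in
/-- A continuous curve in `FḂ^{-1}_{1,r}` has a jointly measurable Fourier transform. -/
theorem MemCFB.exists_stronglyMeasurable (hr : 1 ≤ r) {V : ℝ → 𝓢'(R3, C6)}
    (hV : MemCFB D (-1) r T V) : ∃ w : ℝ → R3 → C6,
      StronglyMeasurable (Function.uncurry w) ∧ ∀ t ∈ timeIco T, HasFourierFn (V t) (w t) := by
  have hhat : ∀ t ∈ timeIco T, HasFourierFn (V t) (hat (V t)) := fun t ht =>
    hasFourierFn_hat (hV.1 t ht).1
  have hi : ∀ t ∈ timeIco T, Integrable fun ξ => ((1 + ‖ξ‖ ^ 2 : ℝ) : ℂ)⁻¹ • hat (V t) ξ :=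
    fun t ht => integrable_weight_of_dyadicNorm D hr (aestronglyMeasurable_hat _) (by
      rw [← (hhat t ht).fbNorm_eq]
      exact (hV.1 t ht).2)
  let G : ℝ → Lp C6 1 (volume : Measure R3) := fun t =>
    if ht : t ∈ timeIco T then (hi t ht).toL1 else 0
  have hGt : ∀ t ∈ timeIco T,
      G t =ᵐ[volume] fun ξ => ((1 + ‖ξ‖ ^ 2 : ℝ) : ℂ)⁻¹ • hat (V t) ξ := fun t ht => by
    simp only [G, dif_pos ht]
    exact (hi t ht).coeFn_toL1
  have hGc : ContinuousOn G (timeIco T) := fun t₀ ht₀ => by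
    obtain ⟨C, hC, hle⟩ := exists_lintegral_weight_le
    rw [ContinuousWithinAt, tendsto_iff_edist_tendsto_0]
    have h0 := ENNReal.Tendsto.const_mul (a := C) (hV.2 t₀ ht₀) (Or.inr hC.ne)
    rw [mul_zero] at h0
    refine tendsto_of_tendsto_of_tendsto_of_le_of_le' tendsto_const_nhds h0
      (Eventually.of_forall fun _ => zero_le) ?_
    filter_upwards [self_mem_nhdsWithin] with t ht
    have hs := (hhat t ht).sub (hhat t₀ ht₀)
    rw [hs.fbNorm_eq]
    refine le_trans (le_of_eq ?_) (hle D (fun ξ => hat (V t) ξ - hat (V t₀) ξ) _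
      ((aestronglyMeasurable_hat _).sub (aestronglyMeasurable_hat _)) (le_dyadicNorm hr _))
    rw [Lp.edist_def, eLpNorm_one_eq_lintegral_enorm]
    refine lintegral_congr_ae ?_
    filter_upwards [hGt t ht, hGt t₀ ht₀] with ξ h1 h2
    rw [Pi.sub_apply, h1, h2, ← smul_sub, enorm_smul]
    congr 1
    rw [← Complex.ofReal_inv, ← ofReal_norm, Complex.norm_real, Real.norm_of_nonneg (by positivity)]
  have hGm : ∀ f, Measurable fun t => edist f (G t) := fun f => by
    have h1 : ContinuousOn (fun t => edist f (G t)) (timeIco T) :=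
      (continuous_const.edist continuous_id).comp_continuousOn hGc
    have h2 : ContinuousOn (fun t => edist f (G t)) (timeIco T)ᶜ :=
      (continuousOn_const (c := edist f 0)).congr fun t ht => by
        simp only [G, dif_neg (show t ∉ timeIco T from ht)]
    have := h1.measurable_piecewise h2 (measurableSet_timeIco T)
    rwa [piecewise_same] at this
  obtain ⟨w, hw, hwG⟩ := exists_stronglyMeasurable_uncurry hGm
  have hc : Continuous fun z : ℝ × R3 => ((1 + ‖z.2‖ ^ 2 : ℝ) : ℂ) := by fun_prop
  refine ⟨fun t ξ => ((1 + ‖ξ‖ ^ 2 : ℝ) : ℂ) • w t ξ, hc.stronglyMeasurable.smul hw,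
    fun t ht => (hhat t ht).congr ?_⟩
  filter_upwards [hwG t, hGt t ht] with ξ h1 h2
  rw [h1, h2, smul_inv_smul₀]
  exact_mod_cast (by positivity : (0 : ℝ) < 1 + ‖ξ‖ ^ 2).ne'

theorem holderConjugate_exponents (hα : α ∈ Ioo (0 : ℝ) 1) :
    (2 / (1 + α)).HolderConjugate (2 / (1 - α)) := by
  have h1 : 0 < 1 + α := by linarith [hα.1]
  have h2 : 0 < 1 - α := by linarith [hα.2]
  rw [Real.holderConjugate_iff]
  refine ⟨(one_lt_div h1).2 (by linarith [hα.2]), ?_⟩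
  field_simp
  ring

/-- The intersection of the two Chemin-Lerner spaces embeds into `L²(0, T; L¹)` on the Fourier
side. This is where `r ≤ 2` is used. -/
theorem exists_lintegral_sq_le (hα : α ∈ Ioo (0 : ℝ) 1) :
    ∃ C : ℝ≥0∞, C < ∞ ∧ ∀ (D : LittlewoodPaley) (r : ℝ) (T : EReal) (v : ℝ → R3 → C6),
      r ∈ Icc (1 : ℝ) 2 → StronglyMeasurable (Function.uncurry v) →
      ∫⁻ t in timeIoo T, (∫⁻ ξ, ‖v t ξ‖ₑ) ^ 2 ≤ C *
        (dyadicNorm α r (fun j => (∫⁻ t in timeIoo T, blockMass D j (v t) ^ (2 / (1 + α)))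
            ^ (1 / (2 / (1 + α)))) ^ 2
          + dyadicNorm (-α) r (fun j => (∫⁻ t in timeIoo T, blockMass D j (v t) ^ (2 / (1 - α)))
            ^ (1 / (2 / (1 - α)))) ^ 2) := by
  obtain ⟨C, hC, hle⟩ := exists_interpolation hα.1
  refine ⟨C, hC, fun D r T v hr hv => ?_⟩
  have h := hle (volume.restrict (timeIoo T)) _ _ (holderConjugate_exponents hα)
    (fun j t => blockMass D j (v t)) fun j => (measurable_blockMass D hv j).aemeasurable
  have e : ∀ t, ∑' j, blockMass D j (v t) = ∫⁻ ξ, ‖v t ξ‖ₑ := fun t =>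
    (lintegral_enorm_eq_tsum_blockMass D (stronglyMeasurable_slice hv t).aestronglyMeasurable).symm
  simp only [e] at h
  refine h.trans ?_
  gcongr
  · exact tsum_sq_le_dyadicNorm_sq hr _
  · exact tsum_sq_le_dyadicNorm_sq hr _

/-- The free evolution of data in `FḂ^{-1}_{1,r}` is in `L²(0, T; L¹)` on the Fourier side. -/
theorem exists_lintegral_sq_flowHat_le (hα : α ∈ Ioo (0 : ℝ) 1) :
    ∃ C : ℝ≥0∞, C < ∞ ∧ ∀ (D : LittlewoodPaley) (r : ℝ) (T : EReal) (v₀ : R3 → C6),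
      r ∈ Icc (1 : ℝ) 2 → StronglyMeasurable v₀ →
      ∫⁻ t in timeIoo T, (∫⁻ ξ, ‖flowHat t ξ (v₀ ξ)‖ₑ) ^ 2
        ≤ C * dyadicNorm (-1) r (fun j => blockMass D j v₀) ^ 2 := by
  obtain ⟨C, hC, hle⟩ := exists_lintegral_sq_le hα
  obtain ⟨hq1, hq2, e1, e2⟩ := two_div_exponents hα
  refine ⟨C * 32, ENNReal.mul_lt_top hC (by simp), fun D r T v₀ hr hv => ?_⟩
  have h1 := dyadicNorm_flowHat_le D hq1 hr.1 T hv
  have h2 := dyadicNorm_flowHat_le D hq2 hr.1 T hv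
  rw [e1] at h1
  rw [e2] at h2
  refine (hle D r T _ hr (stronglyMeasurable_flowHat hv)).trans ?_
  calc _ ≤ C * ((4 * dyadicNorm (-1) r fun j => blockMass D j v₀) ^ 2
        + (4 * dyadicNorm (-1) r fun j => blockMass D j v₀) ^ 2) := by gcongr
    _ = _ := by ring

/-- The quadratic term of a mild solution in the solution class is a fixed point. -/
theorem exists_isFixedPoint_of_isMildSolution (hr : r ∈ Icc (1 : ℝ) 2)
    (hα : α ∈ Ioo (0 : ℝ) 1) {v₀ : R3 → C6} (hv : StronglyMeasurable v₀)
    (hfin : dyadicNorm (-1) r (fun j => blockMass D j v₀) < ∞) {U₀ : 𝓢'(R3, C6)}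
    (hv₀ : hat U₀ =ᵐ[volume] v₀) {V : ℝ → 𝓢'(R3, C6)} (hV : SolutionClass D r α T V)
    (hmild : IsMildSolution T U₀ V) :
    ∃ n, IsFixedPoint T v₀ n ∧ ∀ t ∈ timeIco T, HasFourierFn (V t) (velHat v₀ n t) := by
  obtain ⟨w, hw, hVw⟩ := hV.1.exists_stronglyMeasurable hr.1
  have hwsq : ∫⁻ t in timeIoo T, (∫⁻ ξ, ‖w t ξ‖ₑ) ^ 2 < ∞ := by
    obtain ⟨C, hC, hle⟩ := exists_lintegral_sq_le hα
    refine (hle D r T w hr hw).trans_lt (ENNReal.mul_lt_top hC (ENNReal.add_lt_top.2 ?_))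
    rw [← clNorm_eq hVw, ← clNorm_eq hVw]
    exact ⟨ENNReal.pow_lt_top hV.2.1.2.1, ENNReal.pow_lt_top hV.2.2.2.1⟩
  set n : ℝ × R3 → C3x6 := fun z => tensorHat (w z.1) (w z.1) z.2 with hn
  have hnm : StronglyMeasurable n := stronglyMeasurable_tensorHat hw
  have hnfin : ∫⁻ z, ‖n z‖ₑ ∂spaceTime T < ∞ := by
    rw [lintegral_spaceTime hnm]
    exact (lintegral_tensorHat_self_le hw).trans_lt hwsq
  obtain ⟨-, N, hN, hid⟩ := hmild
  have hNn : ∀ᵐ τ ∂(volume.restrict (timeIoo T)), hat (N τ) =ᵐ[volume] fun ξ => n (τ, ξ) := by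
    filter_upwards [hN, ae_integrable_of_lintegral_sq hw hwsq,
      ae_restrict_mem (measurableSet_timeIoo T)] with τ h1 h2 h3
    exact (h1.hasFourierFn (hVw τ (timeIoo_subset_timeIco T h3)) h2).hat_ae_eq
  have hVvel : ∀ t ∈ timeIco T, HasFourierFn (V t) (velHat v₀ n t) := fun t ht => by
    have h1 := hasFourierFn_hat ⟨_, hVw t ht⟩
    refine h1.congr (ae_eq_of_forall_integral_smul_eq h1.locallyIntegrable ?_ fun φ hφ => ?_)
    · exact locallyIntegrable_of_dyadicNorm D hr.1
        (stronglyMeasurable_slice (stronglyMeasurable_velHat hv hnm) t).aestronglyMeasurable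
        ((dyadicNorm_velHat_slice_le D hr.1 hv hnm ht).trans_lt (ENNReal.add_lt_top.2
          ⟨hfin, ENNReal.mul_lt_top (by simp) hnfin⟩))
    · rw [(hid t ht φ hφ).2, (integral_smul_duhamelInt hnm hnfin hNn ht φ).2,
        integral_smul_velHat hr.1 hv hfin hv₀ hnm hnfin ht φ hφ]
  refine ⟨n, ⟨hnm, hnfin, ?_⟩, hVvel⟩
  -- `n` was built from `w`, which agrees with `velHat v₀ n` almost everywhere at each time
  have h1 : ∀ᵐ z ∂spaceTime T, z.1 ∈ timeIoo T := by
    have := (Measure.quasiMeasurePreserving_fst (μ := volume.restrict (timeIoo T))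
      (ν := (volume : Measure R3))).ae (ae_restrict_mem (measurableSet_timeIoo T))
    exact this
  filter_upwards [h1] with z hz
  have hz' := timeIoo_subset_timeIco T hz
  rw [hn]
  simp only
  rw [tensorHat_congr ((hVw z.1 hz').ae_eq (hVvel z.1 hz'))]

end Uniqueness

/-! ### Well-posedness -/

section WellPosedness

variable {D : LittlewoodPaley} {r α : ℝ}

/-- Well-posedness on `[0, T)` for data whose free evolution is small in `L²(0, T; L¹)`. -/
theorem exists_unique_isMildSolution (hr : r ∈ Icc (1 : ℝ) 2) (hα : α ∈ Ioo (0 : ℝ) 1)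
    {U₀ : 𝓢'(R3, C6)} {v₀ : R3 → C6} (hv : StronglyMeasurable v₀)
    (hfin : dyadicNorm (-1) r (fun j => blockMass D j v₀) < ∞) (hv₀ : hat U₀ =ᵐ[volume] v₀)
    {T : EReal}
    (hlin : ∫⁻ t in timeIoo T, (∫⁻ ξ, ‖flowHat t ξ (v₀ ξ)‖ₑ) ^ 2 ≤ ((1728 : ℝ≥0∞)⁻¹) ^ 2) :
    ∃ U : ℝ → 𝓢'(R3, C6), (SolutionClass D r α T U ∧ IsMildSolution T U₀ U) ∧
      ∀ V : ℝ → 𝓢'(R3, C6), SolutionClass D r α T V → IsMildSolution T U₀ V →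
        ∀ t ∈ timeIco T, V t = U t := by
  classical
  have hlin' := hlin.trans_lt (ENNReal.pow_lt_top (by simp : (1728 : ℝ≥0∞)⁻¹ < ∞))
  obtain ⟨n, hn⟩ := exists_isFixedPoint hv hlin
  have hex : ∀ t ∈ timeIco T, ∃ f, HasFourierFn f (velHat v₀ n t) := fun t ht =>
    exists_hasFourierFn_of_dyadicNorm D hr.1
      (stronglyMeasurable_slice (stronglyMeasurable_velHat hv hn.1) t).aestronglyMeasurable
      ((dyadicNorm_velHat_slice_le D hr.1 hv hn.1 ht).trans_lt (ENNReal.add_lt_top.2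
        ⟨hfin, ENNReal.mul_lt_top (by simp) hn.2⟩))
  let U : ℝ → 𝓢'(R3, C6) := fun t => if ht : t ∈ timeIco T then (hex t ht).choose else 0
  have hU : ∀ t ∈ timeIco T, HasFourierFn (U t) (velHat v₀ n t) := fun t ht => by
    simp only [U, dif_pos ht]
    exact (hex t ht).choose_spec
  refine ⟨U, ⟨solutionClass_of_hasFourierFn hr.1 hα hv hfin hn.1 hn.2 hU,
    hn.isMildSolution hr.1 hv hfin hv₀ hlin' hU⟩, fun V hV hmild t ht => ?_⟩
  obtain ⟨n', hn', hVn'⟩ := exists_isFixedPoint_of_isMildSolution hr hα hv hfin hv₀ hV hmild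
  exact ((hVn' t ht).congr (hn'.velHat_ae_eq hv hlin' hn ht)).eq (hU t ht)

/-- The choice of a Borel representative of the Fourier transform of the data. -/
theorem MemFB.exists_stronglyMeasurable {s : ℝ} {U₀ : 𝓢'(R3, C6)} (h : MemFB D s r U₀) :
    ∃ v₀ : R3 → C6, StronglyMeasurable v₀ ∧ hat U₀ =ᵐ[volume] v₀ ∧
      fbNorm D s r U₀ = dyadicNorm s r fun j => blockMass D j v₀ := by
  have hm := aestronglyMeasurable_hat U₀
  exact ⟨hm.mk, hm.stronglyMeasurable_mk, hm.ae_eq_mk,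
    ((hasFourierFn_hat h.1).congr hm.ae_eq_mk).fbNorm_eq D s r⟩

end WellPosedness

end Micropolar

end

theorem theorem1p4 (D : Micropolar.LittlewoodPaley) (r α : ℝ)
    (hr : r ∈ Set.Icc (1 : ℝ) 2) (hα : α ∈ Set.Ioo (0 : ℝ) 1) :
    (∀ U₀ : 𝓢'(Micropolar.R3, Micropolar.C6),
      Micropolar.MemFB D (-1) r U₀ → Micropolar.IsDivFree U₀ →
      ∃ T : ℝ, 0 < T ∧
        ∃ U : ℝ → 𝓢'(Micropolar.R3, Micropolar.C6),
          (Micropolar.SolutionClass D r α T U ∧ Micropolar.IsMildSolution T U₀ U) ∧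
          ∀ V : ℝ → 𝓢'(Micropolar.R3, Micropolar.C6),
            Micropolar.SolutionClass D r α T V → Micropolar.IsMildSolution T U₀ V →
            ∀ t ∈ Micropolar.timeIco T, V t = U t) ∧
    (∃ ε : ℝ, 0 < ε ∧
      ∀ U₀ : 𝓢'(Micropolar.R3, Micropolar.C6),
        Micropolar.MemFB D (-1) r U₀ → Micropolar.IsDivFree U₀ →
        Micropolar.fbNorm D (-1) r U₀ < ENNReal.ofReal ε →
        ∃ U : ℝ → 𝓢'(Micropolar.R3, Micropolar.C6),
          (Micropolar.SolutionClass D r α ⊤ U ∧ Micropolar.IsMildSolution ⊤ U₀ U) ∧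
          ∀ V : ℝ → 𝓢'(Micropolar.R3, Micropolar.C6),
            Micropolar.SolutionClass D r α ⊤ V → Micropolar.IsMildSolution ⊤ U₀ V →
            ∀ t ∈ Micropolar.timeIco ⊤, V t = U t) := by
  obtain ⟨C, hC, hle⟩ := Micropolar.exists_lintegral_sq_flowHat_le hα
  have hδ0 : ((1728 : ℝ≥0∞)⁻¹) ^ 2 ≠ 0 := by simp
  refine ⟨fun U₀ hU₀ _ => ?_, ?_⟩
  · obtain ⟨v₀, hv, hv₀, hnorm⟩ := hU₀.exists_stronglyMeasurable
    have hfin := hU₀.2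
    rw [hnorm] at hfin
    -- the norm of the free evolution in `L²(0, T; L¹)` tends to `0` with `T`
    have htop := ((hle D r ⊤ v₀ hr hv).trans_lt
      (ENNReal.mul_lt_top hC (ENNReal.pow_lt_top hfin))).ne
    obtain ⟨δ, hδ, hsmall⟩ := exists_pos_setLIntegral_lt_of_measure_lt htop hδ0
    obtain ⟨T, hT, hTδ⟩ : ∃ T : ℝ, 0 < T ∧ ENNReal.ofReal T < δ := by
      obtain ⟨η, h0, h1⟩ := ENNReal.lt_iff_exists_nnreal_btwn.1 hδ
      exact ⟨η, by exact_mod_cast h0, by simpa using h1⟩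
    refine ⟨T, hT, Micropolar.exists_unique_isMildSolution hr hα hv hfin hv₀ ?_⟩
    have hsub : Ioo 0 T ⊆ Micropolar.timeIoo ⊤ := fun t ht => ⟨ht.1, EReal.coe_lt_top t⟩
    have h1 := hsmall (Ioo 0 T) ((Measure.restrict_apply_le _ _).trans_lt (by
      rwa [Real.volume_Ioo, sub_zero]))
    rw [Measure.restrict_restrict measurableSet_Ioo, inter_eq_left.2 hsub] at h1
    rw [Micropolar.timeIoo_coe]
    exact h1.le
  · -- `ε` is such that `C ε² ≤ 1728⁻²`
    obtain ⟨η, hη, hηC⟩ : ∃ η : ℝ≥0∞, 0 < η ∧ C * η ^ 2 ≤ ((1728 : ℝ≥0∞)⁻¹) ^ 2 := by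
      have h0 : Tendsto (fun η : ℝ≥0∞ => C * η ^ 2) (𝓝 0) (𝓝 0) := by
        have := ENNReal.Tendsto.const_mul (a := C)
          ((ENNReal.continuous_pow 2).tendsto 0) (Or.inr hC.ne)
        simpa using this
      have h2 : ∀ᶠ η in 𝓝[>] (0 : ℝ≥0∞), C * η ^ 2 < ((1728 : ℝ≥0∞)⁻¹) ^ 2 :=
        (h0.mono_left nhdsWithin_le_nhds).eventually_lt_const (pos_iff_ne_zero.2 hδ0)
      obtain ⟨η, hη, h1⟩ := (h2.and self_mem_nhdsWithin).exists
      exact ⟨η, h1, hη.le⟩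
    obtain ⟨ε, hε0, hε⟩ := ENNReal.lt_iff_exists_nnreal_btwn.1 hη
    refine ⟨ε, by exact_mod_cast hε0, fun U₀ hU₀ _ hsmall => ?_⟩
    obtain ⟨v₀, hv, hv₀, hnorm⟩ := hU₀.exists_stronglyMeasurable
    have hfin := hU₀.2
    rw [hnorm] at hfin hsmall
    rw [ENNReal.ofReal_coe_nnreal] at hsmall
    refine Micropolar.exists_unique_isMildSolution hr hα hv hfin hv₀ ?_
    refine (hle D r ⊤ v₀ hr hv).trans (le_trans ?_ hηC)
    gcongr
    exact (hsmall.trans hε).le
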